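/- Let $q\ge 2$, $d\ge 1$, and let $\mathcal T$ be a complete, deterministic, subsequential transducer with finitely many states, all accessible from the initial state, with input alphabet $\{0,\dots,q-1\}^d$, real output labels on the transitions and a real final output for every state. For $\boldsymbol n\in\mathbb N_0^d$ let $\boldsymbol b(\boldsymbol n)$ be the vector, indexed by the states $s$, of the sums of all outputs (including the final output) when $\mathcal T$ starts in $s$ and reads the standard joint $q$-ary expansion of $\boldsymbol n$, least significant digits first and without leading zeros; let $\mathcal T(\boldsymbol n)$ be its entry at the initial state. A final component is a strongly connected component of the underlying digraph that no transition leaves; its period is the greatest common divisor of the lengths of its directed cycles. Let $C_1,\dots,C_c$ be the final components and let the final period $p$ be the least common multiple of their periods. For $t\in\mathbb R$ let $M(t)$ be the matrix whose $(s,s')$ entry is $\sum e^{it\delta}$ over all transitions from $s$ to $s'$, where $\delta$ is the output label. For $t$ near $0$ let $\mu_j(t)$ be the continuous branch with $\mu_j(0)=q^d$ of eigenvalues of the restriction of $M(t)$ to $C_j$. For $l\in\mathbb Z$ let $\boldsymbol w_l^\top(t)$ be the image of the indicator row vector of the initial state under the projection onto the left eigenspaces of $M(t)$ for the eigenvalues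 $\mu_j(t)e^{2\pi i l/p}$, $1\le j\le c$, along the remaining generalized left eigenspaces. The functions $\mu_j$ and $\boldsymbol w_0$ are differentiable at $t=0$. Write $\boldsymbol w_l=\boldsymbol w_l(0)$ and $\boldsymbol w_0'$ for the derivative of $\boldsymbol w_0(t)$ at $t=0$, let $\boldsymbol 1$ be the all-ones vector, and put $$e_{\mathcal T}=\sum_{j=1}^c\Bigl(\sum_{s\in C_j}(\boldsymbol w_0)_s\Bigr)\bigl(-iq^{-d}\mu_j'(0)\bigr),\qquad \chi_k=\frac{2\pi i k}{p\log q}\quad(k\in\mathbb Z).$$ There is exactly one $p$-periodic, Hölder continuous function $\Psi_1\colon\mathbb R\to\mathbb R$ such that, for some $\xi>0$, $$\frac1{N^d}\sum_{\boldsymbol n\in\{0,\dots,N-1\}^d}\mathcal T(\boldsymbol n)=e_{\mathcal T}\log_q N+\Psi_1(\log_q N)+\mathcal O(N^{-\xi}\log N)\qquad(N\to\infty).$$ The Dirichlet series $\boldsymbol H(z)=\sum_{\boldsymbol n\in\mathbb N_0^d,\ \boldsymbol n\ne 0}\boldsymbol b(\boldsymbol n)\lVert\boldsymbol n\rVert_\infty^{-z}$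 converges absolutely for $\Re z>d$. For every $k\in\mathbb Z$ the function $\boldsymbol w_k^\top\boldsymbol H(z)$ has a meromorphic continuation to $\Re z>d-1$, which is analytic except for possible poles at $z=d$ and at the points $z=d+\chi_m$ with $m\equiv k\pmod p$. The pole at $z=d$ is at most double if $p\mid k$ and at most simple otherwise, and the poles at $d+\chi_m$ with $m\ne0$ are at most simple. The Fourier coefficients $c_k=\frac1p\int_0^p\Psi_1(x)e^{-2\pi i kx/p}\,dx$ are $$c_0=-\frac{e_{\mathcal T}}{d\log q}-i\,\boldsymbol w_0'^{\top}\boldsymbol 1+\frac1d\operatorname*{Res}_{z=d}\boldsymbol w_0^\top\boldsymbol H(z),\qquad c_k=\frac1{d+\chi_k}\operatorname*{Res}_{z=d+\chi_k}\boldsymbol w_k^\top\boldsymbol H(z)\quad(k\ne0).$$ The Fourier series $\sum_{k\in\mathbb Z}c_k e^{2\pi i kx/p}$ converges absolutely and uniformly, with sum $\Psi_1(x)$. -/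

import Mathlib

open Filter Topology Asymptotics
open scoped NNReal

/-- A complete, deterministic, subsequential transducer with set of states `σ`, input alphabet
`{0, …, q-1}^d` and output alphabet `ℝ`. Completeness and determinism are built in: each state has
exactly one outgoing transition for each input digit vector. -/
structure DigitTransducer (q d : ℕ) (σ : Type*) where
  /-- the initial state -/
  init : σ
  /-- the target of the transition with the given source and input label -/
  next : σ → (Fin d → Fin q) → σ
  /-- the output label of that transition -/
  out : σ → (Fin d → Fin q) → ℝ
  /-- the final output label of a state -/
  final : σ → ℝ

/-- The standard `q`-ary joint digit expansion of `n`, least significant digit vector first, without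
leading zeros; the expansion of `0` is empty. -/
def jointDigits (q : ℕ) [NeZero q] {d : ℕ} (n : Fin d → ℕ) : List (Fin d → Fin q) :=
  (List.range (Finset.univ.sup fun i => (Nat.digits q (n i)).length)).map
    fun j i => Fin.ofNat q (n i / q ^ j)

/-- The image of `v` under the projection onto the sum of the generalized eigenspaces of `f` for the
eigenvalues in `S`, along the sum of the remaining generalized eigenspaces: a vector `w` of the
former sum such that `v - w` is in the latter. See `spectralProjection_spec` and
`spectralProjection_unique`. -/
noncomputable def spectralProjection {V : Type*} [AddCommGroup V] [Module ℂ V]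
    (f : Module.End ℂ V) (S : Set ℂ) (v : V) : V :=
  haveI : Nonempty V := ⟨0⟩
  Classical.epsilon fun w => w ∈ (⨆ μ ∈ S, f.maxGenEigenspace μ) ∧
    v - w ∈ (⨆ μ ∈ Sᶜ, f.maxGenEigenspace μ)

theorem spectralProjection_spec {V : Type*} [AddCommGroup V] [Module ℂ V] [FiniteDimensional ℂ V]
    (f : Module.End ℂ V) (S : Set ℂ) (v : V) :
    spectralProjection f S v ∈ (⨆ μ ∈ S, f.maxGenEigenspace μ) ∧
      v - spectralProjection f S v ∈ (⨆ μ ∈ Sᶜ, f.maxGenEigenspace μ) := by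
  refine Classical.epsilon_spec (p := fun w => w ∈ (⨆ μ ∈ S, f.maxGenEigenspace μ) ∧
    v - w ∈ (⨆ μ ∈ Sᶜ, f.maxGenEigenspace μ)) ?_
  have h : v ∈ (⨆ μ ∈ S, f.maxGenEigenspace μ) ⊔ (⨆ μ ∈ Sᶜ, f.maxGenEigenspace μ) := by
    rw [← iSup_union, Set.union_compl_self]
    simp [Module.End.iSup_maxGenEigenspace_eq_top]
  obtain ⟨a, ha, b, hb, rfl⟩ := Submodule.mem_sup.mp h
  exact ⟨a, ha, by simpa using hb⟩

theorem spectralProjection_unique {V : Type*} [AddCommGroup V] [Module ℂ V]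
    [FiniteDimensional ℂ V] (f : Module.End ℂ V) (S : Set ℂ) (v w : V)
    (hw : w ∈ (⨆ μ ∈ S, f.maxGenEigenspace μ))
    (hw' : v - w ∈ (⨆ μ ∈ Sᶜ, f.maxGenEigenspace μ)) :
    w = spectralProjection f S v := by
  obtain ⟨h1, h2⟩ := spectralProjection_spec f S v
  have hd : Disjoint (⨆ μ ∈ S, f.maxGenEigenspace μ) (⨆ μ ∈ Sᶜ, f.maxGenEigenspace μ) :=
    f.independent_maxGenEigenspace.disjoint_biSup_biSup disjoint_compl_right
  refine sub_eq_zero.mp (Submodule.disjoint_def.mp hd _ (Submodule.sub_mem _ hw h1) ?_)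
  have := Submodule.sub_mem _ h2 hw'
  simpa using this

namespace DigitTransducer

variable {q d : ℕ} {σ : Type*} (T : DigitTransducer q d σ)

/-- The state reached from `s` by reading a word. -/
def run (s : σ) (w : List (Fin d → Fin q)) : σ := w.foldl T.next s

/-- The sum of the outputs, including the final output, when reading a word from state `s`. -/
def wordOutput : σ → List (Fin d → Fin q) → ℝ
  | s, [] => T.final s
  | s, ε :: w => T.out s ε + wordOutput (T.next s ε) w

/-- The vector `b(n)`: output sums for the input `n`, indexed by the state where one starts. -/
def outputVec [NeZero q] (n : Fin d → ℕ) (s : σ) : ℝ := T.wordOutput s (jointDigits q n)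

/-- The value `T(n)` of the sequence defined by the transducer. -/
def value [NeZero q] (n : Fin d → ℕ) : ℝ := T.outputVec n T.init

/-- The expectation of `T(n)` for `n` equidistributed in `{0, …, N-1}^d`. -/
noncomputable def expectation [NeZero q] (N : ℕ) : ℝ :=
  (∑ n : Fin d → Fin N, T.value fun i => (n i : ℕ)) / (N : ℝ) ^ d

/-- Reachability in the underlying digraph. -/
def Reachable (s t : σ) : Prop := ∃ w, T.run s w = t

/-- `C` is a strongly connected component without outgoing transitions. -/
def IsFinalComponent (C : Finset σ) : Prop :=
  (∃ s, ∀ t, t ∈ C ↔ T.Reachable s t ∧ T.Reachable t s) ∧ ∀ t ∈ C, ∀ ε, T.next t ε ∈ C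

/-- The period of a component `C`: the greatest common divisor of the lengths of all closed directed
walks (equivalently, of all directed cycles) in `C`. -/
noncomputable def period (C : Finset σ) : ℕ :=
  sSup {g : ℕ | ∀ s ∈ C, ∀ w : List (Fin d → Fin q), w ≠ [] → T.run s w = s → g ∣ w.length}

section Matrices

variable [Fintype σ] [DecidableEq σ]

open Classical in
/-- The set of final strongly connected components. -/
noncomputable def finalComponents : Finset (Finset σ) :=
  Finset.univ.filter T.IsFinalComponent

/-- The final period `p`. -/
noncomputable def finalPeriod : ℕ := T.finalComponents.lcm T.period

/-- The transition matrix `M_ε(t)`. -/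
noncomputable def digitMatrix (ε : Fin d → Fin q) (t : ℝ) : Matrix σ σ ℂ :=
  Matrix.of fun s s' => if T.next s ε = s' then Complex.exp (Complex.I * t * T.out s ε) else 0

/-- The matrix `M(t) = ∑_ε M_ε(t)`. -/
noncomputable def matrix (t : ℝ) : Matrix σ σ ℂ := ∑ ε, T.digitMatrix ε t

/-- The restriction of `M(t)` to the states in `C`. -/
noncomputable def componentMatrix (C : Finset σ) (t : ℝ) : Matrix C C ℂ :=
  (T.matrix t).submatrix Subtype.val Subtype.val

/-- The function `μ_C(t)` of a final component `C`: the eigenvalue of the restriction of `M(t)` to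
`C` that is closest to `q^d`. At `t = 0` it is the simple eigenvalue `q^d`, so for `t` near `0` this
is the unique continuous branch of eigenvalues that starts in `q^d`. -/
noncomputable def dominantEigenvalue (C : Finset σ) (t : ℝ) : ℂ :=
  Classical.epsilon fun μ => μ ∈ spectrum ℂ (T.componentMatrix C t) ∧
    ∀ ν ∈ spectrum ℂ (T.componentMatrix C t), ‖μ - (q : ℂ) ^ d‖ ≤ ‖ν - (q : ℂ) ^ d‖

/-- The set of the numbers `μ_C(t) exp(2πil/p)`, where `C` runs through the final components. -/
noncomputable def dominantEigenvalues (l : ℤ) (t : ℝ) : Set ℂ :=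
  {z | ∃ C ∈ T.finalComponents, z = T.dominantEigenvalue C t *
    Complex.exp (2 * Real.pi * Complex.I * l / T.finalPeriod)}

/-- The vector `w_l(t)`: the image of the indicator (row) vector of the initial state under the
projection onto the left eigenspaces of `M(t)` for the eigenvalues `μ_C(t) exp(2πil/p)` along the
remaining generalized left eigenspaces. (For `t` near `0` these eigenvalues are semisimple, so their
generalized eigenspaces are their eigenspaces.) -/
noncomputable def leftVec (l : ℤ) (t : ℝ) : σ → ℂ :=
  spectralProjection (T.matrix t).vecMulLinear (T.dominantEigenvalues l t) (Pi.single T.init 1)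

/-- The weight `λ_C = w_0ᵀ 1_C` of a final component. -/
noncomputable def weight (C : Finset σ) : ℂ := ∑ s ∈ C, T.leftVec 0 0 s

/-- The constant `a_C = -i q^{-d} μ_C'(0)` of a final component. -/
noncomputable def drift (C : Finset σ) : ℂ :=
  -Complex.I * ((q : ℂ) ^ d)⁻¹ * deriv (T.dominantEigenvalue C) 0

/-- The constant `e_T = ∑_C λ_C a_C`. -/
noncomputable def meanConstant : ℂ := ∑ C ∈ T.finalComponents, T.weight C * T.drift C

/-- `χ_k = 2πik / (p log q)`. -/
noncomputable def chi (k : ℤ) : ℂ :=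
  2 * Real.pi * Complex.I * k / (T.finalPeriod * Real.log q)

/-- `Ψ` is the periodic fluctuation `Ψ₁` of the expected value: it is `p`-periodic, Hölder
continuous, and `E(T(n)) = e_T log_q N + Ψ(log_q N) + O(N^{-ξ} log N)` for some `ξ > 0`. -/
def IsFluctuation [NeZero q] (Ψ : ℝ → ℝ) : Prop :=
  Function.Periodic Ψ T.finalPeriod ∧
  (∃ C α : ℝ≥0, 0 < α ∧ HolderWith C α Ψ) ∧
  ∃ ξ : ℝ, 0 < ξ ∧
    (fun N : ℕ => (T.expectation N : ℂ) - T.meanConstant * (Real.logb q N : ℂ)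
      - (Ψ (Real.logb q N) : ℂ)) =O[atTop] fun N : ℕ => (N : ℝ) ^ (-ξ) * Real.log N

/-- The `k`-th Fourier coefficient of a `p`-periodic function. -/
noncomputable def fourierCoefficient (Ψ : ℝ → ℝ) (k : ℤ) : ℂ :=
  (T.finalPeriod : ℂ)⁻¹ * ∫ x in (0 : ℝ)..T.finalPeriod,
    (Ψ x : ℂ) * Complex.exp (-(2 * Real.pi * Complex.I * k / T.finalPeriod * x))

end Matrices

/-- The summand `b(n) ‖n‖_∞^{-z}` of the Dirichlet series, in coordinate `s`. -/
noncomputable def dirichletTerm [NeZero q] (z : ℂ) (s : σ) (n : {n : Fin d → ℕ // n ≠ 0}) : ℂ :=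
  (T.outputVec n.1 s : ℂ) * ((Finset.univ.sup n.1 : ℕ) : ℂ) ^ (-z)

/-- The vector-valued Dirichlet series `H(z) = ∑_{n ≠ 0} b(n) ‖n‖_∞^{-z}`. -/
noncomputable def dirichletSeries [NeZero q] (z : ℂ) (s : σ) : ℂ :=
  ∑' n, T.dirichletTerm z s n

end DigitTransducer

/-- `ρ` is the residue of `f` at `z₀`: the coefficient of `(z - z₀)⁻¹` in a Laurent expansion with
finite principal part. -/
def HasResidueAt (f : ℂ → ℂ) (z₀ ρ : ℂ) : Prop :=
  ∃ (m : ℕ) (a : ℕ → ℂ) (g : ℂ → ℂ), a 0 = ρ ∧ AnalyticAt ℂ g z₀ ∧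
    ∀ᶠ z in 𝓝[≠] z₀, f z = (∑ j ∈ Finset.range (m + 1), a j / (z - z₀) ^ (j + 1)) + g z

/-! Write `M` for `M(0)`, `ζ` for `exp(2πi/p)`, and `B(N)` for the vector of the sums of `b(n)` over
the box of side `N` (`boxSum`). Splitting off the least significant digit gives `B(qm) = M B(m) +
m^d O + const`, where `O` collects the outputs of the transitions (`boxSum_mul`). The row sums of
`M` are `q^d`, so eigenvalues of modulus `q^d` are maximal and semisimple. By the maximum principle
such an eigenvector keeps its maximal modulus along all paths into a final component and only
rotates there; hence these eigenvalues are `q^d` times `p`-th roots of unity. The Fredholm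
alternative yields `O = q^d E + (q^d - M) K` with `M E = q^d E` and `w_0 · K = 0`. Then `G(N) = B(N)
- N^d log_q N E - N^d K` satisfies `G(N) = M G(⌊N/q⌋) + O((N+1)^a)` for every `a > d - 1`.

Pairing with the left eigenvector `w_l` leaves a scalar recursion `g(N) ≈ λ g(⌊N/q⌋)` with `λ = q^d
ζ^l`. The limits of `λ^(-m) g(⌊q^m y⌋)` exist, approximate `g`, are multiplied by `λ` when `y` is
replaced by `qy`, and are locally Hölder. Divided by `y^d` they give fluctuations with `Φ_l(x+1) =
ζ^l Φ_l(x)`. The part of the initial indicator vector outside the spans of the `w_l` grows more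
slowly under `M` and goes into the error term. Hence `Ψ₁ = K_init + ∑_l Φ_l`. It is real and unique
because a continuous periodic function is determined by its asymptotic values at `log_q N`.

The constants come from perturbation theory. The simple dominant eigenvalue of each final component
has differentiable left and right eigenvectors. Differentiating `M(t) v_C(t) = μ_C(t) v_C(t)` and
`w_0(t) · v_C(t) = v_C(t)_init`, and summing over `C`, gives `E_init = e_T` and `K_init = -i w_0' ·
1` (`exists_mean_decomposition`).

By partial summation `w_k · H(z)` is `z` times a Mellin integral of `w_k · (B(⌊t⌋+1) - B(1))`. Its
main terms `t^d log t`, `t^d` and `t^d Φ_k(log_q t)` have explicit transforms, the last being an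
entire function over `1 - ζ^k q^(d-z)`; the remainder is analytic for `Re z > d - 1`
(`exists_meromorphic_continuation`). At `d + χ_k` the last term has residue `d + χ_k` times the
`k`-th Fourier coefficient of `Φ_k`, which differs from that of `Ψ₁` only for `k = 0`, by `K_init`.
Since `Ψ₁` is Hölder of every order below 1, Bernstein's theorem makes its Fourier series converge
absolutely. -/

set_option linter.unusedSectionVars false

/-! ### Semisimplicity of peripheral eigenvalues of operators with bounded orbits. -/

section PowerBounded

variable {V : Type*} [NormedAddCommGroup V] [NormedSpace ℂ V] {f : Module.End ℂ V} {c : ℝ}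

theorem Module.End.pow_apply_of_apply_eq_smul {μ : ℂ} {x : V} (hx : f x = μ • x) (j : ℕ) :
    (f ^ j) x = μ ^ j • x := by
  induction j with
  | zero => simp
  | succ j ih => rw [pow_succ', Module.End.mul_apply, ih, map_smul, hx, smul_smul, pow_succ]

/-- An eigenvalue of an operator with orbits of size `O(c ^ j)` has modulus at most `c`. -/
theorem Module.End.norm_eigenvalue_le_of_pow_bounded (hc : 0 < c)
    (hf : ∀ x, ∃ B, ∀ j : ℕ, ‖(f ^ j) x‖ ≤ B * c ^ j) {μ : ℂ} {x : V} (hx0 : x ≠ 0)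
    (hx : f x = μ • x) : ‖μ‖ ≤ c := by
  by_contra! h
  obtain ⟨B, hB⟩ := hf x
  have h1 : 1 < ‖μ‖ / c := (one_lt_div hc).2 h
  obtain ⟨j, hj⟩ := pow_unbounded_of_one_lt (B / ‖x‖) h1
  have hj' := hB j
  rw [Module.End.pow_apply_of_apply_eq_smul hx, norm_smul, norm_pow] at hj'
  have hx' : 0 < ‖x‖ := norm_pos_iff.2 hx0
  rw [div_lt_iff₀ hx', div_pow, div_mul_eq_mul_div, lt_div_iff₀ (by positivity)] at hj
  linarith

/-- A Jordan chain `x`, `y` of length two would put a term `j μ^(j-1) y` into `f^j x`, which grows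
faster than `c^j` unless `y = 0`. -/
theorem Module.End.apply_eq_smul_of_pow_bounded (hc : 0 < c)
    (hf : ∀ x, ∃ B, ∀ j : ℕ, ‖(f ^ j) x‖ ≤ B * c ^ j) {μ : ℂ} (hμ : ‖μ‖ = c) {x : V}
    (hx : f (f x - μ • x) = μ • (f x - μ • x)) : f x = μ • x := by
  set y := f x - μ • x with hy
  have hfx : f x = μ • x + y := by rw [hy]; abel
  have hμ0 : μ ≠ 0 := by rintro rfl; simp at hμ; exact hc.ne hμ
  have key : ∀ j : ℕ, μ • (f ^ j) x = μ ^ (j + 1) • x + ((j : ℂ) * μ ^ j) • y := by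
    intro j
    induction j with
    | zero => simp
    | succ j ih =>
      rw [pow_succ', Module.End.mul_apply, ← map_smul, ih, map_add, map_smul, map_smul, hx, hfx]
      simp only [smul_add, smul_smul]
      push_cast
      module
  obtain ⟨B, hB⟩ := hf x
  have hbound : ∀ j : ℕ, (j : ℝ) * ‖y‖ ≤ c * B + c * ‖x‖ := by
    intro j
    have h1 : ((j : ℂ) * μ ^ j) • y = μ • (f ^ j) x - μ ^ (j + 1) • x := by rw [key j]; abel
    have h2 : ‖((j : ℂ) * μ ^ j) • y‖ ≤ ‖μ • (f ^ j) x‖ + ‖μ ^ (j + 1) • x‖ := by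
      rw [h1]; exact norm_sub_le _ _
    simp only [norm_smul, norm_mul, norm_pow, hμ, Complex.norm_natCast] at h2
    have hcj : 0 < c ^ j := by positivity
    refine le_of_mul_le_mul_right ?_ hcj
    calc (j : ℝ) * ‖y‖ * c ^ j = j * c ^ j * ‖y‖ := by ring
      _ ≤ c * (B * c ^ j) + c ^ (j + 1) * ‖x‖ := h2.trans (by gcongr; exact hB j)
      _ = _ := by ring
  have hy0 : y = 0 := by
    by_contra hne
    have hpos : 0 < ‖y‖ := norm_pos_iff.2 hne
    obtain ⟨j, hj⟩ := exists_nat_gt ((c * B + c * ‖x‖) / ‖y‖)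
    rw [div_lt_iff₀ hpos] at hj
    linarith [hbound j]
  rw [hfx, hy0, add_zero]

theorem Module.End.maxGenEigenspace_eq_eigenspace_of_pow_bounded (hc : 0 < c)
    (hf : ∀ x, ∃ B, ∀ j : ℕ, ‖(f ^ j) x‖ ≤ B * c ^ j) {μ : ℂ} (hμ : ‖μ‖ = c) :
    f.maxGenEigenspace μ = f.eigenspace μ := by
  refine le_antisymm (fun x hx => ?_) Module.End.eigenspace_le_maxGenEigenspace
  obtain ⟨k, hk⟩ := (Module.End.mem_maxGenEigenspace f μ x).1 hx
  rw [Module.End.mem_eigenspace_iff]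
  clear hx
  induction k generalizing x with
  | zero => simp only [pow_zero, Module.End.one_apply] at hk; simp [hk]
  | succ k ih =>
    rw [pow_succ, Module.End.mul_apply] at hk
    have := ih _ hk
    refine Module.End.apply_eq_smul_of_pow_bounded hc hf hμ ?_
    simpa using this

/-- Polynomial factors are absorbed by the gap between `‖μ‖` and `θ`. The induction on the
nilpotency index only needs a constant `A` with `‖μ‖ A + C ≤ θ A`. -/
theorem Module.End.exists_norm_pow_le_of_mem_maxGenEigenspace {μ : ℂ} {θ : ℝ} (hμ : ‖μ‖ < θ) {x : V}
    (hx : x ∈ f.maxGenEigenspace μ) : ∃ C, ∀ j : ℕ, ‖(f ^ j) x‖ ≤ C * θ ^ j := by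
  obtain ⟨k, hk⟩ := (Module.End.mem_maxGenEigenspace f μ x).1 hx
  clear hx
  induction k generalizing x with
  | zero => simp only [pow_zero, Module.End.one_apply] at hk; exact ⟨0, by simp [hk]⟩
  | succ k ih =>
    rw [pow_succ, Module.End.mul_apply] at hk
    obtain ⟨C, hC⟩ := ih hk
    have hθ : 0 < θ := (norm_nonneg μ).trans_lt hμ
    have hC0 : 0 ≤ C := by have := (norm_nonneg _).trans (hC 0); simpa using this
    set A := max ‖x‖ (C / (θ - ‖μ‖)) with hA
    have hA' : ‖μ‖ * A + C ≤ θ * A := by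
      have h1 : C / (θ - ‖μ‖) ≤ A := le_max_right _ _
      rw [div_le_iff₀ (by linarith)] at h1
      linarith
    refine ⟨A, fun j => ?_⟩
    induction j with
    | zero => simp [hA]
    | succ j ihj =>
      have hfx : f x = μ • x + (f - μ • 1) x := by simp
      have h2 : (f ^ (j + 1)) x = μ • (f ^ j) x + (f ^ j) ((f - μ • 1) x) := by
        rw [pow_succ, Module.End.mul_apply, hfx, map_add, map_smul]
      rw [h2]
      have hθj : 0 < θ ^ j := by positivity
      calc _ ≤ ‖μ‖ * ‖(f ^ j) x‖ + ‖(f ^ j) ((f - μ • 1) x)‖ := by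
            rw [← norm_smul]; exact norm_add_le _ _
        _ ≤ ‖μ‖ * (A * θ ^ j) + C * θ ^ j := by
            gcongr
            have := hC j
            simpa using this
        _ = (‖μ‖ * A + C) * θ ^ j := by ring
        _ ≤ (θ * A) * θ ^ j := by gcongr
        _ = _ := by ring

/-- The vectors whose orbit is of size `O(θ ^ j)`. -/
def orbitBoundSubmodule (f : Module.End ℂ V) (θ : ℝ) : Submodule ℂ V where
  carrier := {x | ∃ C, ∀ j : ℕ, ‖(f ^ j) x‖ ≤ C * θ ^ j}
  zero_mem' := ⟨0, by simp⟩
  add_mem' := by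
    rintro x y ⟨C, hC⟩ ⟨D, hD⟩
    refine ⟨C + D, fun j => ?_⟩
    rw [map_add, add_mul]
    exact (norm_add_le _ _).trans (add_le_add (hC j) (hD j))
  smul_mem' := by
    rintro a x ⟨C, hC⟩
    refine ⟨‖a‖ * C, fun j => ?_⟩
    rw [map_smul, norm_smul, mul_assoc]
    exact mul_le_mul_of_nonneg_left (hC j) (norm_nonneg _)

/-- There are finitely many eigenvalues, so one `θ < c` lies above the moduli of all those in `S`.
-/
theorem Module.End.exists_norm_pow_le_of_mem_iSup [FiniteDimensional ℂ V] {S : Set ℂ} (hc : 0 < c)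
    (hS : ∀ μ ∈ S, f.HasEigenvalue μ → ‖μ‖ < c) {x : V}
    (hx : x ∈ ⨆ μ ∈ S, f.maxGenEigenspace μ) :
    ∃ θ C : ℝ, 0 < θ ∧ θ < c ∧ ∀ j : ℕ, ‖(f ^ j) x‖ ≤ C * θ ^ j := by
  classical
  have hfin := f.finite_hasEigenvalue
  obtain ⟨θ, hθ0, hθc, hθ⟩ : ∃ θ : ℝ, 0 < θ ∧ θ < c ∧ ∀ μ ∈ S, f.HasEigenvalue μ → ‖μ‖ < θ := by
    have : ∀ᶠ θ in 𝓝[<] c, ∀ μ ∈ {μ | f.HasEigenvalue μ}, μ ∈ S → ‖μ‖ < θ := by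
      refine (Filter.eventually_all_finite hfin).2 fun μ hμ => ?_
      by_cases hμS : μ ∈ S
      · filter_upwards [Ioo_mem_nhdsLT (hS μ hμS hμ)] with θ hθ _ using hθ.1
      · simp [hμS]
    obtain ⟨θ, h1, h2⟩ := (this.and (Ioo_mem_nhdsLT hc)).exists
    exact ⟨θ, h2.1, h2.2, fun μ hμ h => h1 μ h hμ⟩
  have hle : (⨆ μ ∈ S, f.maxGenEigenspace μ) ≤ orbitBoundSubmodule f θ := by
    refine iSup₂_le fun μ hμ x hx => ?_
    by_cases h0 : x = 0
    · rw [h0]; exact Submodule.zero_mem _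
    · refine Module.End.exists_norm_pow_le_of_mem_maxGenEigenspace (hθ μ hμ ?_) hx
      refine Module.End.HasUnifEigenvalue.lt (k := ⊤) zero_lt_one ?_
      intro h
      rw [Module.End.maxGenEigenspace, h] at hx
      exact h0 (by simpa using hx)
  obtain ⟨C, hC⟩ := hle hx
  exact ⟨θ, C, hθ0, hθc, hC⟩

end PowerBounded

/-! ### Matrices with bounded row sums: left and right eigenvectors, Fredholm alternative. -/

section MatrixPowerBounded

variable {n : Type*} [Fintype n] {A : Matrix n n ℂ} {c : ℝ}

theorem Matrix.norm_mulVec_le_of_row_sum_le (hc : 0 ≤ c) (hA : ∀ s, ∑ t, ‖A s t‖ ≤ c) (x : n → ℂ) :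
    ‖A.mulVec x‖ ≤ c * ‖x‖ := by
  refine (pi_norm_le_iff_of_nonneg (by positivity)).2 fun s => ?_
  calc ‖∑ t, A s t * x t‖ ≤ ∑ t, ‖A s t‖ * ‖x‖ := by
        refine (norm_sum_le _ _).trans (Finset.sum_le_sum fun t _ => ?_)
        rw [norm_mul]
        exact mul_le_mul_of_nonneg_left (norm_le_pi_norm x t) (norm_nonneg _)
    _ ≤ c * ‖x‖ := by
        rw [← Finset.sum_mul]
        exact mul_le_mul_of_nonneg_right (hA s) (norm_nonneg _)

theorem Matrix.norm_mulVecLin_pow_le (hc : 0 ≤ c) (hA : ∀ s, ∑ t, ‖A s t‖ ≤ c) (x : n → ℂ) (j : ℕ) :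
    ‖(A.mulVecLin ^ j) x‖ ≤ ‖x‖ * c ^ j := by
  induction j with
  | zero => simp
  | succ j ih =>
    rw [pow_succ', Module.End.mul_apply, Matrix.mulVecLin_apply]
    refine (Matrix.norm_mulVec_le_of_row_sum_le hc hA _).trans ?_
    calc c * _ ≤ c * (‖x‖ * c ^ j) := by gcongr
      _ = _ := by ring

theorem Matrix.vecMulLinear_pow_apply_dotProduct (x y : n → ℂ) (j : ℕ) :
    (A.vecMulLinear ^ j) x ⬝ᵥ y = x ⬝ᵥ (A.mulVecLin ^ j) y := by
  induction j generalizing x with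
  | zero => simp
  | succ j ih =>
    rw [pow_succ, Module.End.mul_apply, ih, Matrix.vecMulLinear_apply, ← Matrix.dotProduct_mulVec,
      ← Matrix.mulVecLin_apply, ← Module.End.mul_apply, ← pow_succ']

theorem Matrix.norm_dotProduct_le (x y : n → ℂ) : ‖x ⬝ᵥ y‖ ≤ (∑ s, ‖x s‖) * ‖y‖ := by
  rw [dotProduct, Finset.sum_mul]
  refine (norm_sum_le _ _).trans (Finset.sum_le_sum fun t _ => ?_)
  rw [norm_mul]
  exact mul_le_mul_of_nonneg_left (norm_le_pi_norm y t) (norm_nonneg _)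

/-- Row sums control the action on columns; pairing with unit vectors transfers the bound to the
action on rows. -/
theorem Matrix.norm_vecMulLinear_pow_le [DecidableEq n] (hc : 0 ≤ c) (hA : ∀ s, ∑ t, ‖A s t‖ ≤ c) (x : n → ℂ)
    (j : ℕ) : ‖(A.vecMulLinear ^ j) x‖ ≤ (∑ s, ‖x s‖) * c ^ j := by
  have h0 : 0 ≤ ∑ s, ‖x s‖ := Finset.sum_nonneg fun s _ => norm_nonneg _
  refine (pi_norm_le_iff_of_nonneg (by positivity)).2 fun s => ?_
  have h := Matrix.vecMulLinear_pow_apply_dotProduct (A := A) x (Pi.single s 1) j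
  rw [dotProduct_single, mul_one] at h
  rw [h]
  refine (Matrix.norm_dotProduct_le _ _).trans (mul_le_mul_of_nonneg_left ?_ h0)
  refine (Matrix.norm_mulVecLin_pow_le hc hA _ j).trans ?_
  rw [Pi.norm_single]
  simp

/-- Vectors in left generalized eigenspaces are orthogonal to right eigenvectors for different
eigenvalues. -/
theorem Matrix.dotProduct_eq_zero_of_mem_iSup {S : Set ℂ} {x y : n → ℂ} {μ : ℂ} (hμ : μ ∉ S)
    (hx : x ∈ ⨆ ν ∈ S, Module.End.maxGenEigenspace A.vecMulLinear ν) (hy : A.mulVec y = μ • y) :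
    x ⬝ᵥ y = 0 := by
  let L : (n → ℂ) →ₗ[ℂ] ℂ :=
    { toFun := fun x => x ⬝ᵥ y
      map_add' := fun a b => add_dotProduct a b y
      map_smul' := fun a b => smul_dotProduct a b y }
  suffices h : (⨆ ν ∈ S, Module.End.maxGenEigenspace A.vecMulLinear ν) ≤ LinearMap.ker L from h hx
  refine iSup₂_le fun ν hν x hx => ?_
  obtain ⟨k, hk⟩ := (Module.End.mem_maxGenEigenspace _ ν x).1 hx
  clear hx
  change x ⬝ᵥ y = 0
  induction k generalizing x with
  | zero => simp only [pow_zero, Module.End.one_apply] at hk; simp [hk]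
  | succ k ih =>
    rw [pow_succ, Module.End.mul_apply] at hk
    have h := ih _ hk
    have h' : A.vecMul x ⬝ᵥ y - ν * (x ⬝ᵥ y) = 0 := by simpa [sub_dotProduct] using h
    rw [← Matrix.dotProduct_mulVec, hy, dotProduct_smul, smul_eq_mul, ← sub_mul] at h'
    refine (mul_eq_zero.1 h').resolve_left (sub_ne_zero.2 ?_)
    rintro rfl
    exact hμ hν

variable {μ : ℂ}

theorem Matrix.mulVec_eq_smul_of_row_sum_le (hc : 0 < c) (hA : ∀ s, ∑ t, ‖A s t‖ ≤ c)
    (hμ : ‖μ‖ = c) {x : n → ℂ}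
    (hx : A.mulVec (A.mulVec x - μ • x) = μ • (A.mulVec x - μ • x)) : A.mulVec x = μ • x :=
  Module.End.apply_eq_smul_of_pow_bounded (f := A.mulVecLin) hc
    (fun x => ⟨‖x‖, Matrix.norm_mulVecLin_pow_le hc.le hA x⟩) hμ hx

/-- Fredholm alternative for peripheral eigenvalues. -/
theorem Matrix.exists_eq_add_of_row_sum_le (hc : 0 < c) (hA : ∀ s, ∑ t, ‖A s t‖ ≤ c)
    (hμ : ‖μ‖ = c) (x : n → ℂ) :
    ∃ a b : n → ℂ, A.mulVec a = μ • a ∧ x = a + (A.mulVec b - μ • b) := by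
  set g : (n → ℂ) →ₗ[ℂ] (n → ℂ) := A.mulVecLin - μ • LinearMap.id with hg
  have hgx : ∀ x, g x = A.mulVec x - μ • x := fun x => by simp [hg]
  -- Semisimplicity of `μ` makes kernel and range of `A - μ` disjoint; by dimension they are
  -- complementary.
  have hdisj : Disjoint (LinearMap.ker g) (LinearMap.range g) := by
    rw [Submodule.disjoint_def]
    rintro _ hx ⟨y, rfl⟩
    rw [LinearMap.mem_ker, hgx, hgx, sub_eq_zero] at hx
    rw [hgx, Matrix.mulVec_eq_smul_of_row_sum_le hc hA hμ hx, sub_self]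
  have htop := Submodule.eq_top_of_disjoint _ _
    (by rw [add_comm, LinearMap.finrank_range_add_finrank_ker]) hdisj
  obtain ⟨a, ha, _, ⟨b, rfl⟩, hab⟩ := Submodule.mem_sup.1 (htop ▸ Submodule.mem_top : x ∈ _)
  refine ⟨a, b, ?_, ?_⟩
  · rw [LinearMap.mem_ker, hgx, sub_eq_zero] at ha; exact ha
  · rw [← hgx, hab]

/-- A left eigenvector annihilates the range of `A - μ`. If it also annihilates the kernel, the
Fredholm alternative leaves nothing else to test. -/
theorem Matrix.eq_zero_of_vecMul_eq_smul_of_dotProduct_eq_zero (hc : 0 < c)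
    (hA : ∀ s, ∑ t, ‖A s t‖ ≤ c) (hμ : ‖μ‖ = c) {a : n → ℂ} (ha : A.vecMul a = μ • a)
    (ha' : ∀ v, A.mulVec v = μ • v → a ⬝ᵥ v = 0) : a = 0 := by
  refine dotProduct_eq_zero_iff.1 fun x => ?_
  obtain ⟨y, z, hy, rfl⟩ := Matrix.exists_eq_add_of_row_sum_le hc hA hμ x
  rw [dotProduct_add, ha' y hy, dotProduct_sub, Matrix.dotProduct_mulVec, ha,
    dotProduct_smul, smul_dotProduct]
  simp

theorem Matrix.exists_mulVec_eq_smul_iff [DecidableEq n] :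
    (∃ v ≠ 0, A.mulVec v = μ • v) ↔ ∃ v ≠ 0, A.vecMul v = μ • v := by
  have h1 : ∀ v, A.mulVec v = μ • v ↔ (A - μ • (1 : Matrix n n ℂ)).mulVec v = 0 := fun v => by
    rw [Matrix.sub_mulVec, Matrix.smul_mulVec, Matrix.one_mulVec, sub_eq_zero]
  have h2 : ∀ v, A.vecMul v = μ • v ↔ (A - μ • (1 : Matrix n n ℂ)).vecMul v = 0 := fun v => by
    rw [Matrix.vecMul_sub, Matrix.vecMul_smul, Matrix.vecMul_one, sub_eq_zero]
  simp only [h1, h2]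
  rw [Matrix.exists_mulVec_eq_zero_iff, Matrix.exists_vecMul_eq_zero_iff]

theorem Matrix.exists_left_eigenvector_of_simple [DecidableEq n] (hc : 0 < c)
    (hA : ∀ s, ∑ t, ‖A s t‖ ≤ c) (hμ : ‖μ‖ = c) {v₀ : n → ℂ} (hv₀ : v₀ ≠ 0)
    (hv : A.mulVec v₀ = μ • v₀) (hsimple : ∀ v, A.mulVec v = μ • v → ∃ r : ℂ, v = r • v₀) :
    ∃ u₀ : n → ℂ, A.vecMul u₀ = μ • u₀ ∧ u₀ ⬝ᵥ v₀ = 1 := by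
  obtain ⟨a, ha0, ha⟩ := Matrix.exists_mulVec_eq_smul_iff.1 ⟨v₀, hv₀, hv⟩
  have hne : a ⬝ᵥ v₀ ≠ 0 := by
    intro h
    refine ha0 (Matrix.eq_zero_of_vecMul_eq_smul_of_dotProduct_eq_zero hc hA hμ ha fun v hv => ?_)
    obtain ⟨r, rfl⟩ := hsimple v hv
    rw [dotProduct_smul, h, smul_zero]
  refine ⟨(a ⬝ᵥ v₀)⁻¹ • a, ?_, ?_⟩
  · rw [Matrix.smul_vecMul, ha, smul_comm]
  · rw [smul_dotProduct, smul_eq_mul, inv_mul_cancel₀ hne]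

end MatrixPowerBounded

/-! ### Differentiable continuation of a simple eigenpair. -/

section Perturbation

variable {n : Type*} [Fintype n]

/-- A simple eigenvalue of a matrix that depends differentiably on a parameter, together with its
eigenvector, can be continued differentiably. -/
theorem Matrix.exists_differentiable_eigenpair {A : ℝ → Matrix n n ℂ}
    (hA : ∀ i j, ContDiff ℝ 1 fun t => A t i j) {μ₀ : ℂ} {u₀ v₀ : n → ℂ}
    (hu : (A 0).vecMul u₀ = μ₀ • u₀) (hv : (A 0).mulVec v₀ = μ₀ • v₀) (huv : u₀ ⬝ᵥ v₀ = 1)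
    (hsimple : ∀ x, (A 0).mulVec x = μ₀ • x → u₀ ⬝ᵥ x = 0 → x = 0) :
    ∃ (v : ℝ → n → ℂ) (μ : ℝ → ℂ), v 0 = v₀ ∧ μ 0 = μ₀ ∧ DifferentiableAt ℝ v 0 ∧
      DifferentiableAt ℝ μ 0 ∧ ∀ᶠ t in 𝓝 (0 : ℝ), (A t).mulVec (v t) = μ t • v t := by
  -- The normalisation `u₀ ⬝ᵥ v` as an additional component gives as many equations as unknowns, so
  -- that the implicit function theorem applies.
  let G : ℝ × ((n → ℂ) × ℂ) → (n → ℂ) × ℂ := fun p =>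
    ((A p.1).mulVec p.2.1 - p.2.2 • p.2.1, u₀ ⬝ᵥ p.2.1)
  have hG : ContDiff ℝ 1 G := by
    refine ContDiff.prodMk ?_ ?_
    · refine contDiff_pi.2 fun i => ?_
      simp only [Pi.sub_apply, Matrix.mulVec, dotProduct, Pi.smul_apply, smul_eq_mul]
      refine ContDiff.sub (ContDiff.sum fun j _ => ((hA i j).comp contDiff_fst).mul ?_)
        (ContDiff.mul (by fun_prop) ?_) <;> fun_prop
    · simp only [dotProduct]
      exact ContDiff.sum fun j _ => contDiff_const.mul (by fun_prop)
  have hstrict : HasStrictFDerivAt G (fderiv ℝ G (0, v₀, μ₀)) (0, v₀, μ₀) :=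
    hG.contDiffAt.hasStrictFDerivAt one_ne_zero
  set D : (n → ℂ) × ℂ →ₗ[ℝ] (n → ℂ) × ℂ :=
    { toFun := fun w => ((A 0).mulVec w.1 - μ₀ • w.1 - w.2 • v₀, u₀ ⬝ᵥ w.1)
      map_add' := fun a b => by
        ext <;> simp [Matrix.mulVec_add, dotProduct_add]; ring
      map_smul' := fun r a => by
        ext <;> simp [Matrix.mulVec_smul, dotProduct_smul]; ring } with hD
  have hpartial : HasFDerivAt (fun w => G (0, w)) (LinearMap.toContinuousLinearMap D) (v₀, μ₀) := by
    -- At `t = 0` the map is `D` plus a constant plus a product of two increments, which has zero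
    -- derivative.
    have hlin : ∀ w : (n → ℂ) × ℂ, G (0, w) = LinearMap.toContinuousLinearMap D w
        + (- ((w.2 - μ₀) • (w.1 - v₀)) + μ₀ • v₀, 0) := by
      intro w
      simp only [G, hD, LinearMap.coe_toContinuousLinearMap']
      ext <;> simp; ring
    have h2 : HasFDerivAt (fun w : (n → ℂ) × ℂ => (w.2 - μ₀) • (w.1 - v₀))
        (0 : (n → ℂ) × ℂ →L[ℝ] (n → ℂ)) (v₀, μ₀) := by
      have := (((hasFDerivAt_snd (𝕜 := ℝ) (p := (v₀, μ₀))).sub_const μ₀).smul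
        ((hasFDerivAt_fst (𝕜 := ℝ) (p := (v₀, μ₀))).sub_const v₀))
      have h0 : ((v₀, μ₀).2 - μ₀) • ContinuousLinearMap.fst ℝ (n → ℂ) ℂ +
          (ContinuousLinearMap.snd ℝ (n → ℂ) ℂ).smulRight ((v₀, μ₀).1 - v₀) = 0 := by
        ext <;> simp
      rw [h0] at this
      exact this
    have h3 := (LinearMap.toContinuousLinearMap D).hasFDerivAt.add
      ((h2.neg.add_const (μ₀ • v₀)).prodMk (hasFDerivAt_const (0 : ℂ) (v₀, μ₀)))
    have h4 : LinearMap.toContinuousLinearMap D +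
        ContinuousLinearMap.prod (-(0 : (n → ℂ) × ℂ →L[ℝ] (n → ℂ))) 0
          = LinearMap.toContinuousLinearMap D := by ext <;> simp
    rw [h4] at h3
    refine h3.congr_of_eventuallyEq (Eventually.of_forall fun w => ?_)
    exact hlin w
  have hcomp : fderiv ℝ G (0, v₀, μ₀) ∘L .inr ℝ ℝ ((n → ℂ) × ℂ)
      = LinearMap.toContinuousLinearMap D :=
    HasFDerivAt.unique (hstrict.hasFDerivAt.comp (v₀, μ₀) (hasFDerivAt_prodMk_right 0 (v₀, μ₀)))
      hpartial
  have hinj : Function.Injective D := by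
    rw [← LinearMap.ker_eq_bot, LinearMap.ker_eq_bot']
    rintro ⟨x, r⟩ h
    simp only [hD, LinearMap.coe_mk, AddHom.coe_mk, Prod.mk_eq_zero] at h
    -- Pairing with the left eigenvector `u₀` kills `(A 0 - μ₀) x` and isolates `r`.
    have hr : r = 0 := by
      have := congrArg (fun y => u₀ ⬝ᵥ y) h.1
      simpa [dotProduct_sub, Matrix.dotProduct_mulVec, hu, huv] using this
    subst hr
    rw [zero_smul, sub_zero, sub_eq_zero] at h
    rw [hsimple x h.1 h.2]; rfl
  have hinv : (fderiv ℝ G (0, v₀, μ₀) ∘L .inr ℝ ℝ ((n → ℂ) × ℂ)).IsInvertible := by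
    rw [hcomp]
    exact ⟨(LinearEquiv.ofInjectiveEndo D hinj).toContinuousLinearEquiv, by ext <;> simp⟩
  have hψ := hstrict.hasStrictFDerivAt_implicitFunctionOfProdDomain hinv
  have hψ0 : hstrict.implicitFunctionOfProdDomain hinv 0 = (v₀, μ₀) :=
    (hstrict.eventually_apply_eq_iff_implicitFunctionOfProdDomain hinv).self_of_nhds.mp rfl
  have hev := hstrict.eventually_apply_implicitFunctionOfProdDomain hinv
  set ψ := hstrict.implicitFunctionOfProdDomain hinv
  have hdiff : DifferentiableAt ℝ ψ 0 := hψ.hasFDerivAt.differentiableAt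
  refine ⟨fun t => (ψ t).1, fun t => (ψ t).2, congrArg Prod.fst hψ0, congrArg Prod.snd hψ0, hdiff.fst, hdiff.snd, ?_⟩
  filter_upwards [hev] with t ht
  have := congrArg Prod.fst ht
  simp only [G, hv, sub_self] at this
  exact sub_eq_zero.1 this

end Perturbation

/-- Equality case of the triangle inequality for averages. -/
theorem Complex.eq_of_sum_eq_card_mul {ι : Type*} [Fintype ι] {z : ι → ℂ} {w : ℂ}
    (hz : ∀ i, ‖z i‖ ≤ ‖w‖) (hsum : ∑ i, z i = Fintype.card ι * w) (i : ι) : z i = w := by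
  have hsq : ∀ i, ‖z i - w‖ ^ 2 = ‖z i‖ ^ 2 + ‖w‖ ^ 2 - 2 * (z i * (starRingEnd ℂ) w).re := by
    intro i
    simp only [← Complex.normSq_eq_norm_sq]
    exact Complex.normSq_sub _ _
  have htot : ∑ i, ‖z i - w‖ ^ 2 ≤ 0 := by
    have h1 : ∑ i, (z i * (starRingEnd ℂ) w).re = Fintype.card ι * ‖w‖ ^ 2 := by
      rw [← Complex.re_sum, ← Finset.sum_mul, hsum, mul_assoc, Complex.mul_conj,
        Complex.normSq_eq_norm_sq]
      norm_cast
    calc ∑ i, ‖z i - w‖ ^ 2 ≤ ∑ i, (‖w‖ ^ 2 + ‖w‖ ^ 2 - 2 * (z i * (starRingEnd ℂ) w).re) := by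
          refine Finset.sum_le_sum fun i _ => ?_
          rw [hsq i]
          gcongr
          exact hz i
      _ = 0 := by
          rw [Finset.sum_sub_distrib, ← Finset.mul_sum, h1]
          simp
          ring
  have h0 := (Finset.sum_eq_zero_iff_of_nonneg (fun i _ => sq_nonneg ‖z i - w‖)).1
    (le_antisymm htot (Finset.sum_nonneg fun i _ => sq_nonneg _)) i (Finset.mem_univ i)
  exact sub_eq_zero.1 (norm_eq_zero.1 (pow_eq_zero_iff two_ne_zero |>.1 h0))

/-! ### Final components and the maximum principle. -/

namespace DigitTransducer

variable {q d : ℕ} {σ : Type*} (T : DigitTransducer q d σ)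

theorem run_cons (s : σ) (ε : Fin d → Fin q) (w : List (Fin d → Fin q)) :
    T.run s (ε :: w) = T.run (T.next s ε) w := rfl

theorem run_append (s : σ) (w w' : List (Fin d → Fin q)) :
    T.run s (w ++ w') = T.run (T.run s w) w' := by
  simp [run, List.foldl_append]

variable {T}

theorem Reachable.refl (s : σ) : T.Reachable s s := ⟨[], rfl⟩

theorem Reachable.trans {s t u : σ} (h : T.Reachable s t) (h' : T.Reachable t u) :
    T.Reachable s u := by
  obtain ⟨w, rfl⟩ := h
  obtain ⟨w', rfl⟩ := h'
  exact ⟨w ++ w', T.run_append s w w'⟩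

theorem Reachable.next (s : σ) (ε : Fin d → Fin q) : T.Reachable s (T.next s ε) := ⟨[ε], rfl⟩

namespace IsFinalComponent

variable {C C' : Finset σ}

theorem nonempty (hC : T.IsFinalComponent C) : C.Nonempty := by
  obtain ⟨⟨s, hs⟩, -⟩ := hC
  exact ⟨s, (hs s).2 ⟨.refl s, .refl s⟩⟩

theorem reachable (hC : T.IsFinalComponent C) {s t : σ} (hs : s ∈ C) (ht : t ∈ C) :
    T.Reachable s t := by
  obtain ⟨⟨r, hr⟩, -⟩ := hC
  exact ((hr s).1 hs).2.trans ((hr t).1 ht).1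

theorem run_mem (hC : T.IsFinalComponent C) {s : σ} (hs : s ∈ C) (w : List (Fin d → Fin q)) :
    T.run s w ∈ C := by
  induction w generalizing s with
  | nil => exact hs
  | cons ε w ih => exact ih (hC.2 s hs ε)

theorem eq_of_mem (hC : T.IsFinalComponent C) (hC' : T.IsFinalComponent C') {s : σ} (hs : s ∈ C)
    (hs' : s ∈ C') : C = C' := by
  ext t
  constructor
  · intro ht
    obtain ⟨w, rfl⟩ := hC.reachable hs ht
    exact hC'.run_mem hs' w
  · intro ht
    obtain ⟨w, rfl⟩ := hC'.reachable hs' ht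
    exact hC.run_mem hs w

theorem exists_closed_walk [NeZero q] (hC : T.IsFinalComponent C) {s : σ} (hs : s ∈ C) :
    ∃ w : List (Fin d → Fin q), w ≠ [] ∧ T.run s w = s := by
  obtain ⟨w, hw⟩ := hC.reachable (hC.2 s hs 0) hs
  exact ⟨0 :: w, by simp, hw⟩

/-- The length of one closed walk bounds all common divisors, so the supremum in the definition is
attained. Common divisors are closed under least common multiples, so the largest is a multiple of
all others. -/
theorem period_spec [NeZero q] (hC : T.IsFinalComponent C) :
    (∀ s ∈ C, ∀ w : List (Fin d → Fin q), w ≠ [] → T.run s w = s → T.period C ∣ w.length) ∧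
    ∀ g : ℕ, (∀ s ∈ C, ∀ w : List (Fin d → Fin q), w ≠ [] → T.run s w = s → g ∣ w.length) →
      g ∣ T.period C := by
  set D := {g : ℕ | ∀ s ∈ C, ∀ w : List (Fin d → Fin q), w ≠ [] → T.run s w = s → g ∣ w.length}
    with hD
  obtain ⟨s, hs⟩ := hC.nonempty
  obtain ⟨w, hw, hrun⟩ := hC.exists_closed_walk hs
  have hbdd : BddAbove D :=
    ⟨w.length, fun g hg => Nat.le_of_dvd (List.length_pos_iff.2 hw) (hg s hs w hw hrun)⟩
  have hmem : T.period C ∈ D := Nat.sSup_mem ⟨1, fun _ _ _ _ _ => one_dvd _⟩ hbdd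
  refine ⟨hmem, fun g hg => ?_⟩
  have hpos : 0 < T.period C :=
    Nat.pos_of_dvd_of_pos (hmem s hs w hw hrun) (List.length_pos_iff.2 hw)
  have hl : (T.period C).lcm g ∈ D := fun s hs w hw hrun =>
    Nat.lcm_dvd (hmem s hs w hw hrun) (hg s hs w hw hrun)
  have hle : (T.period C).lcm g ≤ T.period C := le_csSup hbdd hl
  have heq : (T.period C).lcm g = T.period C :=
    le_antisymm hle (Nat.le_of_dvd (Nat.lcm_pos_iff.2 ⟨hpos, by
      rcases Nat.eq_zero_or_pos g with rfl | h
      · exact absurd (Nat.eq_zero_of_zero_dvd (hg s hs w hw hrun)) (List.length_pos_iff.2 hw).ne'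
      · exact h⟩) (Nat.dvd_lcm_left _ _))
  exact heq ▸ Nat.dvd_lcm_right _ _

theorem period_pos [NeZero q] (hC : T.IsFinalComponent C) : 0 < T.period C := by
  obtain ⟨s, hs⟩ := hC.nonempty
  obtain ⟨w, hw, hrun⟩ := hC.exists_closed_walk hs
  exact Nat.pos_of_dvd_of_pos (hC.period_spec.1 s hs w hw hrun) (List.length_pos_iff.2 hw)

end IsFinalComponent

/-- Maximum principle for eigenvectors with peripheral eigenvalues. -/
theorem apply_run_of_max {D : Set σ} (hD : ∀ t ∈ D, ∀ ε, T.next t ε ∈ D) {v : σ → ℂ} {ζ : ℂ}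
    (hζ : ‖ζ‖ = 1) (hv : ∀ t ∈ D, ∑ ε, v (T.next t ε) = (q : ℂ) ^ d * ζ * v t) {s : σ} (hs : s ∈ D)
    (hmax : ∀ t ∈ D, ‖v t‖ ≤ ‖v s‖) (w : List (Fin d → Fin q)) :
    v (T.run s w) = ζ ^ w.length * v s := by
  induction w generalizing s with
  | nil => simp [run]
  | cons ε w ih =>
    have hnorm : ‖ζ * v s‖ = ‖v s‖ := by rw [norm_mul, hζ, one_mul]
    have h := Complex.eq_of_sum_eq_card_mul (z := fun ε => v (T.next s ε)) (w := ζ * v s)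
      (fun ε => by rw [hnorm]; exact hmax _ (hD s hs ε))
      (by rw [hv s hs]; simp [mul_assoc]) ε
    rw [run_cons, ih (hD s hs ε) (fun t ht => by rw [h, hnorm]; exact hmax t ht), h,
      List.length_cons, pow_succ, mul_assoc]

/-- By the maximum principle with `ζ = 1` the value at a state of maximal modulus spreads along
every path, hence over all of `C`. -/
theorem IsFinalComponent.eq_of_harmonic {C : Finset σ} (hC : T.IsFinalComponent C) {v : σ → ℂ}
    (hv : ∀ t ∈ C, ∑ ε, v (T.next t ε) = (q : ℂ) ^ d * v t) {s t : σ} (hs : s ∈ C) (ht : t ∈ C) :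
    v s = v t := by
  obtain ⟨m, hm, hmax⟩ := C.exists_max_image (fun s => ‖v s‖) hC.nonempty
  have key : ∀ s ∈ C, v s = v m := by
    intro s hs
    obtain ⟨w, rfl⟩ := hC.reachable hm hs
    have := apply_run_of_max (D := (C : Set σ)) (ζ := 1) (fun t ht ε => hC.2 t ht ε) (by simp)
      (fun t ht => by rw [hv t ht, mul_one]) hm hmax w
    simpa using this
  rw [key s hs, key t ht]

section Fintype

variable [Fintype σ]

/-- Among the states reachable from `s`, one with the fewest reachable states can be reached back
from everything it reaches. -/
theorem exists_isFinalComponent (s : σ) : ∃ C t, T.IsFinalComponent C ∧ t ∈ C ∧ T.Reachable s t := by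
  classical
  let R : σ → Finset σ := fun t => Finset.univ.filter (T.Reachable t)
  obtain ⟨t, ht, hmin⟩ := (R s).exists_min_image (fun t => (R t).card)
    ⟨s, by simp [R, Reachable.refl]⟩
  have hst : T.Reachable s t := by simpa [R] using ht
  have hback : ∀ t', T.Reachable t t' → T.Reachable t' t := by
    intro t' htt'
    have hsub : R t' ⊆ R t := fun x hx => by
      simp only [R, Finset.mem_filter, Finset.mem_univ, true_and] at hx ⊢
      exact htt'.trans hx
    have heq := Finset.eq_of_subset_of_card_le hsub (hmin t' (by simpa [R] using hst.trans htt'))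
    have : t ∈ R t' := by rw [heq]; simp [R, Reachable.refl]
    simpa [R] using this
  refine ⟨Finset.univ.filter fun t' => T.Reachable t t' ∧ T.Reachable t' t, t,
    ⟨⟨t, by simp⟩, ?_⟩, by simp [Reachable.refl], hst⟩
  intro x hx ε
  simp only [Finset.mem_filter, Finset.mem_univ, true_and] at hx ⊢
  have := hx.1.trans (Reachable.next x ε)
  exact ⟨this, hback _ this⟩

theorem mem_finalComponents {C : Finset σ} : C ∈ T.finalComponents ↔ T.IsFinalComponent C := by
  simp [finalComponents]

theorem finalPeriod_pos [NeZero q] : 0 < T.finalPeriod := by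
  rw [Nat.pos_iff_ne_zero, finalPeriod, Ne, Finset.lcm_eq_zero_iff]
  rintro ⟨C, hC, h⟩
  exact (mem_finalComponents.1 hC).period_pos.ne' h

variable [DecidableEq σ]

theorem matrix_mulVec (t : ℝ) (v : σ → ℂ) (s : σ) :
    (T.matrix t).mulVec v s
      = ∑ ε, Complex.exp (Complex.I * t * T.out s ε) * v (T.next s ε) := by
  simp only [matrix, Matrix.sum_mulVec, Finset.sum_apply]
  refine Finset.sum_congr rfl fun ε _ => ?_
  simp [digitMatrix, Matrix.mulVec, dotProduct]

theorem matrix_zero_mulVec (v : σ → ℂ) (s : σ) :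
    (T.matrix 0).mulVec v s = ∑ ε, v (T.next s ε) := by
  simp [matrix_mulVec]

theorem matrix_zero_mulVec_eq_smul_iff {v : σ → ℂ} {μ : ℂ} :
    (T.matrix 0).mulVec v = μ • v ↔ ∀ s, ∑ ε, v (T.next s ε) = μ * v s := by
  simp only [funext_iff, matrix_zero_mulVec, Pi.smul_apply, smul_eq_mul]

theorem matrix_zero_mulVec_one : (T.matrix 0).mulVec (fun _ => 1) = (q : ℂ) ^ d • fun _ => 1 := by
  rw [matrix_zero_mulVec_eq_smul_iff]
  simp

theorem matrix_zero_apply (s s' : σ) :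
    T.matrix 0 s s' = ∑ ε, if T.next s ε = s' then (1 : ℂ) else 0 := by
  simp [matrix, digitMatrix, Matrix.sum_apply]

theorem sum_norm_matrix_zero (s : σ) : ∑ s', ‖T.matrix 0 s s'‖ = (q : ℝ) ^ d := by
  have h : ∀ s', ‖T.matrix 0 s s'‖ = ∑ ε, if T.next s ε = s' then (1 : ℝ) else 0 := by
    intro s'
    have : T.matrix 0 s s' = ((∑ ε, if T.next s ε = s' then (1 : ℝ) else 0 : ℝ) : ℂ) := by
      rw [matrix_zero_apply, Complex.ofReal_sum]
      exact Finset.sum_congr rfl fun ε _ => by split_ifs <;> simp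
    rw [this, Complex.norm_real, Real.norm_eq_abs, abs_of_nonneg]
    exact Finset.sum_nonneg fun ε _ => by split_ifs <;> norm_num
  simp only [h]
  rw [Finset.sum_comm]
  simp

/-- The maximal modulus is carried along a path into some final component, where it is zero. -/
theorem eq_zero_of_eq_zero_on_finalComponents {v : σ → ℂ} {ζ : ℂ} (hζ : ‖ζ‖ = 1)
    (hv : ∀ s, ∑ ε, v (T.next s ε) = (q : ℂ) ^ d * ζ * v s)
    (h0 : ∀ C ∈ T.finalComponents, ∀ s ∈ C, v s = 0) : v = 0 := by
  rcases isEmpty_or_nonempty σ with h | h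
  · exact Subsingleton.elim _ _
  obtain ⟨m, -, hm⟩ := Finset.univ.exists_max_image (fun s => ‖v s‖) Finset.univ_nonempty
  obtain ⟨C, t, hC, ht, w, rfl⟩ := T.exists_isFinalComponent m
  have := apply_run_of_max (D := Set.univ) (fun _ _ _ => trivial) hζ (fun t _ => hv t)
    (s := m) trivial (fun t _ => hm t (Finset.mem_univ t)) w
  rw [h0 C (mem_finalComponents.2 hC) _ ht] at this
  have hm0 : ‖v m‖ = 0 := by
    have := congrArg norm this
    simpa [hζ] using this.symm
  funext s
  exact norm_le_zero_iff.1 ((hm s (Finset.mem_univ s)).trans hm0.le)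

/-- Peripheral eigenvalues are `q ^ d` times a root of unity of order dividing the final period. -/
theorem pow_finalPeriod_eq_one_of_eigenvector [NeZero q] {v : σ → ℂ} {ζ : ℂ} (hζ : ‖ζ‖ = 1)
    (hv0 : v ≠ 0) (hv : ∀ s, ∑ ε, v (T.next s ε) = (q : ℂ) ^ d * ζ * v s) :
    ζ ^ T.finalPeriod = 1 := by
  have : ∃ s, v s ≠ 0 := Function.ne_iff.1 hv0
  obtain ⟨s₀, hs₀⟩ := this
  obtain ⟨m, -, hm⟩ := Finset.univ.exists_max_image (fun s => ‖v s‖) ⟨s₀, Finset.mem_univ _⟩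
  have hvm : v m ≠ 0 := norm_pos_iff.1 ((norm_pos_iff.2 hs₀).trans_le (hm s₀ (Finset.mem_univ _)))
  obtain ⟨C, t, hC, ht, hmt⟩ := T.exists_isFinalComponent m
  -- All states of `C` are reached from the maximum `m`, so the rotation law holds between them and
  -- every closed walk of length `L` in `C` forces `ζ^L = 1`.
  have hall : ∀ s ∈ C, ∀ w, v (T.run s w) = ζ ^ w.length * v s ∧ v s ≠ 0 := by
    intro s hs w
    obtain ⟨w', rfl⟩ := hmt.trans (hC.reachable ht hs)
    have hrun := apply_run_of_max (D := Set.univ) (fun _ _ _ => trivial) hζ (fun t _ => hv t)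
      (s := m) trivial (fun t _ => hm t (Finset.mem_univ t))
    have hζ0 : ζ ≠ 0 := by rintro rfl; simp at hζ
    refine ⟨?_, ?_⟩
    · rw [← run_append, hrun, hrun, List.length_append, pow_add]; ring
    · rw [hrun]; exact mul_ne_zero (pow_ne_zero _ hζ0) hvm
  have hdvd : orderOf ζ ∣ T.period C := by
    refine hC.period_spec.2 _ fun s hs w _ hrun => orderOf_dvd_of_pow_eq_one ?_
    obtain ⟨h1, h2⟩ := hall s hs w
    rw [hrun] at h1
    exact mul_right_cancel₀ h2 (by rw [one_mul, ← h1])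
  exact orderOf_dvd_iff_pow_eq_one.1
    (hdvd.trans (Finset.dvd_lcm (mem_finalComponents.2 hC)))

end Fintype

end DigitTransducer

/-! ### Eigenvectors attached to a single final component. -/

namespace DigitTransducer

variable {q d : ℕ} {σ : Type*} {T : DigitTransducer q d σ} [Fintype σ] [DecidableEq σ]
  {C C' : Finset σ}

theorem contDiff_matrix_apply (s s' : σ) : ContDiff ℝ 1 fun t : ℝ => T.matrix t s s' := by
  have h : (fun t : ℝ => T.matrix t s s') = fun t : ℝ => ∑ ε,
      if T.next s ε = s' then Complex.exp (Complex.I * t * T.out s ε) else 0 := by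
    funext t
    simp [matrix, digitMatrix, Matrix.sum_apply]
  rw [h]
  refine ContDiff.sum fun ε _ => ?_
  split_ifs
  · have : ContDiff ℝ 1 fun t : ℝ => (t : ℂ) := Complex.ofRealCLM.contDiff
    fun_prop
  · exact contDiff_const

theorem IsFinalComponent.matrix_apply_eq_zero (hC : T.IsFinalComponent C) {s s' : σ} (hs : s ∈ C)
    (hs' : s' ∉ C) (t : ℝ) : T.matrix t s s' = 0 := by
  rw [matrix, Matrix.sum_apply]
  refine Finset.sum_eq_zero fun ε _ => ?_
  rw [digitMatrix, Matrix.of_apply, if_neg]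
  rintro rfl
  exact hs' (hC.2 s hs ε)

/-- Extension by zero of a vector indexed by the states in `C`. -/
def extendByZero (C : Finset σ) (y : C → ℂ) (s : σ) : ℂ := if h : s ∈ C then y ⟨s, h⟩ else 0

theorem extendByZero_of_mem {y : C → ℂ} {s : σ} (hs : s ∈ C) :
    extendByZero C y s = y ⟨s, hs⟩ := dif_pos hs

theorem extendByZero_of_notMem {y : C → ℂ} {s : σ} (hs : s ∉ C) :
    extendByZero C y s = 0 := dif_neg hs

theorem extendByZero_dotProduct (y : C → ℂ) (x : σ → ℂ) :
    extendByZero C y ⬝ᵥ x = y ⬝ᵥ fun s => x s := by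
  rw [dotProduct, dotProduct, ← Finset.sum_subset (Finset.subset_univ C) fun s _ hs => by
    rw [extendByZero_of_notMem hs, zero_mul], ← Finset.sum_coe_sort C]
  exact Finset.sum_congr rfl fun s _ => by rw [extendByZero_of_mem s.2]

/-- No transition leaves `C`, so rows of `M(t)` indexed by `C` vanish outside `C`, and left
eigenvectors of the restriction extend by zero. -/
theorem IsFinalComponent.vecMul_extendByZero (hC : T.IsFinalComponent C) (t : ℝ) (y : C → ℂ) :
    (T.matrix t).vecMul (extendByZero C y)
      = extendByZero C ((T.componentMatrix C t).vecMul y) := by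
  funext s'
  rw [Matrix.vecMul, extendByZero_dotProduct]
  by_cases hs' : s' ∈ C
  · rw [extendByZero_of_mem hs']; rfl
  · rw [extendByZero_of_notMem hs']
    refine Finset.sum_eq_zero fun s _ => ?_
    change y s * T.matrix t s s' = 0
    rw [hC.matrix_apply_eq_zero s.2 hs', mul_zero]

theorem extendByZero_smul (μ : ℂ) (y : C → ℂ) :
    extendByZero C (μ • y) = μ • extendByZero C y := by
  funext s
  by_cases hs : s ∈ C <;> simp [extendByZero, hs]

theorem IsFinalComponent.componentMatrix_mulVec (hC : T.IsFinalComponent C) (t : ℝ) (x : σ → ℂ)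
    (s : C) : (T.componentMatrix C t).mulVec (fun s => x s) s = (T.matrix t).mulVec x s := by
  rw [Matrix.mulVec, Matrix.mulVec, dotProduct, dotProduct,
    ← Finset.sum_subset (Finset.subset_univ C) fun s' _ hs' => by
      rw [hC.matrix_apply_eq_zero s.2 hs', zero_mul], ← Finset.sum_coe_sort C]
  rfl

theorem sum_norm_componentMatrix_zero_le (s : C) :
    ∑ s', ‖T.componentMatrix C 0 s s'‖ ≤ (q : ℝ) ^ d := by
  rw [← T.sum_norm_matrix_zero s.1]
  calc ∑ s' : C, ‖T.componentMatrix C 0 s s'‖ = ∑ s' ∈ C, ‖T.matrix 0 s s'‖ := by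
        rw [← Finset.sum_coe_sort C]; rfl
    _ ≤ _ := Finset.sum_le_sum_of_subset_of_nonneg (Finset.subset_univ _)
        fun _ _ _ => norm_nonneg _

open Classical in
/-- The indicator function of the states outside the final components different from `C`. -/
noncomputable def keep (T : DigitTransducer q d σ) (C : Finset σ) (s : σ) : ℂ :=
  if ∃ C' ∈ T.finalComponents, C' ≠ C ∧ s ∈ C' then 0 else 1

theorem keep_of_mem (hC : C ∈ T.finalComponents) {s : σ} (hs : s ∈ C) : T.keep C s = 1 := by
  refine if_neg ?_
  rintro ⟨C', hC', hne, hs'⟩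
  exact hne ((mem_finalComponents.1 hC').eq_of_mem (mem_finalComponents.1 hC) hs' hs)

theorem keep_of_mem_of_ne (hC' : C' ∈ T.finalComponents) (hne : C' ≠ C) {s : σ} (hs : s ∈ C') :
    T.keep C s = 0 := if_pos ⟨C', hC', hne, hs⟩

/-- The matrix `M(t)` with the columns of the final components different from `C` erased. -/
noncomputable def maskedMatrix (T : DigitTransducer q d σ) (C : Finset σ) (t : ℝ) : Matrix σ σ ℂ :=
  T.matrix t * Matrix.diagonal (T.keep C)

theorem maskedMatrix_apply (t : ℝ) (s s' : σ) :
    T.maskedMatrix C t s s' = T.matrix t s s' * T.keep C s' := by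
  rw [maskedMatrix, Matrix.mul_diagonal]

theorem maskedMatrix_mulVec (t : ℝ) (v : σ → ℂ) :
    (T.maskedMatrix C t).mulVec v = (T.matrix t).mulVec fun s => T.keep C s * v s := by
  rw [maskedMatrix, ← Matrix.mulVec_mulVec]
  congr 1
  funext s
  rw [Matrix.mulVec_diagonal]

/-- Transitions from a final component `C' ≠ C` lead to erased columns only, so an eigenvector for a
nonzero eigenvalue vanishes on `C'` and masking does not affect it. This singles out the right
eigenvector belonging to `C` even if `q^d` is a multiple eigenvalue of `M`. -/
theorem maskedMatrix_eigenvector {t : ℝ} {v : σ → ℂ} {μ : ℂ} (hμ : μ ≠ 0)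
    (hv : (T.maskedMatrix C t).mulVec v = μ • v) :
    (∀ C' ∈ T.finalComponents, C' ≠ C → ∀ s ∈ C', v s = 0) ∧ (T.matrix t).mulVec v = μ • v := by
  have h0 : ∀ C' ∈ T.finalComponents, C' ≠ C → ∀ s ∈ C', v s = 0 := by
    intro C' hC' hne s hs
    have h := congrFun hv s
    rw [maskedMatrix_mulVec, matrix_mulVec, Pi.smul_apply, smul_eq_mul,
      Finset.sum_eq_zero fun ε _ => by
        rw [keep_of_mem_of_ne hC' hne ((mem_finalComponents.1 hC').2 s hs ε), zero_mul,
          mul_zero]] at h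
    exact (mul_eq_zero.1 h.symm).resolve_left hμ
  refine ⟨h0, ?_⟩
  have hk : (fun s => T.keep C s * v s) = v := by
    funext s
    by_cases hs : ∃ C' ∈ T.finalComponents, C' ≠ C ∧ s ∈ C'
    · obtain ⟨C', hC', hne, hs⟩ := hs
      rw [h0 C' hC' hne s hs, mul_zero]
    · rw [keep, if_neg hs, one_mul]
  rw [← hv, maskedMatrix_mulVec, hk]

theorem eq_zero_of_harmonic (hC : C ∈ T.finalComponents) {x : σ → ℂ}
    (hx : (T.matrix 0).mulVec x = (q : ℂ) ^ d • x)
    (h0 : ∀ C' ∈ T.finalComponents, C' ≠ C → ∀ s ∈ C', x s = 0) {s : σ} (hs : s ∈ C)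
    (hxs : x s = 0) : x = 0 := by
  rw [matrix_zero_mulVec_eq_smul_iff] at hx
  refine eq_zero_of_eq_zero_on_finalComponents (T := T) (ζ := 1) (by simp) (by simpa using hx) ?_
  intro C' hC' t ht
  by_cases h : C' = C
  · subst h
    rw [(mem_finalComponents.1 hC).eq_of_harmonic (fun t _ => hx t) ht hs, hxs]
  · exact h0 C' hC' h t ht

/-- The eigenvalue `q^d` is simple for the restriction to `C`, which supplies the left eigenvector,
and for the masked matrix, which supplies the right one. The perturbation result applies to each. -/
theorem exists_eigenpairs [NeZero q] (hC : C ∈ T.finalComponents) :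
    ∃ (u v : ℝ → σ → ℂ) (μ : ℝ → ℂ), μ 0 = (q : ℂ) ^ d ∧ DifferentiableAt ℝ μ 0 ∧
      DifferentiableAt ℝ u 0 ∧ DifferentiableAt ℝ v 0 ∧
      (∀ᶠ t in 𝓝 (0 : ℝ), (T.matrix t).vecMul (u t) = μ t • u t ∧
        (T.matrix t).mulVec (v t) = μ t • v t ∧
        ∀ C' ∈ T.finalComponents, C' ≠ C → ∀ s ∈ C', v t s = 0) ∧
      (∀ t, ∀ s ∉ C, u t s = 0) ∧ (∀ s ∈ C, v 0 s = 1) ∧ ∑ s ∈ C, u 0 s = 1 := by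
  have hF := mem_finalComponents.1 hC
  obtain ⟨s₀, hs₀⟩ := hF.nonempty
  have hq : (0 : ℝ) < (q : ℝ) ^ d := by have := NeZero.pos q; positivity
  have hqC : (q : ℂ) ^ d ≠ 0 := by simpa using pow_ne_zero d (NeZero.ne (q : ℂ))
  have hμ : ‖(q : ℂ) ^ d‖ = (q : ℝ) ^ d := by simp
  have hrow := fun s => T.sum_norm_componentMatrix_zero_le (C := C) s
  -- the eigenvalue is simple on the component
  have hone : (T.componentMatrix C 0).mulVec (fun _ => 1) = (q : ℂ) ^ d • fun _ => 1 := by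
    funext s
    rw [hF.componentMatrix_mulVec 0 (fun _ => 1) s, matrix_zero_mulVec_one]
    rfl
  have hconst : ∀ x, (T.componentMatrix C 0).mulVec x = (q : ℂ) ^ d • x →
      ∃ r : ℂ, x = r • fun _ => 1 := by
    intro x hx
    refine ⟨x ⟨s₀, hs₀⟩, ?_⟩
    have hx' : x = fun s : C => extendByZero C x s := by
      funext s; rw [extendByZero_of_mem s.2]
    funext s
    have := hF.eq_of_harmonic (v := extendByZero C x) (fun t ht => ?_) s.2 hs₀
    · simpa [extendByZero_of_mem s.2, extendByZero_of_mem hs₀] using this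
    · have h := congrFun hx ⟨t, ht⟩
      rw [hx', hF.componentMatrix_mulVec 0 _ ⟨t, ht⟩, matrix_zero_mulVec] at h
      exact h
  have hne : (fun _ => 1 : C → ℂ) ≠ 0 := fun h => one_ne_zero (congrFun h ⟨s₀, hs₀⟩)
  obtain ⟨y₀, hy₀, hy₀1⟩ := Matrix.exists_left_eigenvector_of_simple hq hrow hμ hne hone hconst
  -- The left eigenvector is continued as a right eigenvector of the transpose, normalised against
  -- the constant vector.
  obtain ⟨y, μ, hy0, hμ0, hyd, hμd, hyev⟩ := Matrix.exists_differentiable_eigenpair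
    (A := fun t => (T.componentMatrix C t).transpose) (μ₀ := (q : ℂ) ^ d) (u₀ := fun _ => 1)
    (v₀ := y₀) (fun i j => contDiff_matrix_apply _ _)
    (by rw [Matrix.vecMul_transpose, hone]) (by rw [Matrix.mulVec_transpose, hy₀])
    (by rw [dotProduct_comm, hy₀1]) (fun x hx hx1 => by
      rw [Matrix.mulVec_transpose] at hx
      refine Matrix.eq_zero_of_vecMul_eq_smul_of_dotProduct_eq_zero hq hrow hμ hx fun v hv => ?_
      obtain ⟨r, rfl⟩ := hconst v hv
      rw [dotProduct_smul, dotProduct_comm, hx1, smul_zero])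
  have huext : ∀ t, (T.componentMatrix C t).vecMul (y t) = μ t • y t →
      (T.matrix t).vecMul (extendByZero C (y t)) = μ t • extendByZero C (y t) := fun t ht => by
    rw [hF.vecMul_extendByZero, ht, extendByZero_smul]
  -- the right eigenvector
  set u₀ := extendByZero C y₀ with hu₀def
  have hu₀ : (T.maskedMatrix C 0).vecMul u₀ = (q : ℂ) ^ d • u₀ := by
    rw [maskedMatrix, ← Matrix.vecMul_vecMul, hF.vecMul_extendByZero, hy₀, extendByZero_smul]
    funext s
    rw [Matrix.vecMul_diagonal]
    by_cases hs : s ∈ C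
    · rw [keep_of_mem hC hs, mul_one]
    · rw [Pi.smul_apply, extendByZero_of_notMem hs, smul_zero, zero_mul]
  have hu₀dot : ∀ x : σ → ℂ, (T.matrix 0).mulVec x = (q : ℂ) ^ d • x → ∀ s ∈ C,
      u₀ ⬝ᵥ x = x s := by
    intro x hx s hs
    rw [matrix_zero_mulVec_eq_smul_iff] at hx
    have : (fun s : C => x s) = x s • fun _ => 1 := by
      funext s'
      simpa using hF.eq_of_harmonic (fun t _ => hx t) s'.2 hs
    rw [hu₀def, extendByZero_dotProduct, this, dotProduct_smul, hy₀1, smul_eq_mul, mul_one]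
  have hu₀ne : u₀ ≠ 0 := by
    intro h
    have : y₀ ⬝ᵥ (fun _ => 1) = u₀ ⬝ᵥ fun _ => 1 := by rw [hu₀def, extendByZero_dotProduct]
    rw [hy₀1, h, zero_dotProduct] at this
    exact one_ne_zero this
  -- The extended left eigenvector survives the masking, so `q^d` is an eigenvalue of the masked
  -- matrix and has a right eigenvector there.
  obtain ⟨x₀, hx₀ne, hx₀⟩ := Matrix.exists_mulVec_eq_smul_iff.2 ⟨u₀, hu₀ne, hu₀⟩
  obtain ⟨hx₀z, hx₀M⟩ := maskedMatrix_eigenvector hqC hx₀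
  have hr : x₀ s₀ ≠ 0 := fun h => hx₀ne (eq_zero_of_harmonic hC hx₀M hx₀z hs₀ h)
  set v₀ := (x₀ s₀)⁻¹ • x₀ with hv₀def
  have hv₀ : (T.maskedMatrix C 0).mulVec v₀ = (q : ℂ) ^ d • v₀ := by
    rw [hv₀def, Matrix.mulVec_smul, hx₀, smul_comm]
  have hv₀M := (maskedMatrix_eigenvector hqC hv₀).2
  have hv₀s : v₀ s₀ = 1 := by simp [hv₀def, hr]
  have huv : u₀ ⬝ᵥ v₀ = 1 := by rw [hu₀dot v₀ hv₀M s₀ hs₀, hv₀s]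
  obtain ⟨v, μ', hv0, hμ'0, hvd, hμ'd, hvev⟩ := Matrix.exists_differentiable_eigenpair
    (A := fun t => T.maskedMatrix C t) (μ₀ := (q : ℂ) ^ d) (u₀ := u₀) (v₀ := v₀)
    (fun i j => by
      simp only [maskedMatrix_apply]
      exact (contDiff_matrix_apply _ _).mul contDiff_const) hu₀ hv₀ huv
    (fun x hx hx0 => by
      obtain ⟨h1, h2⟩ := maskedMatrix_eigenvector hqC hx
      refine eq_zero_of_harmonic hC h2 h1 hs₀ ?_
      rw [← hu₀dot x h2 s₀ hs₀, hx0])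
  have hud : DifferentiableAt ℝ (fun t => extendByZero C (y t)) 0 := by
    refine differentiableAt_pi.2 fun s => ?_
    by_cases hs : s ∈ C
    · simp only [extendByZero_of_mem hs]
      exact differentiableAt_pi.1 hyd _
    · simp only [extendByZero_of_notMem hs]
      exact differentiableAt_const _
  have hcont : ContinuousAt (fun t => extendByZero C (y t) ⬝ᵥ v t) 0 := by
    simp only [dotProduct]
    exact tendsto_finsetSum _ fun s _ =>
      (((continuousAt_pi.1 hud.continuousAt) s).mul ((continuousAt_pi.1 hvd.continuousAt) s))
  refine ⟨fun t => extendByZero C (y t), v, μ, hμ0, hμd, hud, hvd, ?_,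
    fun t s hs => extendByZero_of_notMem hs, ?_, ?_⟩
  · have h1 : ∀ᶠ t in 𝓝 (0 : ℝ), μ' t ≠ 0 :=
      hμ'd.continuousAt.eventually_ne (by rw [hμ'0]; exact hqC)
    have h2 : ∀ᶠ t in 𝓝 (0 : ℝ), extendByZero C (y t) ⬝ᵥ v t ≠ 0 :=
      hcont.eventually_ne (by rw [hy0, hv0, ← hu₀def, huv]; exact one_ne_zero)
    filter_upwards [hyev, hvev, h1, h2] with t ht1 ht2 ht3 ht4
    rw [Matrix.mulVec_transpose] at ht1
    obtain ⟨h5, h6⟩ := maskedMatrix_eigenvector ht3 ht2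
    have h7 := huext t ht1
    -- The two continuations come from different matrices. Evaluating `u M(t) v` in both ways
    -- identifies their eigenvalues, as `u ⬝ᵥ v ≠ 0`.
    have h8 : μ t = μ' t := by
      have := Matrix.dotProduct_mulVec (extendByZero C (y t)) (T.matrix t) (v t)
      rw [h6, h7, dotProduct_smul, smul_dotProduct, smul_eq_mul, smul_eq_mul] at this
      exact (mul_right_cancel₀ ht4 this).symm
    exact ⟨h7, by rw [h6, h8], h5⟩
  · intro s hs
    have h := hu₀dot v₀ hv₀M s hs
    rw [hv0, ← h, huv]
  · have : ∑ s ∈ C, extendByZero C (y 0) s = extendByZero C (y 0) ⬝ᵥ fun _ => 1 := by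
      rw [extendByZero_dotProduct, ← Finset.sum_coe_sort C, dotProduct]
      exact Finset.sum_congr rfl fun s _ => by rw [extendByZero_of_mem s.2, mul_one]
    rw [this, extendByZero_dotProduct, hy0, hy₀1]

end DigitTransducer

/-- Injectivity of a family of linear maps is an open condition. -/
theorem eventually_forall_sum_smul_eq_zero {X E n : Type*} [TopologicalSpace X] [Fintype n]
    [NormedAddCommGroup E] [NormedSpace ℂ E] {F : X → n → E} {x₀ : X} (hF : ContinuousAt F x₀)
    (h : ∀ a : n → ℂ, ∑ s, a s • F x₀ s = 0 → a = 0) :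
    ∀ᶠ x in 𝓝 x₀, ∀ a : n → ℂ, ∑ s, a s • F x s = 0 → a = 0 := by
  have h0 : LinearIndependent ℂ (F x₀) :=
    Fintype.linearIndependent_iff.2 fun g hg i => congrFun (h g hg) i
  filter_upwards [hF.eventually h0.eventually] with x hx a ha
  funext i
  exact Fintype.linearIndependent_iff.1 hx a ha i

theorem Matrix.mem_spectrum_iff_exists_vecMul {n : Type*} [Fintype n] [DecidableEq n]
    {A : Matrix n n ℂ} {μ : ℂ} : μ ∈ spectrum ℂ A ↔ ∃ v ≠ 0, A.vecMul v = μ • v := by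
  rw [← Matrix.exists_mulVec_eq_smul_iff, ← Matrix.spectrum_toLin',
    ← Module.End.hasEigenvalue_iff_mem_spectrum]
  constructor
  · intro h
    obtain ⟨v, hv⟩ := h.exists_hasEigenvector
    exact ⟨v, hv.2, by simpa using hv.apply_eq_smul⟩
  · rintro ⟨v, hv0, hv⟩
    exact Module.End.hasEigenvalue_of_hasEigenvector
      ⟨Module.End.mem_eigenspace_iff.2 (by simpa using hv), hv0⟩

/-! ### Identification of the dominant eigenvalues and of the spectral projections. -/

namespace DigitTransducer

variable {q d : ℕ} {σ : Type*} {T : DigitTransducer q d σ} [Fintype σ] [DecidableEq σ]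

/-- Every harmonic function is the combination of the `v C` given by its values on the final
components. -/
theorem eq_sum_of_harmonic {v : Finset σ → σ → ℂ}
    (hv : ∀ C ∈ T.finalComponents, (T.matrix 0).mulVec (v C) = (q : ℂ) ^ d • v C)
    (hv1 : ∀ C ∈ T.finalComponents, ∀ s ∈ C, v C s = 1)
    (hv0 : ∀ C ∈ T.finalComponents, ∀ C' ∈ T.finalComponents, C' ≠ C → ∀ s ∈ C', v C s = 0)
    {x : σ → ℂ} (hx : (T.matrix 0).mulVec x = (q : ℂ) ^ d • x) {c : Finset σ → ℂ}
    (hc : ∀ C ∈ T.finalComponents, ∃ s ∈ C, x s = c C) :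
    x = ∑ C ∈ T.finalComponents, c C • v C := by
  rw [← sub_eq_zero]
  have hharm : (T.matrix 0).mulVec (x - ∑ C ∈ T.finalComponents, c C • v C)
      = (q : ℂ) ^ d • (x - ∑ C ∈ T.finalComponents, c C • v C) := by
    rw [Matrix.mulVec_sub, hx, Matrix.mulVec_sum, smul_sub, Finset.smul_sum]
    congr 1
    refine Finset.sum_congr rfl fun C hC => ?_
    rw [Matrix.mulVec_smul, hv C hC, smul_comm]
  rw [matrix_zero_mulVec_eq_smul_iff] at hharm
  refine eq_zero_of_eq_zero_on_finalComponents (T := T) (ζ := 1) (by simp) (by simpa using hharm) ?_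
  intro C hC t ht
  obtain ⟨s, hs, hxs⟩ := hc C hC
  rw [(mem_finalComponents.1 hC).eq_of_harmonic (fun t _ => hharm t) ht hs, Pi.sub_apply,
    Finset.sum_apply, Finset.sum_eq_single_of_mem C hC fun C' hC' hne => by
      rw [Pi.smul_apply, hv0 C' hC' C hC hne.symm s hs, smul_zero], Pi.smul_apply, hv1 C hC s hs,
    hxs]
  simp

theorem continuous_matrix_apply (s s' : σ) : Continuous fun t : ℝ => T.matrix t s s' :=
  (contDiff_matrix_apply s s').continuous

/-- The linear map sending `a` to `a (M(t) - μ)` together with all pairings `a · v_C(t)` is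
injective at `(0, q^d)`, because the `v_C(0)` span the harmonic functions. Injectivity is an open
condition in `(t, μ)`. -/
theorem eventually_left_eigenvector_eq_zero [NeZero q] {v : Finset σ → ℝ → σ → ℂ}
    (hvc : ∀ C ∈ T.finalComponents, ContinuousAt (v C) 0)
    (hv : ∀ C ∈ T.finalComponents, (T.matrix 0).mulVec (v C 0) = (q : ℂ) ^ d • v C 0)
    (hv1 : ∀ C ∈ T.finalComponents, ∀ s ∈ C, v C 0 s = 1)
    (hv0 : ∀ C ∈ T.finalComponents, ∀ C' ∈ T.finalComponents, C' ≠ C → ∀ s ∈ C', v C 0 s = 0) :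
    ∀ᶠ p : ℝ × ℂ in 𝓝 (0, (q : ℂ) ^ d), ∀ a : σ → ℂ, (T.matrix p.1).vecMul a = p.2 • a →
      (∀ C ∈ T.finalComponents, a ⬝ᵥ v C p.1 = 0) → a = 0 := by
  let F : ℝ × ℂ → σ → (σ → ℂ) × (T.finalComponents → ℂ) := fun p s =>
    (fun s' => (T.matrix p.1 - p.2 • (1 : Matrix σ σ ℂ)) s s', fun C => v C p.1 s)
  have hsum : ∀ p : ℝ × ℂ, ∀ a : σ → ℂ, ∑ s, a s • F p s = 0 ↔
      (T.matrix p.1).vecMul a = p.2 • a ∧ ∀ C ∈ T.finalComponents, a ⬝ᵥ v C p.1 = 0 := by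
    intro p a
    have h1 : (∑ s, a s • F p s).1 = (T.matrix p.1).vecMul a - p.2 • a := by
      have h : (T.matrix p.1).vecMul a - p.2 • a
          = (T.matrix p.1 - p.2 • (1 : Matrix σ σ ℂ)).vecMul a := by
        rw [Matrix.vecMul_sub, Matrix.vecMul_smul, Matrix.vecMul_one]
      rw [h, Prod.fst_sum]
      funext s'
      rw [Finset.sum_apply]
      rfl
    have h2 : ∀ C, (∑ s, a s • F p s).2 C = a ⬝ᵥ v C p.1 := by
      intro C
      rw [Prod.snd_sum, Finset.sum_apply]
      rfl
    rw [Prod.ext_iff, h1, Prod.fst_zero, sub_eq_zero, Prod.snd_zero]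
    refine and_congr Iff.rfl ⟨fun h C hC => ?_, fun h => funext fun C => ?_⟩
    · rw [← h2 ⟨C, hC⟩, h]; rfl
    · rw [h2]; exact h C C.2
  have hFc : ContinuousAt F (0, (q : ℂ) ^ d) := by
    refine continuousAt_pi.2 fun s => ContinuousAt.prodMk ?_ ?_
    · refine continuousAt_pi.2 fun s' => ?_
      change ContinuousAt (fun p : ℝ × ℂ => T.matrix p.1 s s' - p.2 • (1 : Matrix σ σ ℂ) s s') _
      exact (((continuous_matrix_apply s s').comp continuous_fst).sub
        (continuous_snd.smul continuous_const)).continuousAt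
    · refine continuousAt_pi.2 fun C => ?_
      exact ContinuousAt.comp (f := Prod.fst) (g := fun t => v C t s)
        (continuousAt_pi.1 (hvc C C.2) s) continuousAt_fst
  have h := eventually_forall_sum_smul_eq_zero hFc ?_
  · filter_upwards [h] with p hp a ha ha'
    exact hp a ((hsum p a).2 ⟨ha, ha'⟩)
  · intro a ha
    obtain ⟨ha1, ha2⟩ := (hsum _ a).1 ha
    have hq : (0 : ℝ) < (q : ℝ) ^ d := by have := NeZero.pos q; positivity
    refine Matrix.eq_zero_of_vecMul_eq_smul_of_dotProduct_eq_zero hq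
      (fun s => (T.sum_norm_matrix_zero s).le) (by simp) ha1 fun x hx => ?_
    have hx' := eq_sum_of_harmonic (v := fun C => v C 0) hv hv1 hv0 hx
      (c := fun C => if h : C.Nonempty then x h.choose else 0) (fun C hC => by
        have hne := (mem_finalComponents.1 hC).nonempty
        exact ⟨hne.choose, hne.choose_spec, by rw [dif_pos hne]⟩)
    rw [hx', dotProduct_sum]
    exact Finset.sum_eq_zero fun C hC => by rw [dotProduct_smul, ha2 C hC, smul_zero]

/-- The eigenvalue closest to `q^d` is at least as close as `μ(t)`. If it were different, its left
eigenvector, extended by zero, would be orthogonal to `v_C` (different eigenvalues) and to the other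
`v_C'` (disjoint supports), hence zero. -/
theorem eventually_dominantEigenvalue_eq {C : Finset σ} (hC : C ∈ T.finalComponents)
    {u : ℝ → σ → ℂ} {v : Finset σ → ℝ → σ → ℂ} {μ : ℝ → ℂ} (hμ0 : μ 0 = (q : ℂ) ^ d)
    (hμc : ContinuousAt μ 0)
    (hu : ∀ᶠ t in 𝓝 (0 : ℝ), (T.matrix t).vecMul (u t) = μ t • u t ∧ u t ≠ 0)
    (huC : ∀ t, ∀ s ∉ C, u t s = 0)
    (hv : ∀ᶠ t in 𝓝 (0 : ℝ), (T.matrix t).mulVec (v C t) = μ t • v C t)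
    (hv0 : ∀ C' ∈ T.finalComponents, C ≠ C' → ∀ᶠ t in 𝓝 (0 : ℝ), ∀ s ∈ C, v C' t s = 0)
    (hinj : ∀ᶠ p : ℝ × ℂ in 𝓝 (0, (q : ℂ) ^ d), ∀ a : σ → ℂ, (T.matrix p.1).vecMul a = p.2 • a →
      (∀ C ∈ T.finalComponents, a ⬝ᵥ v C p.1 = 0) → a = 0) :
    ∀ᶠ t in 𝓝 (0 : ℝ), T.dominantEigenvalue C t = μ t := by
  have hF := mem_finalComponents.1 hC
  rw [nhds_prod_eq] at hinj
  obtain ⟨P, hP, Q, hQ, hPQ⟩ := Filter.eventually_prod_iff.1 hinj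
  obtain ⟨r, hr, hball⟩ := Metric.eventually_nhds_iff.1 hQ
  have hμr : ∀ᶠ t in 𝓝 (0 : ℝ), dist (μ t) ((q : ℂ) ^ d) < r := by
    rw [← hμ0]
    exact hμc.eventually (Metric.ball_mem_nhds _ hr)
  have hv0' : ∀ᶠ t in 𝓝 (0 : ℝ), ∀ C' ∈ T.finalComponents, C ≠ C' → ∀ s ∈ C, v C' t s = 0 := by
    refine (Filter.eventually_all_finset _).2 fun C' hC' => ?_
    by_cases h : C = C'
    · simp [h]
    · filter_upwards [hv0 C' hC' h] with t ht _ using ht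
  filter_upwards [hP, hμr, hu, hv, hv0'] with t htP htr htu htv htv0
  have hmem : μ t ∈ spectrum ℂ (T.componentMatrix C t) := by
    have hext : extendByZero C (fun s : C => u t s) = u t := by
      funext s
      by_cases hs : s ∈ C
      · rw [extendByZero_of_mem hs]
      · rw [extendByZero_of_notMem hs, huC t s hs]
    rw [Matrix.mem_spectrum_iff_exists_vecMul]
    refine ⟨fun s : C => u t s, fun h => htu.2 ?_, ?_⟩
    · rw [← hext, h]
      funext s
      by_cases hs : s ∈ C <;> simp [extendByZero, hs]
    · funext s
      have := congrFun htu.1 s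
      rw [← hext, hF.vecMul_extendByZero, ← extendByZero_smul, extendByZero_of_mem s.2,
        extendByZero_of_mem s.2] at this
      exact this
  have hex : ∃ m, m ∈ spectrum ℂ (T.componentMatrix C t) ∧
      ∀ ν ∈ spectrum ℂ (T.componentMatrix C t), ‖m - (q : ℂ) ^ d‖ ≤ ‖ν - (q : ℂ) ^ d‖ :=
    Set.exists_min_image _ (fun ν => ‖ν - (q : ℂ) ^ d‖) (Matrix.finite_spectrum _) ⟨_, hmem⟩
  obtain ⟨hm1, hm2⟩ := Classical.epsilon_spec hex
  change T.dominantEigenvalue C t ∈ _ at hm1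
  have hm2 : ‖T.dominantEigenvalue C t - (q : ℂ) ^ d‖ ≤ ‖μ t - (q : ℂ) ^ d‖ := hm2 _ hmem
  set m := T.dominantEigenvalue C t
  by_contra hne
  obtain ⟨a, ha0, ha⟩ := Matrix.mem_spectrum_iff_exists_vecMul.1 hm1
  have haM : (T.matrix t).vecMul (extendByZero C a) = m • extendByZero C a := by
    rw [hF.vecMul_extendByZero, ha, extendByZero_smul]
  have hQm : Q m := hball (by rw [dist_eq_norm] at htr ⊢; exact hm2.trans_lt htr)
  have hz := hPQ htP hQm (extendByZero C a) haM fun C' hC' => by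
    by_cases h : C = C'
    · subst h
      have := Matrix.dotProduct_mulVec (extendByZero C a) (T.matrix t) (v C t)
      rw [htv, haM, dotProduct_smul, smul_dotProduct, smul_eq_mul, smul_eq_mul, ← sub_eq_zero,
        ← sub_mul] at this
      exact (mul_eq_zero.1 this).resolve_left (sub_ne_zero.2 (Ne.symm hne))
    · rw [extendByZero_dotProduct]
      exact Finset.sum_eq_zero fun s _ => by
        change a s * v C' t s = 0
        rw [htv0 C' hC' h s s.2, mul_zero]
  refine ha0 ?_
  funext s
  rw [← extendByZero_of_mem (y := a) s.2, hz]
  rfl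

/-- Characterization of spectral projections by right eigenvectors. -/
theorem _root_.spectralProjection_eq_of_dotProduct {A : Matrix σ σ ℂ} {S : Set ℂ} {e w : σ → ℂ}
    {ι : Type*} {I : Set ι} {v : ι → σ → ℂ} {μ : ι → ℂ} (hμ : ∀ i ∈ I, μ i ∈ S)
    (hv : ∀ i ∈ I, A.mulVec (v i) = μ i • v i)
    (hw : w ∈ ⨆ ν ∈ S, Module.End.maxGenEigenspace A.vecMulLinear ν)
    (hew : ∀ i ∈ I, (e - w) ⬝ᵥ v i = 0)
    (hinj : ∀ ν ∈ S, ∀ a, A.vecMul a = ν • a → (∀ i ∈ I, a ⬝ᵥ v i = 0) → a = 0) :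
    spectralProjection A.vecMulLinear S e = w := by
  set f : Module.End ℂ (σ → ℂ) := A.vecMulLinear with hf
  refine (spectralProjection_unique f S e w hw ?_).symm
  obtain ⟨ha, hb⟩ := spectralProjection_spec f S (e - w)
  set a := spectralProjection f S (e - w) with hadef
  suffices a = 0 by rwa [this, sub_zero] at hb
  -- The defect `a` lies in an `f`-invariant space orthogonal to all `v i`. If this space were
  -- nonzero it would contain an eigenvector, with eigenvalue in `S`, which `hinj` excludes.
  let W : Submodule ℂ (σ → ℂ) :=
    { carrier := {x | x ∈ (⨆ ν ∈ S, f.maxGenEigenspace ν) ∧ ∀ i ∈ I, x ⬝ᵥ v i = 0}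
      zero_mem' := ⟨Submodule.zero_mem _, by simp⟩
      add_mem' := fun {x y} hx hy => ⟨Submodule.add_mem _ hx.1 hy.1, fun i hi => by
        rw [add_dotProduct, hx.2 i hi, hy.2 i hi, add_zero]⟩
      smul_mem' := fun r x hx => ⟨Submodule.smul_mem _ r hx.1, fun i hi => by
        rw [smul_dotProduct, hx.2 i hi, smul_zero]⟩ }
  have haW : a ∈ W := by
    refine ⟨ha, fun i hi => ?_⟩
    have h1 := Matrix.dotProduct_eq_zero_of_mem_iSup (A := A) (S := Sᶜ) (fun h => h (hμ i hi)) hb (hv i hi)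
    rw [sub_dotProduct, hew i hi, zero_sub, neg_eq_zero] at h1
    exact h1
  have hfS : ∀ x ∈ (⨆ ν ∈ S, f.maxGenEigenspace ν), f x ∈ (⨆ ν ∈ S, f.maxGenEigenspace ν) := by
    intro x hx
    have : (⨆ ν ∈ S, f.maxGenEigenspace ν) ≤ (⨆ ν ∈ S, f.maxGenEigenspace ν).comap f :=
      iSup₂_le fun ν hν y hy => Submodule.mem_iSup_of_mem ν (Submodule.mem_iSup_of_mem hν
        (Module.End.mapsTo_maxGenEigenspace_of_comm (Commute.refl f) ν hy))
    exact this hx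
  have hfW : ∀ x ∈ W, f x ∈ W := fun x hx => ⟨hfS x hx.1, fun i hi => by
    rw [hf, Matrix.vecMulLinear_apply, ← Matrix.dotProduct_mulVec, hv i hi, dotProduct_smul,
      hx.2 i hi, smul_zero]⟩
  by_contra hne
  have : Nontrivial W := ⟨⟨⟨a, haW⟩, 0, fun h => hne (congrArg Subtype.val h)⟩⟩
  obtain ⟨ν, hν⟩ := Module.End.exists_eigenvalue (f.restrict hfW)
  obtain ⟨x, hx⟩ := hν.exists_hasEigenvector
  have hfx : f x.1 = ν • x.1 := congrArg Subtype.val hx.apply_eq_smul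
  have hx0 : x.1 ≠ 0 := fun h => hx.2 (Subtype.ext h)
  have hνS : ν ∈ S := by
    by_contra hνS
    have hd : Disjoint (⨆ μ ∈ S, f.maxGenEigenspace μ) (⨆ μ ∈ Sᶜ, f.maxGenEigenspace μ) :=
      f.independent_maxGenEigenspace.disjoint_biSup_biSup disjoint_compl_right
    refine hx0 (Submodule.disjoint_def.mp hd _ x.2.1 ?_)
    exact Submodule.mem_iSup_of_mem ν (Submodule.mem_iSup_of_mem hνS
      (Module.End.eigenspace_le_maxGenEigenspace (Module.End.mem_eigenspace_iff.2 hfx)))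
  exact hx0 (hinj ν hνS x.1 hfx x.2.2)

end DigitTransducer

/-! ### The vectors `w_l` and the constants of the expansion. -/

namespace DigitTransducer

variable {q d : ℕ} {σ : Type*} {T : DigitTransducer q d σ} [Fintype σ] [DecidableEq σ]

theorem dotProduct_eq_zero_of_forall {C : Finset σ} {x y : σ → ℂ} (hx : ∀ s ∉ C, x s = 0)
    (hy : ∀ s ∈ C, y s = 0) : x ⬝ᵥ y = 0 :=
  Finset.sum_eq_zero fun s _ => by
    by_cases hs : s ∈ C
    · rw [hy s hs, mul_zero]
    · rw [hx s hs, zero_mul]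

theorem finalComponents_nonempty : T.finalComponents.Nonempty := by
  obtain ⟨C, -, hC, -⟩ := T.exists_isFinalComponent T.init
  exact ⟨C, mem_finalComponents.2 hC⟩

/-- Differentiable left and right eigenvectors for the dominant eigenvalues, and the resulting
formula for `w_0(t)`. -/
theorem exists_eigenbasis [NeZero q] (T : DigitTransducer q d σ) :
    ∃ u v : Finset σ → ℝ → σ → ℂ,
      (∀ C ∈ T.finalComponents, T.dominantEigenvalue C 0 = (q : ℂ) ^ d ∧
        DifferentiableAt ℝ (T.dominantEigenvalue C) 0 ∧
        DifferentiableAt ℝ (u C) 0 ∧ DifferentiableAt ℝ (v C) 0 ∧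
        (∀ t, ∀ s ∉ C, u C t s = 0) ∧ (∀ s ∈ C, v C 0 s = 1) ∧ ∑ s ∈ C, u C 0 s = 1) ∧
      (∀ᶠ t in 𝓝 (0 : ℝ), (∀ C ∈ T.finalComponents,
        (T.matrix t).mulVec (v C t) = T.dominantEigenvalue C t • v C t ∧ u C t ⬝ᵥ v C t ≠ 0 ∧
        ∀ C' ∈ T.finalComponents, C' ≠ C → ∀ s ∈ C', v C t s = 0) ∧
        T.leftVec 0 t = ∑ C ∈ T.finalComponents, (v C t T.init / (u C t ⬝ᵥ v C t)) • u C t) := by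
  choose! u v μ hμ0 hμd hud hvd hev huC hv1 hu1 using
    fun (C : Finset σ) (hC : C ∈ T.finalComponents) => exists_eigenpairs hC
  have hev' : ∀ᶠ t in 𝓝 (0 : ℝ), ∀ C ∈ T.finalComponents, (T.matrix t).vecMul (u C t) = μ C t • u C t ∧
      (T.matrix t).mulVec (v C t) = μ C t • v C t ∧
        ∀ C' ∈ T.finalComponents, C' ≠ C → ∀ s ∈ C', v C t s = 0 :=
    (Filter.eventually_all_finset _).2 hev
  have hev0 := hev'.self_of_nhds
  have hinj := eventually_left_eigenvector_eq_zero (T := T) (v := v)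
    (fun C hC => (hvd C hC).continuousAt) (fun C hC => by rw [(hev0 C hC).2.1, hμ0 C hC]) hv1
    (fun C hC => (hev0 C hC).2.2)
  have huv0 : ∀ C ∈ T.finalComponents, u C 0 ⬝ᵥ v C 0 = 1 := by
    intro C hC
    rw [← hu1 C hC, dotProduct, ← Finset.sum_subset (Finset.subset_univ C) fun s _ hs => by
      rw [huC C hC 0 s hs, zero_mul]]
    exact Finset.sum_congr rfl fun s hs => by rw [hv1 C hC s hs, mul_one]
  have huv : ∀ᶠ t in 𝓝 (0 : ℝ), ∀ C ∈ T.finalComponents, u C t ⬝ᵥ v C t ≠ 0 := by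
    refine (Filter.eventually_all_finset _).2 fun C hC => ?_
    have hcont : ContinuousAt (fun t => u C t ⬝ᵥ v C t) 0 := by
      simp only [dotProduct]
      exact tendsto_finsetSum _ fun s _ => ((continuousAt_pi.1 (hud C hC).continuousAt) s).mul
        ((continuousAt_pi.1 (hvd C hC).continuousAt) s)
    exact hcont.eventually_ne (by rw [huv0 C hC]; exact one_ne_zero)
  have hdom : ∀ᶠ t in 𝓝 (0 : ℝ), ∀ C ∈ T.finalComponents, T.dominantEigenvalue C t = μ C t := by
    refine (Filter.eventually_all_finset _).2 fun C hC => ?_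
    refine eventually_dominantEigenvalue_eq hC (hμ0 C hC) (hμd C hC).continuousAt (u := u C) (v := v)
      ?_ (huC C hC) ?_ ?_ hinj
    · filter_upwards [hev', huv] with t h1 h2
      refine ⟨(h1 C hC).1, fun h => h2 C hC ?_⟩
      rw [h, zero_dotProduct]
    · filter_upwards [hev'] with t h1 using (h1 C hC).2.1
    · intro C' hC' hne
      filter_upwards [hev'] with t h1 using (h1 C' hC').2.2 C hC hne
  have hdom0 := hdom.self_of_nhds
  have hinj' : ∀ᶠ t in 𝓝 (0 : ℝ), ∀ C ∈ T.finalComponents, ∀ a : σ → ℂ,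
      (T.matrix t).vecMul a = μ C t • a → (∀ C ∈ T.finalComponents, a ⬝ᵥ v C t = 0) → a = 0 := by
    refine (Filter.eventually_all_finset _).2 fun C hC => ?_
    have hc : ContinuousAt (fun t => (t, μ C t)) 0 := continuousAt_id.prodMk (hμd C hC).continuousAt
    have : Tendsto (fun t => (t, μ C t)) (𝓝 0) (𝓝 (0, (q : ℂ) ^ d)) := by
      have := hc.tendsto
      rwa [hμ0 C hC] at this
    exact this.eventually hinj
  refine ⟨u, v, fun C hC => ⟨by rw [hdom0 C hC, hμ0 C hC], ?_, hud C hC, hvd C hC, huC C hC,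
    hv1 C hC, hu1 C hC⟩, ?_⟩
  · refine (hμd C hC).congr_of_eventuallyEq ?_
    filter_upwards [hdom] with t ht using ht C hC
  · filter_upwards [hev', huv, hdom, hinj'] with t h1 h2 h3 h4
    refine ⟨fun C hC => ⟨by rw [(h1 C hC).2.1, h3 C hC], h2 C hC, (h1 C hC).2.2⟩, ?_⟩
    have hS : T.dominantEigenvalues 0 t = {z | ∃ C ∈ T.finalComponents, z = μ C t} := by
      ext z
      simp only [dominantEigenvalues, Int.cast_zero, mul_zero, zero_div, Complex.exp_zero, mul_one,
        Set.mem_ofPred_eq]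
      exact exists_congr fun C => and_congr_right fun hC => by rw [h3 C hC]
    rw [leftVec, hS]
    refine spectralProjection_eq_of_dotProduct (I := (T.finalComponents : Set (Finset σ)))
      (v := fun C => v C t) (μ := fun C => μ C t) (fun C hC => ⟨C, hC, rfl⟩)
      (fun C hC => (h1 C hC).2.1) ?_ ?_ ?_
    · refine Submodule.sum_mem _ fun C hC => Submodule.smul_mem _ _ ?_
      refine Submodule.mem_iSup_of_mem (μ C t) (Submodule.mem_iSup_of_mem ⟨C, hC, rfl⟩ ?_)
      exact Module.End.eigenspace_le_maxGenEigenspace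
        (Module.End.mem_eigenspace_iff.2 (h1 C hC).1)
    · intro C hC
      rw [sub_dotProduct, single_one_dotProduct, sum_dotProduct,
        Finset.sum_eq_single_of_mem C hC fun C' hC' hne => ?_, smul_dotProduct, smul_eq_mul,
        div_mul_cancel₀ _ (h2 C hC), sub_self]
      rw [smul_dotProduct, dotProduct_eq_zero_of_forall (huC C' hC' t)
        ((h1 C hC).2.2 C' hC' hne), smul_zero]
    · rintro _ ⟨C, hC, rfl⟩ a ha ha'
      exact h4 C hC a ha fun C hC => ha' C hC

theorem dominantEigenvalues_zero [NeZero q] (k : ℤ) : T.dominantEigenvalues k 0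
    = {(q : ℂ) ^ d * Complex.exp (2 * Real.pi * Complex.I * k / T.finalPeriod)} := by
  obtain ⟨u, v, h, -⟩ := T.exists_eigenbasis
  ext z
  simp only [dominantEigenvalues, Set.mem_ofPred_eq, Set.mem_singleton_iff]
  constructor
  · rintro ⟨C, hC, rfl⟩
    rw [(h C hC).1]
  · rintro rfl
    obtain ⟨C, hC⟩ := T.finalComponents_nonempty
    exact ⟨C, hC, by rw [(h C hC).1]⟩

theorem norm_root_of_unity (k : ℤ) :
    ‖Complex.exp (2 * Real.pi * Complex.I * k / T.finalPeriod)‖ = 1 := by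
  have : (2 * Real.pi * Complex.I * k / T.finalPeriod : ℂ)
      = ((2 * Real.pi * k / T.finalPeriod : ℝ) : ℂ) * Complex.I := by push_cast; ring
  rw [this, Complex.norm_exp_ofReal_mul_I]

/-- The eigenvalue has modulus `q^d`, so its generalized left eigenspace is an eigenspace. -/
theorem vecMul_leftVec [NeZero q] (k : ℤ) : (T.matrix 0).vecMul (T.leftVec k 0)
    = ((q : ℂ) ^ d * Complex.exp (2 * Real.pi * Complex.I * k / T.finalPeriod)) •
      T.leftVec k 0 := by
  have hq : (0 : ℝ) < (q : ℝ) ^ d := by have := NeZero.pos q; positivity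
  have h := (spectralProjection_spec (T.matrix 0).vecMulLinear (T.dominantEigenvalues k 0)
    (Pi.single T.init 1)).1
  rw [dominantEigenvalues_zero, iSup_singleton,
    Module.End.maxGenEigenspace_eq_eigenspace_of_pow_bounded hq (fun x => ⟨∑ s, ‖x s‖,
      Matrix.norm_vecMulLinear_pow_le hq.le (fun s => (T.sum_norm_matrix_zero s).le) x⟩)
      (by rw [norm_mul, norm_root_of_unity]; simp), Module.End.mem_eigenspace_iff] at h
  rw [leftVec, dominantEigenvalues_zero]
  exact h

theorem leftVec_zero_dotProduct_of_harmonic [NeZero q] {x : σ → ℂ}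
    (hx : (T.matrix 0).mulVec x = (q : ℂ) ^ d • x) : T.leftVec 0 0 ⬝ᵥ x = x T.init := by
  have h := (spectralProjection_spec (T.matrix 0).vecMulLinear (T.dominantEigenvalues 0 0)
    (Pi.single T.init 1)).2
  have h0 := Matrix.dotProduct_eq_zero_of_mem_iSup (S := (T.dominantEigenvalues 0 0)ᶜ)
    (fun h => h (by rw [dominantEigenvalues_zero]; simp)) h hx
  rw [sub_dotProduct, single_one_dotProduct, sub_eq_zero] at h0
  exact h0.symm

/-- For `p ∤ k` the left and the right eigenvector belong to different eigenvalues. Applied to `E`,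
this removes the double pole at `d`. -/
theorem leftVec_dotProduct_eq_zero_of_harmonic [NeZero q] {x : σ → ℂ} {k : ℤ}
    (hk : ¬ (T.finalPeriod : ℤ) ∣ k) (hx : (T.matrix 0).mulVec x = (q : ℂ) ^ d • x) :
    T.leftVec k 0 ⬝ᵥ x = 0 := by
  have h := Matrix.dotProduct_mulVec (T.leftVec k 0) (T.matrix 0) x
  rw [hx, vecMul_leftVec, dotProduct_smul, smul_dotProduct, smul_eq_mul, smul_eq_mul] at h
  by_contra hne
  have h1 := mul_right_cancel₀ hne h
  have hqC : (q : ℂ) ^ d ≠ 0 := by simpa using pow_ne_zero d (NeZero.ne (q : ℂ))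
  have h2 := (mul_right_eq_self₀.1 h1.symm).resolve_right hqC
  obtain ⟨m, hm⟩ := Complex.exp_eq_one_iff.1 h2
  have hp : (T.finalPeriod : ℂ) ≠ 0 := by exact_mod_cast (T.finalPeriod_pos).ne'
  refine hk ⟨m, ?_⟩
  have h3 : (2 * Real.pi * Complex.I : ℂ) ≠ 0 := Complex.two_pi_I_ne_zero
  rw [div_eq_iff hp] at hm
  have h4 : (2 * Real.pi * Complex.I : ℂ) * k = 2 * Real.pi * Complex.I * (T.finalPeriod * m) := by
    rw [hm]; ring
  exact_mod_cast mul_left_cancel₀ h3 h4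

/-- The vector of the sums of the outputs of all transitions leaving a state. -/
noncomputable def outSum (T : DigitTransducer q d σ) (s : σ) : ℂ := ∑ ε, (T.out s ε : ℂ)

/-- With `V' = ∑ v_C'(0)` and `H = ∑ μ_C'(0) v_C(0)`, differentiating the eigenvector equations
gives `i O + M V' = H + q^d V'`. Comparison with `O = q^d E + (q^d - M) K` and semisimplicity show
`H = i q^d E` and that `V' - i K` is harmonic; evaluating at the initial state yields both
constants. -/
theorem exists_mean_decomposition [NeZero q] (T : DigitTransducer q d σ) :
    (∀ C ∈ T.finalComponents, DifferentiableAt ℝ (T.dominantEigenvalue C) 0) ∧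
    DifferentiableAt ℝ (T.leftVec 0) 0 ∧
    ∃ E K : σ → ℂ, (T.matrix 0).mulVec E = (q : ℂ) ^ d • E ∧
      T.outSum = (q : ℂ) ^ d • E + ((q : ℂ) ^ d • K - (T.matrix 0).mulVec K) ∧
      E T.init = T.meanConstant ∧
      K T.init = -Complex.I * (deriv (T.leftVec 0) 0 ⬝ᵥ fun _ => 1) ∧
      T.leftVec 0 0 ⬝ᵥ K = 0 := by
  obtain ⟨u, v, h, hev⟩ := T.exists_eigenbasis
  have hq : (0 : ℝ) < (q : ℝ) ^ d := by have := NeZero.pos q; positivity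
  have hqC : (q : ℂ) ^ d ≠ 0 := by simpa using pow_ne_zero d (NeZero.ne (q : ℂ))
  have hrow := fun s => (T.sum_norm_matrix_zero s).le
  have hμ : ‖(q : ℂ) ^ d‖ = (q : ℝ) ^ d := by simp
  have hud := fun C hC => (h C hC).2.2.1
  have hvd := fun C hC => (h C hC).2.2.2.1
  have hev0 := hev.self_of_nhds
  have hwd : DifferentiableAt ℝ (T.leftVec 0) 0 := by
    have hform : DifferentiableAt ℝ
        (fun t => ∑ C ∈ T.finalComponents, (v C t T.init / (u C t ⬝ᵥ v C t)) • u C t) 0 := by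
      refine DifferentiableAt.fun_sum fun C hC => DifferentiableAt.fun_smul ?_ (hud C hC)
      refine DifferentiableAt.fun_div (differentiableAt_pi.1 (hvd C hC) _) ?_ (hev0.1 C hC).2.1
      simp only [dotProduct]
      exact DifferentiableAt.fun_sum fun s _ =>
        (differentiableAt_pi.1 (hud C hC) s).fun_mul (differentiableAt_pi.1 (hvd C hC) s)
    refine hform.congr_of_eventuallyEq ?_
    filter_upwards [hev] with t ht using ht.2
  refine ⟨fun C hC => (h C hC).2.1, hwd, ?_⟩
  have hharm : ∀ C ∈ T.finalComponents, (T.matrix 0).mulVec (v C 0) = (q : ℂ) ^ d • v C 0 :=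
    fun C hC => by rw [(hev0.1 C hC).1, (h C hC).1]
  have hsum1 : ∑ C ∈ T.finalComponents, v C 0 = fun _ => 1 := by
    have := eq_sum_of_harmonic (T := T) (v := fun C => v C 0) hharm
      (fun C hC => (h C hC).2.2.2.2.2.1) (fun C hC => (hev0.1 C hC).2.2) (x := fun _ => 1)
      matrix_zero_mulVec_one (c := fun _ => 1) (fun C hC => by
        obtain ⟨s, hs⟩ := (mem_finalComponents.1 hC).nonempty
        exact ⟨s, hs, rfl⟩)
    rw [this]
    exact Finset.sum_congr rfl fun C _ => (one_smul _ _).symm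
  -- Fredholm decomposition
  obtain ⟨a, b, ha, hab⟩ := Matrix.exists_eq_add_of_row_sum_le hq hrow hμ T.outSum
  -- The vector `b` matters only up to harmonic functions. Its component in the range of `M - q^d`
  -- gives the choice of `K` that is orthogonal to `w_0`.
  obtain ⟨a', b', ha', hab'⟩ := Matrix.exists_eq_add_of_row_sum_le hq hrow hμ b
  set K : σ → ℂ := -((T.matrix 0).mulVec b' - (q : ℂ) ^ d • b') with hK
  set E : σ → ℂ := ((q : ℂ) ^ d)⁻¹ • a with hE
  have hEM : (T.matrix 0).mulVec E = (q : ℂ) ^ d • E := by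
    rw [hE, Matrix.mulVec_smul, ha, smul_comm]
  have hbK : b = a' - K := by rw [hab', hK]; abel
  have hO : T.outSum = (q : ℂ) ^ d • E + ((q : ℂ) ^ d • K - (T.matrix 0).mulVec K) := by
    rw [hab, hE, smul_smul, mul_inv_cancel₀ hqC, one_smul, hbK, Matrix.mulVec_sub, ha', smul_sub]
    abel
  have hwK : T.leftVec 0 0 ⬝ᵥ K = 0 := by
    have hw := T.vecMul_leftVec 0
    simp only [Int.cast_zero, mul_zero, zero_div, Complex.exp_zero, mul_one] at hw
    rw [hK, dotProduct_neg, dotProduct_sub, Matrix.dotProduct_mulVec, hw, smul_dotProduct,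
      dotProduct_smul, sub_self, neg_zero]
  -- derivatives
  set v' : Finset σ → σ → ℂ := fun C => deriv (v C) 0 with hv'
  have hvder : ∀ C ∈ T.finalComponents, ∀ s, HasDerivAt (fun t => v C t s) (v' C s) 0 :=
    fun C hC s => hasDerivAt_pi.1 (hvd C hC).hasDerivAt s
  have hright : ∀ C ∈ T.finalComponents, ∀ s,
      ∑ ε, (Complex.I * T.out s ε * v C 0 (T.next s ε) + v' C (T.next s ε))
        = deriv (T.dominantEigenvalue C) 0 * v C 0 s + (q : ℂ) ^ d * v' C s := by
    intro C hC s
    have hL : HasDerivAt (fun t : ℝ => ∑ ε, Complex.exp (Complex.I * t * T.out s ε)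
          * v C t (T.next s ε))
        (∑ ε, (Complex.I * T.out s ε * v C 0 (T.next s ε) + v' C (T.next s ε))) 0 := by
      refine HasDerivAt.fun_sum fun ε _ => ?_
      have he : HasDerivAt (fun t : ℝ => Complex.exp (Complex.I * t * T.out s ε))
          (Complex.I * T.out s ε) 0 := by
        have h1 : HasDerivAt (fun t : ℝ => Complex.I * t * T.out s ε)
            (Complex.I * 1 * T.out s ε) 0 :=
          ((Complex.ofRealCLM.hasDerivAt (x := 0)).const_mul Complex.I).mul_const _
        have h2 := h1.cexp
        simpa using h2
      have := he.fun_mul (hvder C hC (T.next s ε))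
      simpa using this
    have hR : HasDerivAt (fun t : ℝ => T.dominantEigenvalue C t * v C t s)
        (deriv (T.dominantEigenvalue C) 0 * v C 0 s + T.dominantEigenvalue C 0 * v' C s) 0 :=
      (h C hC).2.1.hasDerivAt.fun_mul (hvder C hC s)
    rw [(h C hC).1] at hR
    refine hL.unique (hR.congr_of_eventuallyEq ?_)
    filter_upwards [hev] with t ht
    have := congrFun (ht.1 C hC).1 s
    rwa [matrix_mulVec] at this
  have hdot : ∀ᶠ t in 𝓝 (0 : ℝ), ∀ C ∈ T.finalComponents, T.leftVec 0 t ⬝ᵥ v C t = v C t T.init := by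
    filter_upwards [hev] with t ht C hC
    rw [ht.2, sum_dotProduct, Finset.sum_eq_single_of_mem C hC fun C' hC' hne => ?_,
      smul_dotProduct, smul_eq_mul, div_mul_cancel₀ _ (ht.1 C hC).2.1]
    rw [smul_dotProduct, dotProduct_eq_zero_of_forall ((h C' hC').2.2.2.2.1 t)
      ((ht.1 C hC).2.2 C' hC' hne), smul_zero]
  have hleft : ∀ C ∈ T.finalComponents,
      deriv (T.leftVec 0) 0 ⬝ᵥ v C 0 + T.leftVec 0 0 ⬝ᵥ v' C = v' C T.init := by
    intro C hC
    have hL : HasDerivAt (fun t : ℝ => T.leftVec 0 t ⬝ᵥ v C t)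
        (deriv (T.leftVec 0) 0 ⬝ᵥ v C 0 + T.leftVec 0 0 ⬝ᵥ v' C) 0 := by
      simp only [dotProduct, ← Finset.sum_add_distrib]
      exact HasDerivAt.fun_sum fun s _ => (hasDerivAt_pi.1 hwd.hasDerivAt s).fun_mul (hvder C hC s)
    refine hL.unique ((hvder C hC T.init).congr_of_eventuallyEq ?_)
    filter_upwards [hdot] with t ht using ht C hC
  set V' : σ → ℂ := ∑ C ∈ T.finalComponents, v' C with hV'
  set H : σ → ℂ := ∑ C ∈ T.finalComponents, deriv (T.dominantEigenvalue C) 0 • v C 0 with hH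
  -- Summing over `C` makes the outputs unweighted, because the `v_C(0)` add up to the constant 1.
  have hVeq : Complex.I • T.outSum + (T.matrix 0).mulVec V' = H + (q : ℂ) ^ d • V' := by
    funext s
    have h1 := Finset.sum_congr rfl fun C hC => hright C hC s
    simp only [Finset.sum_add_distrib] at h1
    have h2 : ∑ C ∈ T.finalComponents, ∑ ε, Complex.I * T.out s ε * v C 0 (T.next s ε)
        = Complex.I * T.outSum s := by
      rw [Finset.sum_comm, outSum, Finset.mul_sum]
      refine Finset.sum_congr rfl fun ε _ => ?_
      rw [← Finset.mul_sum, ← Finset.sum_apply, hsum1, mul_one]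
    have h3 : ∑ C ∈ T.finalComponents, ∑ ε, v' C (T.next s ε) = (T.matrix 0).mulVec V' s := by
      rw [Finset.sum_comm, matrix_zero_mulVec]
      exact Finset.sum_congr rfl fun ε _ => by rw [hV', Finset.sum_apply]
    rw [h2, h3, ← Finset.mul_sum] at h1
    rw [Pi.add_apply, Pi.smul_apply, smul_eq_mul, h1, Pi.add_apply, Pi.smul_apply, hH, hV',
      Finset.sum_apply, Finset.sum_apply]
    rfl
  have hHM : (T.matrix 0).mulVec H = (q : ℂ) ^ d • H := by
    rw [hH, Matrix.mulVec_sum, Finset.smul_sum]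
    exact Finset.sum_congr rfl fun C hC => by rw [Matrix.mulVec_smul, hharm C hC, smul_comm]
  set Z : σ → ℂ := V' - Complex.I • K with hZ
  have hZ1 : (T.matrix 0).mulVec Z - (q : ℂ) ^ d • Z = H - (Complex.I * (q : ℂ) ^ d) • E := by
    have h1 : (T.matrix 0).mulVec V' = H + (q : ℂ) ^ d • V' - Complex.I • T.outSum := by
      rw [← hVeq]; abel
    rw [hZ, Matrix.mulVec_sub, Matrix.mulVec_smul, h1, hO]
    module
  -- `(M - q^d) Z` is itself harmonic by `hZ1`, and there are no Jordan blocks at `q^d`.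
  have hZ2 : (T.matrix 0).mulVec Z = (q : ℂ) ^ d • Z := by
    refine Matrix.mulVec_eq_smul_of_row_sum_le hq hrow hμ ?_
    rw [hZ1, Matrix.mulVec_sub, Matrix.mulVec_smul, hEM, hHM]
    module
  have hH0 : H = (Complex.I * (q : ℂ) ^ d) • E := by
    rw [hZ2, sub_self] at hZ1
    exact (sub_eq_zero.1 hZ1.symm)
  have hweight : ∀ C ∈ T.finalComponents, T.weight C = v C 0 T.init := by
    intro C hC
    rw [← hdot.self_of_nhds C hC, hev0.2, sum_dotProduct,
      Finset.sum_eq_single_of_mem C hC fun C' hC' hne => ?_, weight, hev0.2]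
    · have hd : u C 0 ⬝ᵥ v C 0 = ∑ s ∈ C, u C 0 s := by
        rw [dotProduct, ← Finset.sum_subset (Finset.subset_univ C) fun s _ hs => by
          rw [(h C hC).2.2.2.2.1 0 s hs, zero_mul]]
        exact Finset.sum_congr rfl fun s hs => by rw [(h C hC).2.2.2.2.2.1 s hs, mul_one]
      rw [smul_dotProduct, hd, Finset.smul_sum]
      refine Finset.sum_congr rfl fun s hs => ?_
      rw [Finset.sum_apply, Finset.sum_eq_single_of_mem C hC fun C' hC' hne => ?_]
      · simp [hd]
      · rw [Pi.smul_apply, (h C' hC').2.2.2.2.1 0 s fun hs' => hne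
          ((mem_finalComponents.1 hC').eq_of_mem (mem_finalComponents.1 hC) hs' hs), smul_zero]
    · rw [smul_dotProduct, dotProduct_eq_zero_of_forall ((h C' hC').2.2.2.2.1 0)
        ((hev0.1 C hC).2.2 C' hC' hne), smul_zero]
  refine ⟨E, K, hEM, hO, ?_, ?_, hwK⟩
  · have h1 := congrFun hH0 T.init
    rw [hH, Finset.sum_apply] at h1
    simp only [Pi.smul_apply, smul_eq_mul] at h1
    have h2 : E T.init = -Complex.I * ((q : ℂ) ^ d)⁻¹ *
        (Complex.I * (q : ℂ) ^ d * E T.init) := by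
      field_simp
      rw [Complex.I_sq]; ring
    rw [h2, ← h1, Finset.mul_sum, meanConstant]
    refine Finset.sum_congr rfl fun C hC => ?_
    rw [drift, hweight C hC]
    ring
  -- The sum over `C` reads `w_0' · 1 + w_0 · V' = V'_init`, while harmonicity of `V' - i K` and
  -- `w_0 · K = 0` give `w_0 · V' = V'_init - i K_init`.
  · have h1 := Finset.sum_congr rfl hleft
    rw [Finset.sum_add_distrib, ← dotProduct_sum, ← dotProduct_sum, hsum1, ← hV',
      ← Finset.sum_apply, ← hV'] at h1
    have h2 := leftVec_zero_dotProduct_of_harmonic hZ2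
    rw [hZ, dotProduct_sub, dotProduct_smul, hwK, smul_zero, sub_zero, Pi.sub_apply, Pi.smul_apply,
      smul_eq_mul] at h2
    have h3 : deriv (T.leftVec 0) 0 ⬝ᵥ (fun _ => 1) = Complex.I * K T.init := by
      linear_combination h1 - h2
    rw [h3]
    linear_combination K T.init * Complex.I_sq

end DigitTransducer

/-! ### Spectral decomposition of the initial indicator vector. -/

namespace DigitTransducer

variable {q d : ℕ} {σ : Type*} {T : DigitTransducer q d σ} [Fintype σ] [DecidableEq σ]

theorem exp_eq_pow (l : ℕ) : Complex.exp (2 * Real.pi * Complex.I * (l : ℤ) / T.finalPeriod)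
    = Complex.exp (2 * Real.pi * Complex.I / T.finalPeriod) ^ l := by
  rw [← Complex.exp_nat_mul]
  congr 1
  push_cast
  ring

/-- The indicator vector of the initial state is the sum of the `w_l` and a vector of smaller growth
under `M`. -/
theorem exists_spectral_decomposition [NeZero q] (T : DigitTransducer q d σ) :
    ∃ (r : σ → ℂ) (θ B : ℝ), 0 < θ ∧ θ < (q : ℝ) ^ d ∧
      (∀ j : ℕ, ‖(((T.matrix 0).vecMulLinear : Module.End ℂ (σ → ℂ)) ^ j) r‖ ≤ B * θ ^ j) ∧
      Pi.single T.init 1 = ∑ l ∈ Finset.range T.finalPeriod, T.leftVec l 0 + r := by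
  have hq : (0 : ℝ) < (q : ℝ) ^ d := by have := NeZero.pos q; positivity
  have hqC : (q : ℂ) ^ d ≠ 0 := by simpa using pow_ne_zero d (NeZero.ne (q : ℂ))
  have hp := (T.finalPeriod_pos).ne'
  set p := T.finalPeriod with hpdef
  set f : Module.End ℂ (σ → ℂ) := (T.matrix 0).vecMulLinear with hf
  set ω := Complex.exp (2 * Real.pi * Complex.I / p) with hω
  have hprim : IsPrimitiveRoot ω p := Complex.isPrimitiveRoot_exp p hp
  have : NeZero p := ⟨hp⟩
  set lam : ℕ → ℂ := fun l => (q : ℂ) ^ d * ω ^ l with hlam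
  set Λ : Set ℂ := lam '' (Finset.range p : Set ℕ) with hΛ
  have hinj : ∀ l ∈ Finset.range p, ∀ l' ∈ Finset.range p, lam l = lam l' → l = l' := by
    intro l hl l' hl' h
    exact hprim.pow_inj (Finset.mem_range.1 hl) (Finset.mem_range.1 hl')
      (mul_left_cancel₀ hqC h)
  obtain ⟨ha, hr⟩ := spectralProjection_spec f Λ (Pi.single T.init 1)
  set a := spectralProjection f Λ (Pi.single T.init 1)
  set r := Pi.single T.init 1 - a with hrdef
  rw [hΛ, iSup_image] at ha
  simp only [Finset.mem_coe] at ha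
  obtain ⟨b, hb⟩ := (Submodule.mem_iSup_finset_iff_exists_sum _ _).1 ha
  -- Each summand is `w_l` by uniqueness of the projection: the other summands and `r` lie in
  -- generalized eigenspaces for different eigenvalues.
  have hbl : ∀ l ∈ Finset.range p, (b l : σ → ℂ) = T.leftVec l 0 := by
    intro l hl
    rw [leftVec, dominantEigenvalues_zero, exp_eq_pow]
    refine spectralProjection_unique f _ _ _ ?_ ?_
    · rw [iSup_singleton]
      exact (b l).2
    · have : Pi.single T.init 1 - (b l : σ → ℂ) = ∑ l' ∈ (Finset.range p).erase l, (b l' : σ → ℂ) + r := by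
        rw [hrdef, ← hb, ← Finset.add_sum_erase _ _ hl]
        abel
      rw [this]
      refine Submodule.add_mem _ (Submodule.sum_mem _ fun l' hl' => ?_) ?_
      · refine Submodule.mem_iSup_of_mem (lam l') (Submodule.mem_iSup_of_mem ?_ (b l').2)
        rw [Finset.mem_erase] at hl'
        exact fun h => hl'.1 (hinj l' hl'.2 l hl h)
      · have hle : (⨆ μ ∈ Λᶜ, f.maxGenEigenspace μ) ≤ ⨆ μ ∈ ({lam l} : Set ℂ)ᶜ, f.maxGenEigenspace μ := by
          refine biSup_mono fun μ hμ => ?_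
          rintro rfl
          exact hμ ⟨l, hl, rfl⟩
        exact hle hr
  have hbd : ∀ x, ∃ B, ∀ j : ℕ, ‖(f ^ j) x‖ ≤ B * ((q : ℝ) ^ d) ^ j := fun x => ⟨_,
    Matrix.norm_vecMulLinear_pow_le hq.le (fun s => (T.sum_norm_matrix_zero s).le) x⟩
  obtain ⟨θ, B, hθ0, hθ, hB⟩ := Module.End.exists_norm_pow_le_of_mem_iSup (S := Λᶜ) hq (by
    intro μ hμ hev
    obtain ⟨x, hx⟩ := hev.exists_hasEigenvector
    refine lt_of_le_of_ne (Module.End.norm_eigenvalue_le_of_pow_bounded hq hbd hx.2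
      hx.apply_eq_smul) fun hnorm => hμ ?_
    -- An eigenvalue of modulus `q^d` also has a right eigenvector, to which the maximum principle
    -- applies; it then belongs to `Λ`.
    obtain ⟨y, hy0, hy⟩ := Matrix.exists_mulVec_eq_smul_iff.2 ⟨x, hx.2, hx.apply_eq_smul⟩
    have hζ : ‖μ / (q : ℂ) ^ d‖ = 1 := by
      rw [norm_div, hnorm, norm_pow, Complex.norm_natCast, div_self hq.ne']
    have hpow := pow_finalPeriod_eq_one_of_eigenvector (T := T) hζ hy0 (fun s => by
      rw [mul_div_cancel₀ _ hqC]
      exact matrix_zero_mulVec_eq_smul_iff.1 hy s)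
    obtain ⟨l, hl, h⟩ := hprim.eq_pow_of_pow_eq_one hpow
    refine ⟨l, Finset.mem_coe.2 (Finset.mem_range.2 hl), ?_⟩
    rw [hlam]
    simp only
    rw [h, mul_div_cancel₀ _ hqC]) hr
  refine ⟨r, θ, B, hθ0, hθ, hB, ?_⟩
  rw [← Finset.sum_congr rfl hbl, hb, hrdef]
  abel

end DigitTransducer

/-! ### Increments of sequences of polynomial growth. -/

section Increments

theorem norm_sub_le_of_increment {V : Type*} [SeminormedAddCommGroup V] {g : ℕ → V} {C a : ℝ}
    (ha : 0 ≤ a) (hC : 0 ≤ C) (h : ∀ N : ℕ, ‖g (N + 1) - g N‖ ≤ C * ((N : ℝ) + 1) ^ a) (N k : ℕ) :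
    ‖g (N + k) - g N‖ ≤ k * (C * ((N : ℝ) + k) ^ a) := by
  induction k with
  | zero => simp
  | succ k ih =>
    have h1 := h (N + k)
    have h2 : ((N : ℝ) + k) ^ a ≤ ((N : ℝ) + (k + 1 : ℕ)) ^ a := by
      refine Real.rpow_le_rpow (by positivity) ?_ ha
      push_cast; linarith
    calc ‖g (N + (k + 1)) - g N‖ = ‖(g (N + k + 1) - g (N + k)) + (g (N + k) - g N)‖ := by
          congr 1; rw [← add_assoc]; abel
      _ ≤ _ := norm_add_le _ _
      _ ≤ C * (((N + k : ℕ) : ℝ) + 1) ^ a + k * (C * ((N : ℝ) + k) ^ a) := add_le_add h1 ih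
      _ ≤ C * ((N : ℝ) + (k + 1 : ℕ)) ^ a + k * (C * ((N : ℝ) + (k + 1 : ℕ)) ^ a) := by
          gcongr ?_ + ?_
          · refine le_of_eq ?_
            push_cast; ring
          · gcongr
      _ = _ := by push_cast; ring

theorem abs_pow_sub_pow_le_rpow {x y : ℝ} (hx : 0 ≤ x) (hxy : x ≤ y) (hy : y ≤ x + 1) (hy1 : 1 ≤ y)
    {d : ℕ} {a : ℝ} (ha : (d : ℝ) - 1 ≤ a) : |y ^ d - x ^ d| ≤ d * y ^ a := by
  rcases d with _ | k
  · simp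
  have hy0 : 0 < y := by linarith
  have h := abs_pow_sub_pow_le y x (k + 1)
  rw [abs_of_nonneg (sub_nonneg.2 hxy), abs_of_nonneg hy0.le, abs_of_nonneg hx, max_eq_left hxy,
    Nat.add_sub_cancel, mul_assoc] at h
  refine h.trans ((mul_le_of_le_one_left (by positivity) (by linarith)).trans ?_)
  refine mul_le_mul_of_nonneg_left ?_ (Nat.cast_nonneg _)
  rw [← Real.rpow_natCast]
  refine Real.rpow_le_rpow_of_exponent_le hy1 ?_
  push_cast at ha
  linarith

theorem exists_logb_le_rpow {q : ℕ} (hq : 2 ≤ q) {η : ℝ} (hη : 0 < η) :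
    ∃ C : ℝ, 0 ≤ C ∧ ∀ y : ℝ, 0 ≤ y → Real.logb q y ≤ C * y ^ η := by
  have hlq : 0 < Real.log q := Real.log_pos (by exact_mod_cast hq)
  refine ⟨(η * Real.log q)⁻¹, by positivity, fun y hy => ?_⟩
  rw [Real.logb, div_le_iff₀ hlq]
  refine (Real.log_le_rpow_div hy hη).trans (le_of_eq ?_)
  field_simp

/-- The increment of `y^d log y` is of order `y^(d-1) log y`, and an exponent strictly above `d - 1`
absorbs the logarithm. -/
theorem exists_abs_pow_mul_logb_sub_le {q d : ℕ} (hq : 2 ≤ q) (hd : 1 ≤ d) {a : ℝ}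
    (ha : (d : ℝ) - 1 < a) : ∃ C : ℝ, 0 ≤ C ∧ ∀ x y : ℝ, 1 ≤ x → x ≤ y → y ≤ x + 1 →
      |y ^ d * Real.logb q y - x ^ d * Real.logb q x| ≤ C * y ^ a := by
  obtain ⟨C, hC0, hC⟩ := exists_logb_le_rpow hq (η := a - (d - 1)) (by linarith)
  have hlq : 0 < Real.log q := Real.log_pos (by exact_mod_cast hq)
  have hq1 : (1 : ℝ) < q := by exact_mod_cast hq
  refine ⟨d * C + (Real.log q)⁻¹, by positivity, fun x y hx hxy hy => ?_⟩
  have hx0 : 0 < x := by linarith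
  have hy0 : 0 < y := by linarith
  have hy1 : 1 ≤ y := hx.trans hxy
  have hd1 : (1 : ℝ) ≤ d := by exact_mod_cast hd
  have hsplit : y ^ d * Real.logb q y - x ^ d * Real.logb q x
      = (y ^ d - x ^ d) * Real.logb q y + x ^ d * (Real.logb q y - Real.logb q x) := by ring
  have hlogy : 0 ≤ Real.logb q y := Real.logb_nonneg hq1 hy1
  have h1 : |(y ^ d - x ^ d) * Real.logb q y| ≤ d * C * y ^ a := by
    rw [abs_mul, abs_of_nonneg hlogy]
    calc _ ≤ (d * y ^ ((d : ℝ) - 1)) * (C * y ^ (a - (d - 1))) :=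
          mul_le_mul (abs_pow_sub_pow_le_rpow hx0.le hxy hy hy1 le_rfl) (hC y hy0.le) hlogy (by positivity)
      _ = d * C * (y ^ ((d : ℝ) - 1) * y ^ (a - (d - 1))) := by ring
      _ = _ := by rw [← Real.rpow_add hy0]; congr 2; ring
  have h2 : |x ^ d * (Real.logb q y - Real.logb q x)| ≤ (Real.log q)⁻¹ * y ^ a := by
    have hmono : Real.logb q x ≤ Real.logb q y := Real.logb_le_logb_of_le hq1 hx0 hxy
    rw [abs_of_nonneg (mul_nonneg (by positivity) (sub_nonneg.2 hmono)), Real.logb, Real.logb,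
      ← sub_div, ← Real.log_div hy0.ne' hx0.ne']
    have h3 : Real.log (y / x) ≤ x⁻¹ := by
      refine (Real.log_le_sub_one_of_pos (by positivity)).trans ?_
      rw [div_sub_one hx0.ne', div_eq_mul_inv]
      exact mul_le_of_le_one_left (by positivity) (by linarith)
    calc x ^ d * (Real.log (y / x) / Real.log q) ≤ x ^ d * (x⁻¹ / Real.log q) := by gcongr
      _ = (Real.log q)⁻¹ * x ^ ((d : ℝ) - 1) := by
          rw [Real.rpow_sub_one hx0.ne', Real.rpow_natCast]; ring
      _ ≤ (Real.log q)⁻¹ * y ^ a := by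
          gcongr
          exact (Real.rpow_le_rpow hx0.le hxy (by linarith)).trans
            (Real.rpow_le_rpow_of_exponent_le hy1 ha.le)
  rw [hsplit, add_mul]
  exact (abs_add_le _ _).trans (add_le_add h1 h2)

end Increments

/-! ### The digit recursion for box sums and its normalisation. -/

section Digits

variable {q d : ℕ} [NeZero q]

theorem sup_digits_length_le_iff (hq : 2 ≤ q) (n : Fin d → ℕ) (k : ℕ) :
    (Finset.univ.sup fun i => (Nat.digits q (n i)).length) ≤ k ↔ ∀ i, n i < q ^ k := by
  simp only [Finset.sup_le_iff, Finset.mem_univ, true_implies]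
  exact forall_congr' fun i => Nat.digits_length_le_iff (by omega) _

/-- The zero vector has to be excluded: its expansion is empty and does not start with the digit
vector 0. -/
theorem jointDigits_mul_add (hq : 2 ≤ q) (n : Fin d → ℕ) (ε : Fin d → Fin q)
    (h : (fun i => q * n i + ε i) ≠ 0) :
    jointDigits q (fun i => q * n i + ε i) = ε :: jointDigits q n := by
  have hlen : (Finset.univ.sup fun i => (Nat.digits q (q * n i + ε i)).length)
      = (Finset.univ.sup fun i => (Nat.digits q (n i)).length) + 1 := by
    refine eq_of_forall_ge_iff fun k => ?_
    rw [sup_digits_length_le_iff hq]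
    rcases k with _ | k
    · constructor
      · intro hk
        refine absurd (funext fun i => ?_) h
        have := hk i
        simpa using this
      · intro hk; omega
    · rw [Nat.add_le_add_iff_right, sup_digits_length_le_iff hq]
      refine forall_congr' fun i => ⟨fun hi => ?_, fun hi => ?_⟩
      · rw [pow_succ'] at hi
        exact lt_of_mul_lt_mul_left (lt_of_le_of_lt (Nat.le_add_right _ _) hi) (Nat.zero_le q)
      · have := (ε i).2
        calc q * n i + ε i < q * n i + q := by omega
          _ = q * (n i + 1) := by ring
          _ ≤ q * q ^ k := Nat.mul_le_mul_left q hi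
          _ = q ^ (k + 1) := (pow_succ' q k).symm
  rw [jointDigits, hlen, List.range_succ_eq_map, List.map_cons, List.map_map, jointDigits]
  congr 1
  · funext i
    apply Fin.ext
    simp [Fin.ofNat, Nat.mod_eq_of_lt (ε i).2]
  · refine List.map_congr_left fun j _ => ?_
    funext i
    apply Fin.ext
    have : (q * n i + ε i) / q ^ (j + 1) = n i / q ^ j := by
      rw [pow_succ', ← Nat.div_div_eq_div_mul, Nat.mul_add_div (NeZero.pos q),
        Nat.div_eq_of_lt (ε i).2, add_zero]
    simp [this]

namespace DigitTransducer

variable {σ : Type*} {T : DigitTransducer q d σ}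

theorem outputVec_mul_add (hq : 2 ≤ q) (n : Fin d → ℕ) (ε : Fin d → Fin q)
    (h : (fun i => q * n i + ε i) ≠ 0) (s : σ) :
    T.outputVec (fun i => q * n i + ε i) s = T.out s ε + T.outputVec n (T.next s ε) := by
  rw [outputVec, jointDigits_mul_add hq n ε h]
  rfl

theorem exists_abs_wordOutput_le [Finite σ] (T : DigitTransducer q d σ) :
    ∃ B : ℝ, 0 ≤ B ∧ ∀ s w, |T.wordOutput s w| ≤ B * (w.length + 1) := by
  cases nonempty_fintype σ
  set B := ∑ s, (|T.final s| + ∑ ε, |T.out s ε|) with hB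
  have hfin : ∀ s, |T.final s| + ∑ ε, |T.out s ε| ≤ B := fun s =>
    Finset.single_le_sum (f := fun s => |T.final s| + ∑ ε, |T.out s ε|)
      (fun s _ => add_nonneg (abs_nonneg _) (Finset.sum_nonneg fun _ _ => abs_nonneg _))
      (Finset.mem_univ s)
  have hout : ∀ s ε, |T.out s ε| ≤ B := fun s ε => by
    have := Finset.single_le_sum (f := fun ε => |T.out s ε|) (fun _ _ => abs_nonneg _)
      (Finset.mem_univ ε)
    linarith [hfin s, abs_nonneg (T.final s)]
  have hfinal : ∀ s, |T.final s| ≤ B := fun s => by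
    have := Finset.sum_nonneg fun ε (_ : ε ∈ Finset.univ) => abs_nonneg (T.out s ε)
    linarith [hfin s]
  refine ⟨B, Finset.sum_nonneg fun s _ =>
    add_nonneg (abs_nonneg _) (Finset.sum_nonneg fun _ _ => abs_nonneg _), fun s w => ?_⟩
  induction w generalizing s with
  | nil => simpa [wordOutput] using hfinal s
  | cons ε w ih =>
    rw [wordOutput, List.length_cons]
    refine (abs_add_le _ _).trans ?_
    have := ih (T.next s ε)
    push_cast
    linarith [hout s ε]

/-- The box `{0, …, N-1}^d`. -/
def box (d N : ℕ) : Finset (Fin d → ℕ) := Fintype.piFinset fun _ => Finset.range N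

theorem mem_box {N : ℕ} {n : Fin d → ℕ} : n ∈ box d N ↔ ∀ i, n i < N := by simp [box]

theorem card_box (d N : ℕ) : (box d N).card = N ^ d := by simp [box]

theorem exists_abs_outputVec_le [Finite σ] (hq : 2 ≤ q) (T : DigitTransducer q d σ) {η : ℝ}
    (hη : 0 < η) : ∃ C : ℝ, 0 ≤ C ∧ ∀ N : ℕ, ∀ n ∈ box d (N + 1), ∀ s,
      |T.outputVec n s| ≤ C * ((N : ℝ) + 1) ^ η := by
  obtain ⟨B, hB0, hB⟩ := T.exists_abs_wordOutput_le
  obtain ⟨D, hD0, hD⟩ := exists_logb_le_rpow hq hη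
  refine ⟨B * (D + 2), by positivity, fun N n hn s => ?_⟩
  have hlen : (jointDigits q n).length ≤ Nat.log q (N + 1) + 1 := by
    rw [jointDigits, List.length_map, List.length_range, sup_digits_length_le_iff hq]
    intro i
    exact (mem_box.1 hn i).trans (Nat.lt_pow_succ_log_self (by omega) _)
  have h1 : (Nat.log q (N + 1) : ℝ) ≤ D * ((N : ℝ) + 1) ^ η := by
    have h := Real.natLog_le_logb (N + 1) q
    push_cast at h
    exact h.trans (hD _ (by positivity))
  have h2 : (1 : ℝ) ≤ ((N : ℝ) + 1) ^ η :=
    Real.one_le_rpow (by linarith [Nat.cast_nonneg (α := ℝ) N]) hη.le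
  have h3 : ((jointDigits q n).length : ℝ) ≤ Nat.log q (N + 1) + 1 := by exact_mod_cast hlen
  calc |T.outputVec n s| ≤ B * ((jointDigits q n).length + 1) := hB s _
    _ ≤ B * (D * ((N : ℝ) + 1) ^ η + 2 * ((N : ℝ) + 1) ^ η) :=
        mul_le_mul_of_nonneg_left (by linarith) hB0
    _ = _ := by ring

/-- The vector of the sums of `b(n)` over a box. -/
noncomputable def boxSum (T : DigitTransducer q d σ) (N : ℕ) (s : σ) : ℂ :=
  ∑ n ∈ box d N, (T.outputVec n s : ℂ)

theorem boxSum_zero (hd : 1 ≤ d) : T.boxSum 0 = 0 := by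
  funext s
  have : box d 0 = ∅ := by
    rw [← Finset.card_eq_zero, card_box, zero_pow (by omega)]
  simp [boxSum, this]

theorem box_subset (N : ℕ) : box d N ⊆ box d (N + 1) := fun _ hn =>
  mem_box.2 fun i => (mem_box.1 hn i).trans (Nat.lt_succ_self N)

/-- Division with remainder by `q` in every coordinate. -/
theorem sum_box_mul {M : Type*} [AddCommMonoid M] (f : (Fin d → ℕ) → M) (m : ℕ) :
    ∑ n ∈ box d (q * m), f n
      = ∑ ε : Fin d → Fin q, ∑ n ∈ box d m, f fun i => q * n i + ε i := by
  rw [← Finset.sum_product']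
  symm
  refine Finset.sum_nbij' (fun x i => q * x.2 i + x.1 i)
    (fun n => (fun i => Fin.ofNat q (n i), fun i => n i / q)) ?_ ?_ ?_ ?_ ?_
  · rintro ⟨ε, n⟩ h
    rw [Finset.mem_product] at h
    rw [mem_box]
    intro i
    have h1 := mem_box.1 h.2 i
    have h2 := (ε i).2
    calc q * n i + ε i < q * n i + q := by omega
      _ = q * (n i + 1) := by ring
      _ ≤ q * m := Nat.mul_le_mul_left q h1
  · intro n hn
    rw [Finset.mem_product]
    refine ⟨Finset.mem_univ _, mem_box.2 fun i => ?_⟩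
    exact Nat.div_lt_of_lt_mul (mem_box.1 hn i)
  · rintro ⟨ε, n⟩ h
    refine Prod.ext (funext fun i => Fin.ext ?_) (funext fun i => ?_)
    · simp [Nat.mod_eq_of_lt (ε i).2]
    · simp only
      rw [Nat.mul_add_div (NeZero.pos q), Nat.div_eq_of_lt (ε i).2, add_zero]
  · intro n hn
    funext i
    simp [Nat.div_add_mod]
  · intros; rfl

variable [Fintype σ] [DecidableEq σ]

/-- The least significant digit is split off everywhere; the constant corrects the single input `n =
0`, for which the digit recursion fails. -/
theorem boxSum_mul (hq : 2 ≤ q) {m : ℕ} (hm : 1 ≤ m) (s : σ) :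
    T.boxSum (q * m) s = (T.matrix 0).mulVec (T.boxSum m) s + (m : ℂ) ^ d * T.outSum s
      + ((T.outputVec 0 s : ℂ) - T.out s 0 - T.outputVec 0 (T.next s 0)) := by
  rw [boxSum, sum_box_mul]
  set c : ℂ := (T.outputVec 0 s : ℂ) - T.out s 0 - T.outputVec 0 (T.next s 0) with hc
  have hterm : ∀ (ε : Fin d → Fin q) (n : Fin d → ℕ),
      (T.outputVec (fun i => q * n i + ε i) s : ℂ) = ((T.out s ε : ℂ) + T.outputVec n (T.next s ε))
        + if ε = 0 then (if n = 0 then c else 0) else 0 := by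
    intro ε n
    by_cases h : (fun i => q * n i + (ε i : ℕ)) = 0
    · have hn : n = 0 := by
        funext i
        have := congrFun h i
        simp only [Pi.zero_apply, Nat.add_eq_zero_iff, Nat.mul_eq_zero] at this
        exact this.1.resolve_left (NeZero.ne q)
      have hε : ε = 0 := by
        funext i
        apply Fin.ext
        have := congrFun h i
        simp only [Pi.zero_apply, Nat.add_eq_zero_iff] at this
        simpa using this.2
      rw [if_pos hε, if_pos hn, h, hn, hε, hc]
      ring
    · rw [outputVec_mul_add hq n ε h]
      have : ¬ (ε = 0 ∧ n = 0) := by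
        rintro ⟨rfl, rfl⟩
        exact h (by funext i; simp)
      split_ifs with h1 h2
      · exact absurd ⟨h1, h2⟩ this
      · push_cast; ring
      · push_cast; ring
  simp only [hterm, Finset.sum_add_distrib]
  have h0 : (0 : Fin d → ℕ) ∈ box d m := mem_box.2 fun i => hm
  have hcorr : ∑ ε : Fin d → Fin q, ∑ n ∈ box d m, (if ε = 0 then (if n = 0 then c else 0) else 0)
      = c := by
    rw [Finset.sum_eq_single_of_mem 0 (Finset.mem_univ _) fun ε _ hε => by simp [hε]]
    simp [h0]
  rw [hcorr, matrix_zero_mulVec, outSum]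
  simp only [Finset.sum_const, card_box, boxSum, nsmul_eq_mul, ← Finset.mul_sum]
  push_cast
  ring

/-- The normalized box sums: the box sums without their main terms. -/
noncomputable def normalizedSum (T : DigitTransducer q d σ) (E K : σ → ℂ) (N : ℕ) : σ → ℂ :=
  T.boxSum N - ((N : ℂ) ^ d * (Real.logb q N : ℂ)) • E - ((N : ℂ) ^ d) • K

theorem normalizedSum_zero (hd : 1 ≤ d) (E K : σ → ℂ) : T.normalizedSum E K 0 = 0 := by
  rw [normalizedSum, boxSum_zero hd]
  simp [zero_pow (show d ≠ 0 by omega)]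

/-- Since `log_q (qm) = log_q m + 1`, the logarithmic term produces the part `q^d m^d E` of `m^d O`,
and `N^d K` accounts for the rest. Only a bounded inhomogeneity remains. -/
theorem normalizedSum_mul (hq : 2 ≤ q) {E K : σ → ℂ}
    (hE : (T.matrix 0).mulVec E = (q : ℂ) ^ d • E)
    (hO : T.outSum = (q : ℂ) ^ d • E + ((q : ℂ) ^ d • K - (T.matrix 0).mulVec K)) {m : ℕ}
    (hm : 1 ≤ m) : T.normalizedSum E K (q * m) = (T.matrix 0).mulVec (T.normalizedSum E K m)
      + fun s => (T.outputVec 0 s : ℂ) - T.out s 0 - T.outputVec 0 (T.next s 0) := by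
  have hlog : Real.logb q ((q * m : ℕ) : ℝ) = Real.logb q m + 1 := by
    have hq0 : (q : ℝ) ≠ 0 := NeZero.ne _
    have hm0 : (m : ℝ) ≠ 0 := by positivity
    rw [Nat.cast_mul, Real.logb_mul hq0 hm0, Real.logb_self_eq_one (by exact_mod_cast hq), add_comm]
  funext s
  have h1 := boxSum_mul (T := T) hq hm s
  have h2 := congrFun hO s
  simp only [Pi.add_apply, Pi.sub_apply, Pi.smul_apply, smul_eq_mul] at h2
  rw [normalizedSum, normalizedSum, Matrix.mulVec_sub, Matrix.mulVec_sub, Matrix.mulVec_smul,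
    Matrix.mulVec_smul, hE]
  simp only [Pi.add_apply, Pi.sub_apply, Pi.smul_apply, smul_eq_mul]
  rw [h1, h2, hlog]
  push_cast
  ring

/-- A shell has `O(N^(d-1))` points, and each output is logarithmic in `N`, hence bounded by any
positive power. -/
theorem exists_norm_boxSum_sub_le (hq : 2 ≤ q) (T : DigitTransducer q d σ) {a : ℝ}
    (ha : (d : ℝ) - 1 < a) : ∃ C : ℝ, 0 ≤ C ∧ ∀ N : ℕ,
      ‖T.boxSum (N + 1) - T.boxSum N‖ ≤ C * ((N : ℝ) + 1) ^ a := by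
  obtain ⟨C, hC0, hC⟩ := T.exists_abs_outputVec_le hq (η := a - (d - 1)) (by linarith)
  refine ⟨d * C, by positivity, fun N => ?_⟩
  have hN : (0 : ℝ) < (N : ℝ) + 1 := by positivity
  refine (pi_norm_le_iff_of_nonneg (by positivity)).2 fun s => ?_
  rw [Pi.sub_apply, boxSum, boxSum, ← Finset.sum_sdiff_eq_sub (box_subset N)]
  have hcard : ((box d (N + 1) \ box d N).card : ℝ) ≤ d * ((N : ℝ) + 1) ^ ((d : ℝ) - 1) := by
    rw [Finset.card_sdiff_of_subset (box_subset N), Nat.cast_sub (Finset.card_le_card (box_subset N)),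
      card_box, card_box]
    push_cast
    exact (le_abs_self _).trans (abs_pow_sub_pow_le_rpow (by positivity) (by linarith) le_rfl
      (by linarith [Nat.cast_nonneg (α := ℝ) N]) le_rfl)
  calc _ ≤ ∑ n ∈ box d (N + 1) \ box d N, ‖(T.outputVec n s : ℂ)‖ := norm_sum_le _ _
    _ ≤ ∑ n ∈ box d (N + 1) \ box d N, C * ((N : ℝ) + 1) ^ (a - (d - 1)) := by
        refine Finset.sum_le_sum fun n hn => ?_
        rw [Complex.norm_real, Real.norm_eq_abs]
        exact hC N n (Finset.mem_sdiff.1 hn).1 s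
    _ = (box d (N + 1) \ box d N).card * (C * ((N : ℝ) + 1) ^ (a - (d - 1))) := by
        rw [Finset.sum_const, nsmul_eq_mul]
    _ ≤ d * ((N : ℝ) + 1) ^ ((d : ℝ) - 1) * (C * ((N : ℝ) + 1) ^ (a - (d - 1))) := by gcongr
    _ = d * C * (((N : ℝ) + 1) ^ ((d : ℝ) - 1) * ((N : ℝ) + 1) ^ (a - (d - 1))) := by ring
    _ = _ := by rw [← Real.rpow_add hN]; congr 2; ring

theorem exists_norm_normalizedSum_sub_le (hq : 2 ≤ q) (hd : 1 ≤ d) (T : DigitTransducer q d σ)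
    (E K : σ → ℂ) {a : ℝ} (ha : (d : ℝ) - 1 < a) : ∃ C : ℝ, 0 ≤ C ∧ ∀ N : ℕ,
      ‖T.normalizedSum E K (N + 1) - T.normalizedSum E K N‖ ≤ C * ((N : ℝ) + 1) ^ a := by
  obtain ⟨C, hC0, hC⟩ := T.exists_norm_boxSum_sub_le hq ha
  obtain ⟨D, hD0, hD⟩ := exists_abs_pow_mul_logb_sub_le hq hd ha
  refine ⟨C + D * ‖E‖ + d * ‖K‖, by positivity, fun N => ?_⟩
  have hN : (0 : ℝ) ≤ N := Nat.cast_nonneg N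
  have h1 : ‖((N + 1 : ℕ) : ℂ) ^ d * (Real.logb q (N + 1 : ℕ) : ℂ)
      - (N : ℂ) ^ d * (Real.logb q N : ℂ)‖ ≤ D * ((N : ℝ) + 1) ^ a := by
    have : ((N + 1 : ℕ) : ℂ) ^ d * (Real.logb q (N + 1 : ℕ) : ℂ) - (N : ℂ) ^ d * (Real.logb q N : ℂ)
        = (((N : ℝ) + 1) ^ d * Real.logb q ((N : ℝ) + 1) - (N : ℝ) ^ d * Real.logb q N : ℝ) := by
      push_cast; ring
    rw [this, Complex.norm_real, Real.norm_eq_abs]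
    rcases Nat.eq_zero_or_pos N with rfl | h
    · simp; exact hD0
    · exact hD _ _ (by exact_mod_cast h) (by linarith) le_rfl
  have h2 : ‖((N + 1 : ℕ) : ℂ) ^ d - (N : ℂ) ^ d‖ ≤ d * ((N : ℝ) + 1) ^ a := by
    have : ((N + 1 : ℕ) : ℂ) ^ d - (N : ℂ) ^ d = (((N : ℝ) + 1) ^ d - (N : ℝ) ^ d : ℝ) := by
      push_cast; ring
    rw [this, Complex.norm_real, Real.norm_eq_abs]
    exact abs_pow_sub_pow_le_rpow hN (by linarith) le_rfl (by linarith) ha.le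
  have hsplit : T.normalizedSum E K (N + 1) - T.normalizedSum E K N
      = (T.boxSum (N + 1) - T.boxSum N)
        - (((N + 1 : ℕ) : ℂ) ^ d * (Real.logb q (N + 1 : ℕ) : ℂ)
          - (N : ℂ) ^ d * (Real.logb q N : ℂ)) • E
        - (((N + 1 : ℕ) : ℂ) ^ d - (N : ℂ) ^ d) • K := by
    rw [normalizedSum, normalizedSum]
    module
  rw [hsplit]
  refine (norm_sub_le _ _).trans ?_
  have h3 := norm_sub_le (T.boxSum (N + 1) - T.boxSum N)
    ((((N + 1 : ℕ) : ℂ) ^ d * (Real.logb q (N + 1 : ℕ) : ℂ)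
          - (N : ℂ) ^ d * (Real.logb q N : ℂ)) • E)
  rw [norm_smul] at h3 ⊢
  have h4 := mul_le_mul_of_nonneg_right h1 (norm_nonneg E)
  have h5 := mul_le_mul_of_nonneg_right h2 (norm_nonneg K)
  linarith [hC N]

/-- From `q ⌊N/q⌋` to `N` there are fewer than `q` increments, so the exact recursion at multiples
of `q` extends to all `N` with an error. -/
theorem exists_norm_normalizedSum_sub_mulVec_le (hq : 2 ≤ q) (hd : 1 ≤ d)
    (T : DigitTransducer q d σ) {E K : σ → ℂ} (hE : (T.matrix 0).mulVec E = (q : ℂ) ^ d • E)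
    (hO : T.outSum = (q : ℂ) ^ d • E + ((q : ℂ) ^ d • K - (T.matrix 0).mulVec K)) {a : ℝ}
    (ha : (d : ℝ) - 1 < a) : ∃ C : ℝ, 0 ≤ C ∧ ∀ N : ℕ,
      ‖T.normalizedSum E K N - (T.matrix 0).mulVec (T.normalizedSum E K (N / q))‖
        ≤ C * ((N : ℝ) + 1) ^ a := by
  obtain ⟨C, hC0, hC⟩ := T.exists_norm_normalizedSum_sub_le hq hd E K ha
  set c : σ → ℂ := fun s => (T.outputVec 0 s : ℂ) - T.out s 0 - T.outputVec 0 (T.next s 0) with hc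
  have ha0 : 0 ≤ a := by
    have : (1 : ℝ) ≤ d := by exact_mod_cast hd
    linarith
  refine ⟨q * C + ‖c‖, by positivity, fun N => ?_⟩
  have h1 := norm_sub_le_of_increment ha0 hC0 hC (q * (N / q)) (N % q)
  rw [Nat.div_add_mod] at h1
  have hNN : (((q * (N / q) : ℕ) : ℝ) + (N % q : ℕ)) = N := by exact_mod_cast Nat.div_add_mod N q
  rw [hNN] at h1
  have hN1 : (N : ℝ) ^ a ≤ ((N : ℝ) + 1) ^ a :=
    Real.rpow_le_rpow (Nat.cast_nonneg N) (by linarith) ha0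
  have h2 : ‖T.normalizedSum E K N - T.normalizedSum E K (q * (N / q))‖
      ≤ q * (C * ((N : ℝ) + 1) ^ a) := by
    refine h1.trans ?_
    have : ((N % q : ℕ) : ℝ) ≤ q := by exact_mod_cast (Nat.mod_lt N (NeZero.pos q)).le
    gcongr
  have h3 : ‖T.normalizedSum E K (q * (N / q))
      - (T.matrix 0).mulVec (T.normalizedSum E K (N / q))‖ ≤ ‖c‖ := by
    rcases Nat.eq_zero_or_pos (N / q) with h | h
    · rw [h, mul_zero, normalizedSum_zero hd, Matrix.mulVec_zero]
      simp
    · rw [normalizedSum_mul hq hE hO h, add_sub_cancel_left]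
  have h4 : (1 : ℝ) ≤ ((N : ℝ) + 1) ^ a :=
    Real.one_le_rpow (by linarith [Nat.cast_nonneg (α := ℝ) N]) ha0
  calc _ ≤ _ := norm_sub_le_norm_sub_add_norm_sub _ (T.normalizedSum E K (q * (N / q))) _
    _ ≤ q * (C * ((N : ℝ) + 1) ^ a) + ‖c‖ * ((N : ℝ) + 1) ^ a :=
        add_le_add h2 (h3.trans (le_mul_of_one_le_right (norm_nonneg c) h4))
    _ = _ := by ring

end DigitTransducer

end Digits

/-! ### Limits and Hölder continuity for scalar recursions `g(N) ≈ λ g(⌊N/q⌋)`. -/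

section ScaleLimit

variable {q d : ℕ} {lam : ℂ} {g : ℕ → ℂ} {C a : ℝ}

/-- The limit of `λ⁻ᵐ g(⌊qᵐ y⌋)` for `m → ∞`. -/
noncomputable def scaleLimit (q : ℕ) (lam : ℂ) (g : ℕ → ℂ) (y : ℝ) : ℂ :=
  limUnder atTop fun m : ℕ => (lam ^ m)⁻¹ * g ⌊(q : ℝ) ^ m * y⌋₊

theorem pow_inv_mul_rpow_eq (hq : 2 ≤ q) (a : ℝ) {y : ℝ} (hy : 0 ≤ y) (m : ℕ) :
    (((q : ℝ) ^ d) ^ m)⁻¹ * ((q : ℝ) ^ m * y) ^ a = y ^ a * ((q : ℝ) ^ (a - d)) ^ m := by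
  have hq0 : (0 : ℝ) < q := by positivity
  rw [Real.mul_rpow (by positivity) hy, ← Real.rpow_pow_comm hq0.le, Real.rpow_sub hq0,
    Real.rpow_natCast, div_pow]
  field_simp

theorem rpow_sub_lt_one (hq : 2 ≤ q) (had : a < d) : (q : ℝ) ^ (a - d) < 1 :=
  Real.rpow_lt_one_of_one_lt_of_neg (by exact_mod_cast hq) (by linarith)

/-- As `⌊q^m y⌋ = ⌊⌊q^(m+1) y⌋ / q⌋`, consecutive terms differ by one recursion error divided by
`λ^(m+1)`; for `a < d` these errors decay geometrically. -/
theorem dist_scaleSequence_le (hq : 2 ≤ q) (hlam : ‖lam‖ = (q : ℝ) ^ d) (ha : 0 ≤ a) (hC : 0 ≤ C)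
    (hrec : ∀ N : ℕ, ‖g N - lam * g (N / q)‖ ≤ C * ((N : ℝ) + 1) ^ a) {y : ℝ} (hy : 0 ≤ y) (m : ℕ) :
    dist ((lam ^ m)⁻¹ * g ⌊(q : ℝ) ^ m * y⌋₊) ((lam ^ (m + 1))⁻¹ * g ⌊(q : ℝ) ^ (m + 1) * y⌋₊)
      ≤ (C * (y + 1) ^ a) * ((q : ℝ) ^ (a - d)) ^ (m + 1) := by
  have hq0 : (0 : ℝ) < q := by positivity
  have hq1 : (1 : ℝ) ≤ q := by exact_mod_cast (by omega : 1 ≤ q)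
  have hl0 : lam ≠ 0 := by rw [← norm_pos_iff, hlam]; positivity
  set N := ⌊(q : ℝ) ^ (m + 1) * y⌋₊ with hN
  have hdiv : ⌊(q : ℝ) ^ m * y⌋₊ = N / q := by
    rw [hN, ← Nat.floor_div_natCast]
    congr 1
    rw [pow_succ]; field_simp
  have hsub : (lam ^ (m + 1))⁻¹ * g N - (lam ^ m)⁻¹ * g (N / q)
      = (lam ^ (m + 1))⁻¹ * (g N - lam * g (N / q)) := by
    rw [pow_succ]; field_simp
  rw [dist_comm, dist_eq_norm, hdiv, hsub, norm_mul, norm_inv, norm_pow, hlam]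
  have hN1 : (N : ℝ) + 1 ≤ (q : ℝ) ^ (m + 1) * (y + 1) := by
    have h1 : (N : ℝ) ≤ (q : ℝ) ^ (m + 1) * y := Nat.floor_le (by positivity)
    have h2 : (1 : ℝ) ≤ (q : ℝ) ^ (m + 1) := one_le_pow₀ hq1
    linarith
  calc _ ≤ (((q : ℝ) ^ d) ^ (m + 1))⁻¹ * (C * ((q : ℝ) ^ (m + 1) * (y + 1)) ^ a) := by
        gcongr
        exact (hrec N).trans (by gcongr)
    _ = C * ((((q : ℝ) ^ d) ^ (m + 1))⁻¹ * ((q : ℝ) ^ (m + 1) * (y + 1)) ^ a) := by ring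
    _ = _ := by rw [pow_inv_mul_rpow_eq hq a (by positivity)]; ring

theorem tendsto_scaleLimit (hq : 2 ≤ q) (hlam : ‖lam‖ = (q : ℝ) ^ d) (ha : 0 ≤ a) (had : a < d)
    (hC : 0 ≤ C) (hrec : ∀ N : ℕ, ‖g N - lam * g (N / q)‖ ≤ C * ((N : ℝ) + 1) ^ a) {y : ℝ}
    (hy : 0 ≤ y) : Tendsto (fun m : ℕ => (lam ^ m)⁻¹ * g ⌊(q : ℝ) ^ m * y⌋₊) atTop
      (𝓝 (scaleLimit q lam g y)) := by
  refine CauchySeq.tendsto_limUnder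
    (cauchySeq_of_le_geometric ((q : ℝ) ^ (a - d)) ((C * (y + 1) ^ a) * (q : ℝ) ^ (a - d))
      (rpow_sub_lt_one hq had) fun m => ?_)
  refine (dist_scaleSequence_le hq hlam ha hC hrec hy m).trans (le_of_eq ?_)
  rw [pow_succ]; ring

theorem norm_scaleSequence_sub_scaleLimit_le (hq : 2 ≤ q) (hlam : ‖lam‖ = (q : ℝ) ^ d) (ha : 0 ≤ a)
    (had : a < d) (hC : 0 ≤ C)
    (hrec : ∀ N : ℕ, ‖g N - lam * g (N / q)‖ ≤ C * ((N : ℝ) + 1) ^ a) {y : ℝ} (hy : 0 ≤ y) (m : ℕ) :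
    ‖(lam ^ m)⁻¹ * g ⌊(q : ℝ) ^ m * y⌋₊ - scaleLimit q lam g y‖
      ≤ C / (1 - (q : ℝ) ^ (a - d)) * (y + 1) ^ a * ((q : ℝ) ^ (a - d)) ^ m := by
  have hr := rpow_sub_lt_one hq had
  have hr0 : 0 < (q : ℝ) ^ (a - d) := Real.rpow_pos_of_pos (by positivity) _
  rw [← dist_eq_norm]
  have := dist_le_of_le_geometric_of_tendsto ((q : ℝ) ^ (a - d)) (C * (y + 1) ^ a) hr
    (fun m => (dist_scaleSequence_le hq hlam ha hC hrec hy m).trans ?_)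
    (tendsto_scaleLimit hq hlam ha had hC hrec hy) m
  · refine this.trans (le_of_eq ?_)
    ring
  · rw [pow_succ]
    have : 0 ≤ (C * (y + 1) ^ a) * ((q : ℝ) ^ (a - d)) ^ m := by positivity
    rw [← mul_assoc]
    exact mul_le_of_le_one_right this hr.le

theorem scaleLimit_mul (hq : 2 ≤ q) (hlam : ‖lam‖ = (q : ℝ) ^ d) (ha : 0 ≤ a) (had : a < d)
    (hC : 0 ≤ C) (hrec : ∀ N : ℕ, ‖g N - lam * g (N / q)‖ ≤ C * ((N : ℝ) + 1) ^ a) {y : ℝ}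
    (hy : 0 ≤ y) : scaleLimit q lam g (q * y) = lam * scaleLimit q lam g y := by
  have hl0 : lam ≠ 0 := by rw [← norm_pos_iff, hlam]; positivity
  have h1 := tendsto_scaleLimit hq hlam ha had hC hrec (y := q * y) (by positivity)
  have h2 := ((tendsto_scaleLimit hq hlam ha had hC hrec hy).comp (tendsto_add_atTop_nat 1)).const_mul
    lam
  refine tendsto_nhds_unique h1 (h2.congr fun m => ?_)
  simp only [Function.comp]
  rw [pow_succ, pow_succ, mul_assoc ((q : ℝ) ^ m)]
  field_simp

theorem exists_norm_scaleLimit_le (hq : 2 ≤ q) (hlam : ‖lam‖ = (q : ℝ) ^ d) (ha : 0 ≤ a)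
    (had : a < d) (hC : 0 ≤ C) (hrec : ∀ N : ℕ, ‖g N - lam * g (N / q)‖ ≤ C * ((N : ℝ) + 1) ^ a)
    (hinc : ∀ N : ℕ, ‖g (N + 1) - g N‖ ≤ C * ((N : ℝ) + 1) ^ a) (Y : ℝ) :
    ∃ B : ℝ, 0 ≤ B ∧ ∀ y, 0 ≤ y → y ≤ Y → ‖scaleLimit q lam g y‖ ≤ B := by
  have hr := rpow_sub_lt_one hq had
  set D := C / (1 - (q : ℝ) ^ (a - d)) with hD
  have hD0 : 0 ≤ D := div_nonneg hC (by linarith)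
  refine ⟨‖g 0‖ + |Y| * (C * |Y| ^ a) + D * (|Y| + 1) ^ a, by positivity, fun y hy hyY => ?_⟩
  have h1 := norm_scaleSequence_sub_scaleLimit_le hq hlam ha had hC hrec hy 0
  simp only [pow_zero, inv_one, one_mul, mul_one] at h1
  have h2 := norm_sub_le_of_increment ha hC hinc 0 ⌊y⌋₊
  simp only [zero_add, Nat.cast_zero] at h2
  have hf : (⌊y⌋₊ : ℝ) ≤ |Y| := (Nat.floor_le hy).trans (hyY.trans (le_abs_self Y))
  have h3 : ‖g ⌊y⌋₊ - g 0‖ ≤ |Y| * (C * |Y| ^ a) := h2.trans (by gcongr)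
  have h4 : D * (y + 1) ^ a ≤ D * (|Y| + 1) ^ a := by
    gcongr
    exact hyY.trans (le_abs_self Y)
  have h5 : scaleLimit q lam g y = g 0 + (g ⌊y⌋₊ - g 0) - (g ⌊y⌋₊ - scaleLimit q lam g y) := by ring
  rw [h5]
  exact (norm_sub_le _ _).trans (add_le_add ((norm_add_le _ _).trans (add_le_add le_rfl h3))
    (h1.trans h4))

/-- Both limits are compared with their `m`-th approximants, where `m` is the scale at which the two
points become indistinguishable. -/
theorem exists_norm_scaleLimit_sub_le (hq : 2 ≤ q) (hlam : ‖lam‖ = (q : ℝ) ^ d) (ha : 0 ≤ a)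
    (had : a < d) (hC : 0 ≤ C) (hrec : ∀ N : ℕ, ‖g N - lam * g (N / q)‖ ≤ C * ((N : ℝ) + 1) ^ a)
    (hinc : ∀ N : ℕ, ‖g (N + 1) - g N‖ ≤ C * ((N : ℝ) + 1) ^ a) {Y : ℝ} (hY : 0 ≤ Y) :
    ∃ D : ℝ, 0 ≤ D ∧ ∀ y y', 0 ≤ y → y ≤ y' → y' ≤ Y →
      ‖scaleLimit q lam g y' - scaleLimit q lam g y‖ ≤ D * (y' - y) ^ ((d : ℝ) - a) := by
  have hq0 : (0 : ℝ) < q := by positivity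
  have hq1 : (1 : ℝ) < q := by exact_mod_cast hq
  have hr := rpow_sub_lt_one hq had
  set r := (q : ℝ) ^ (a - d) with hrdef
  have hr0 : 0 < r := Real.rpow_pos_of_pos hq0 _
  obtain ⟨B, hB0, hB⟩ := exists_norm_scaleLimit_le hq hlam ha had hC hrec hinc Y
  set D := C / (1 - r) with hD
  have hD0 : 0 ≤ D := div_nonneg hC (by linarith)
  have hα : 0 < (d : ℝ) - a := by linarith
  set D' := (2 * C + 2 * D) * (Y + 1) ^ a * (q : ℝ) ^ ((d : ℝ) - a) with hD'
  have hD'0 : 0 ≤ D' := by positivity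
  refine ⟨2 * B + D', by positivity, fun y y' hy hyy' hy' => ?_⟩
  rcases eq_or_lt_of_le hyy' with rfl | hlt
  · simp; positivity
  set δ := y' - y with hδ
  have hδ0 : 0 < δ := by linarith
  have hδα : 0 < δ ^ ((d : ℝ) - a) := Real.rpow_pos_of_pos hδ0 _
  rcases le_or_gt δ 1 with hδ1 | hδ1
  -- With `q^(-m-1) < δ ≤ q^(-m)` the two floors differ by at most 2, and `r^m` is at most a
  -- constant times `δ^(d-a)`.
  · obtain ⟨m, hm1, hm2⟩ := exists_nat_pow_near_of_lt_one hδ0 hδ1 (inv_pos.2 hq0)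
      (inv_lt_one_of_one_lt₀ hq1)
    have hY0 : 0 ≤ y' := hy.trans hyy'
    have e1 := norm_scaleSequence_sub_scaleLimit_le hq hlam ha had hC hrec hy m
    have e2 := norm_scaleSequence_sub_scaleLimit_le hq hlam ha had hC hrec hY0 m
    rw [← hrdef, ← hD] at e1 e2
    have hmono : ∀ z, 0 ≤ z → z ≤ Y → D * (z + 1) ^ a * r ^ m ≤ D * (Y + 1) ^ a * r ^ m := by
      intro z hz hzY
      gcongr
    set N := ⌊(q : ℝ) ^ m * y⌋₊ with hN
    set N' := ⌊(q : ℝ) ^ m * y'⌋₊ with hN'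
    have hNN' : N ≤ N' := Nat.floor_mono (by gcongr)
    have hqm : (q : ℝ) ^ m * δ ≤ 1 := by
      rw [inv_pow] at hm2
      calc (q : ℝ) ^ m * δ ≤ (q : ℝ) ^ m * ((q : ℝ) ^ m)⁻¹ := by gcongr
        _ = 1 := mul_inv_cancel₀ (by positivity)
    have hk : ((N' - N : ℕ) : ℝ) ≤ 2 := by
      rw [Nat.cast_sub hNN']
      have h1 : (N' : ℝ) ≤ (q : ℝ) ^ m * y' := Nat.floor_le (by positivity)
      have h2 : (q : ℝ) ^ m * y < N + 1 := Nat.lt_floor_add_one _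
      have h3 : (q : ℝ) ^ m * δ = (q : ℝ) ^ m * y' - (q : ℝ) ^ m * y := by rw [hδ]; ring
      linarith
    have hgN := norm_sub_le_of_increment ha hC hinc N (N' - N)
    rw [Nat.add_sub_cancel' hNN', show (N : ℝ) + ((N' - N : ℕ) : ℝ) = N' by
      rw [Nat.cast_sub hNN']; ring] at hgN
    have hN'Y : (N' : ℝ) ≤ (q : ℝ) ^ m * (Y + 1) := by
      refine (Nat.floor_le (by positivity)).trans ?_
      gcongr
      linarith
    have e3 : ‖(lam ^ m)⁻¹ * g N' - (lam ^ m)⁻¹ * g N‖ ≤ 2 * C * (Y + 1) ^ a * r ^ m := by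
      rw [← mul_sub, norm_mul, norm_inv, norm_pow, hlam]
      calc _ ≤ (((q : ℝ) ^ d) ^ m)⁻¹ * (2 * (C * ((q : ℝ) ^ m * (Y + 1)) ^ a)) := by
            gcongr
            exact hgN.trans (by gcongr)
        _ = 2 * C * ((((q : ℝ) ^ d) ^ m)⁻¹ * ((q : ℝ) ^ m * (Y + 1)) ^ a) := by ring
        _ = _ := by rw [pow_inv_mul_rpow_eq hq a (by positivity)]; ring
    have hrm : r ^ m ≤ (q : ℝ) ^ ((d : ℝ) - a) * δ ^ ((d : ℝ) - a) := by
      have h1 : r ^ m = ((q : ℝ)⁻¹ ^ m) ^ ((d : ℝ) - a) := by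
        rw [← Real.rpow_pow_comm (by positivity), Real.inv_rpow hq0.le, ← Real.rpow_neg hq0.le, hrdef]
        congr 2; ring
      rw [h1, ← Real.mul_rpow hq0.le hδ0.le]
      refine Real.rpow_le_rpow (by positivity) ?_ hα.le
      have : (q : ℝ)⁻¹ ^ m = q * (q : ℝ)⁻¹ ^ (m + 1) := by
        rw [pow_succ]; field_simp
      rw [this]
      gcongr
    have e4 : scaleLimit q lam g y' - scaleLimit q lam g y
        = ((lam ^ m)⁻¹ * g N' - (lam ^ m)⁻¹ * g N)
          - ((lam ^ m)⁻¹ * g N' - scaleLimit q lam g y')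
          + ((lam ^ m)⁻¹ * g N - scaleLimit q lam g y) := by ring
    rw [e4]
    refine (norm_add_le _ _).trans ((add_le_add (norm_sub_le _ _) le_rfl).trans ?_)
    calc _ ≤ 2 * C * (Y + 1) ^ a * r ^ m + D * (Y + 1) ^ a * r ^ m + D * (Y + 1) ^ a * r ^ m :=
          add_le_add (add_le_add e3 (e2.trans (hmono _ hY0 hy')))
            (e1.trans (hmono _ hy (hyy'.trans hy')))
      _ = ((2 * C + 2 * D) * (Y + 1) ^ a) * r ^ m := by ring
      _ ≤ ((2 * C + 2 * D) * (Y + 1) ^ a) *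
          ((q : ℝ) ^ ((d : ℝ) - a) * δ ^ ((d : ℝ) - a)) := by gcongr
      _ = D' * δ ^ ((d : ℝ) - a) := by rw [hD']; ring
      _ ≤ _ := by gcongr; linarith
  · have h1 : 1 ≤ δ ^ ((d : ℝ) - a) := Real.one_le_rpow hδ1.le hα.le
    calc _ ≤ ‖scaleLimit q lam g y'‖ + ‖scaleLimit q lam g y‖ := norm_sub_le _ _
      _ ≤ B + B := add_le_add (hB _ (hy.trans hyy') hy') (hB _ hy (hyy'.trans hy'))
      _ = 2 * B * 1 := by ring
      _ ≤ (2 * B + D') * δ ^ ((d : ℝ) - a) := by gcongr; linarith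

/-- The fluctuation attached to a sequence with `g(N) ≈ λ g(⌊N/q⌋)`. -/
noncomputable def scaleFluctuation (q d : ℕ) (lam : ℂ) (g : ℕ → ℂ) (x : ℝ) : ℂ :=
  scaleLimit q lam g ((q : ℝ) ^ x) / (((q : ℝ) ^ x : ℝ) : ℂ) ^ d

theorem scaleFluctuation_add_one (hq : 2 ≤ q) (hlam : ‖lam‖ = (q : ℝ) ^ d) (ha : 0 ≤ a)
    (had : a < d) (hC : 0 ≤ C) (hrec : ∀ N : ℕ, ‖g N - lam * g (N / q)‖ ≤ C * ((N : ℝ) + 1) ^ a)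
    (x : ℝ) : scaleFluctuation q d lam g (x + 1)
      = lam / (q : ℂ) ^ d * scaleFluctuation q d lam g x := by
  have hq0 : (0 : ℝ) < q := by positivity
  rw [scaleFluctuation, scaleFluctuation, Real.rpow_add_one hq0.ne', mul_comm,
    scaleLimit_mul hq hlam ha had hC hrec (by positivity)]
  push_cast
  rw [mul_pow, mul_div_mul_comm]

theorem norm_scaleLimit_log_sub_le (hq : 2 ≤ q) (hlam : ‖lam‖ = (q : ℝ) ^ d) (ha : 0 ≤ a)
    (had : a < d) (hC : 0 ≤ C) (hrec : ∀ N : ℕ, ‖g N - lam * g (N / q)‖ ≤ C * ((N : ℝ) + 1) ^ a)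
    {y : ℝ} (hy : 1 ≤ y) :
    ‖g ⌊y⌋₊ - (y : ℂ) ^ d * scaleFluctuation q d lam g (Real.logb q y)‖
      ≤ C / (1 - (q : ℝ) ^ (a - d)) * 2 ^ a * y ^ a := by
  have hq0 : (0 : ℝ) < q := by positivity
  have hq1 : (1 : ℝ) < q := by exact_mod_cast hq
  have hy0 : 0 < y := by linarith
  have hr := rpow_sub_lt_one hq had
  have hD0 : 0 ≤ C / (1 - (q : ℝ) ^ (a - d)) := div_nonneg hC (by linarith)
  have hyC : (y : ℂ) ≠ 0 := by exact_mod_cast hy0.ne'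
  rw [scaleFluctuation, Real.rpow_logb hq0 hq1.ne' hy0, mul_div_cancel₀ _ (pow_ne_zero d hyC)]
  have h1 := norm_scaleSequence_sub_scaleLimit_le hq hlam ha had hC hrec hy0.le 0
  simp only [pow_zero, inv_one, one_mul, mul_one] at h1
  refine h1.trans ?_
  rw [mul_assoc, ← Real.mul_rpow (by norm_num) hy0.le]
  gcongr
  linarith

theorem Real.exp_sub_exp_le (x y : ℝ) : Real.exp y - Real.exp x ≤ Real.exp y * (y - x) := by
  have h := Real.add_one_le_exp (x - y)
  have h2 : Real.exp x = Real.exp y * Real.exp (x - y) := by rw [← Real.exp_add]; congr 1; ring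
  rw [h2]
  nlinarith [Real.exp_pos y]

/-- On `[0, 2]` the numerator is Hölder and the reciprocal of the denominator is Lipschitz. The
factor under `x ↦ x + 1` has modulus 1, so norms of differences at a fixed distance are 1-periodic,
which extends the bound to close points anywhere; distant points are covered by boundedness. -/
theorem exists_norm_scaleFluctuation_sub_le (hq : 2 ≤ q) (hlam : ‖lam‖ = (q : ℝ) ^ d) (ha : 0 ≤ a)
    (had : a < d) (had' : (d : ℝ) - 1 ≤ a) (hC : 0 ≤ C)
    (hrec : ∀ N : ℕ, ‖g N - lam * g (N / q)‖ ≤ C * ((N : ℝ) + 1) ^ a)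
    (hinc : ∀ N : ℕ, ‖g (N + 1) - g N‖ ≤ C * ((N : ℝ) + 1) ^ a) :
    ∃ D : ℝ, 0 ≤ D ∧ ∀ x y, ‖scaleFluctuation q d lam g x - scaleFluctuation q d lam g y‖
      ≤ D * |x - y| ^ ((d : ℝ) - a) := by
  have hq0 : (0 : ℝ) < q := by positivity
  have hq1 : (1 : ℝ) < q := by exact_mod_cast hq
  have hlq : 0 < Real.log q := Real.log_pos hq1
  set Φ := scaleFluctuation q d lam g with hΦ
  set α := (d : ℝ) - a with hα
  have hα0 : 0 < α := by rw [hα]; linarith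
  have hα1 : α ≤ 1 := by rw [hα]; linarith
  have hstep := scaleFluctuation_add_one (g := g) hq hlam ha had hC hrec
  have hω : ‖lam / (q : ℂ) ^ d‖ = 1 := by
    rw [norm_div, hlam, norm_pow, Complex.norm_natCast, div_self (by positivity)]
  obtain ⟨B, hB0, hB⟩ := exists_norm_scaleLimit_le hq hlam ha had hC hrec hinc ((q : ℝ) ^ (2 : ℝ))
  obtain ⟨D, hD0, hD⟩ := exists_norm_scaleLimit_sub_le hq hlam ha had hC hrec hinc
    (Y := (q : ℝ) ^ (2 : ℝ)) (by positivity)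
  have hpow1 : ∀ x : ℝ, 0 ≤ x → 1 ≤ ((q : ℝ) ^ x) ^ d := fun x hx =>
    one_le_pow₀ (Real.one_le_rpow hq1.le hx)
  have hnormpow : ∀ x : ℝ, ‖(((q : ℝ) ^ x : ℝ) : ℂ) ^ d‖ = ((q : ℝ) ^ x) ^ d := fun x => by
    rw [norm_pow, Complex.norm_real, Real.norm_of_nonneg (by positivity)]
  have hsup : ∀ x, ‖Φ x‖ ≤ B := by
    have hper : Function.Periodic (fun x => ‖Φ x‖) 1 := fun x => by
      simp only [hΦ, hstep x, norm_mul, hω, one_mul]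
    intro x
    have h1 := hper.sub_int_mul_eq (x := x) ⌊x⌋
    simp only [mul_one] at h1
    rw [← h1]
    have hx0 : 0 ≤ x - ⌊x⌋ := sub_nonneg.2 (Int.floor_le x)
    have hx1 : x - ⌊x⌋ ≤ 2 := by linarith [Int.lt_floor_add_one x]
    rw [hΦ, scaleFluctuation, norm_div, hnormpow]
    refine (div_le_self (norm_nonneg _) (hpow1 _ hx0)).trans (hB _ (by positivity) ?_)
    exact Real.rpow_le_rpow_of_exponent_le hq1.le hx1
  set L := D * ((q : ℝ) ^ (2 : ℝ) * Real.log q) ^ α + B * (d * Real.log q) with hL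
  have hL0 : 0 ≤ L := by positivity
  have hlocal : ∀ x y, 0 ≤ x → x ≤ y → y ≤ x + 1 → y ≤ 2 → ‖Φ y - Φ x‖ ≤ L * (y - x) ^ α := by
    intro x y hx hxy hy1 hy
    have hX : 0 < (q : ℝ) ^ x := Real.rpow_pos_of_pos hq0 x
    have hYp : 0 < (q : ℝ) ^ y := Real.rpow_pos_of_pos hq0 y
    have hXY : (q : ℝ) ^ x ≤ (q : ℝ) ^ y := Real.rpow_le_rpow_of_exponent_le hq1.le hxy
    have hY2 : (q : ℝ) ^ y ≤ (q : ℝ) ^ (2 : ℝ) := Real.rpow_le_rpow_of_exponent_le hq1.le hy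
    have h1 := hD _ _ hX.le hXY hY2
    have hdiff : (q : ℝ) ^ y - (q : ℝ) ^ x ≤ (q : ℝ) ^ (2 : ℝ) * Real.log q * (y - x) := by
      have := Real.exp_sub_exp_le (Real.log q * x) (Real.log q * y)
      rw [← Real.rpow_def_of_pos hq0, ← Real.rpow_def_of_pos hq0] at this
      calc _ ≤ (q : ℝ) ^ y * (Real.log q * y - Real.log q * x) := this
        _ = (q : ℝ) ^ y * (Real.log q * (y - x)) := by ring
        _ ≤ (q : ℝ) ^ (2 : ℝ) * (Real.log q * (y - x)) :=
          mul_le_mul_of_nonneg_right hY2 (mul_nonneg hlq.le (sub_nonneg.2 hxy))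
        _ = _ := by ring
    have h2 : ‖scaleLimit q lam g ((q : ℝ) ^ y) - scaleLimit q lam g ((q : ℝ) ^ x)‖
        ≤ D * ((q : ℝ) ^ (2 : ℝ) * Real.log q) ^ α * (y - x) ^ α := by
      refine h1.trans ?_
      rw [mul_assoc, ← Real.mul_rpow (by positivity) (by linarith)]
      gcongr
    have hinv : ((((q : ℝ) ^ x) ^ d)⁻¹ - (((q : ℝ) ^ y) ^ d)⁻¹) ≤ d * Real.log q * (y - x) := by
      have hpe : ∀ z : ℝ, (((q : ℝ) ^ z) ^ d)⁻¹ = Real.exp (-(d * Real.log q * z)) := by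
        intro z
        rw [Real.rpow_def_of_pos hq0, ← Real.exp_nat_mul, ← Real.exp_neg]
        congr 1; ring
      rw [hpe, hpe]
      refine (Real.exp_sub_exp_le _ _).trans ?_
      have : Real.exp (-(d * Real.log q * x)) ≤ 1 := by
        rw [Real.exp_le_one_iff]
        have : 0 ≤ d * Real.log q * x := by positivity
        linarith
      calc _ = Real.exp (-(d * Real.log q * x)) * (d * Real.log q * (y - x)) := by ring
        _ ≤ 1 * (d * Real.log q * (y - x)) := mul_le_mul_of_nonneg_right this
            (mul_nonneg (by positivity) (sub_nonneg.2 hxy))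
        _ = _ := one_mul _
    have hinv0 : 0 ≤ ((((q : ℝ) ^ x) ^ d)⁻¹ - (((q : ℝ) ^ y) ^ d)⁻¹) := by
      rw [sub_nonneg]
      exact inv_anti₀ (by positivity) (pow_le_pow_left₀ hX.le hXY d)
    have hyx : y - x ≤ (y - x) ^ α := by
      rcases eq_or_lt_of_le hxy with rfl | hlt
      · simp [Real.zero_rpow hα0.ne']
      · calc y - x = (y - x) ^ (1 : ℝ) := (Real.rpow_one _).symm
          _ ≤ (y - x) ^ α :=
            Real.rpow_le_rpow_of_exponent_ge (by linarith) (by linarith) hα1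
    have hsplit : Φ y - Φ x = (scaleLimit q lam g ((q : ℝ) ^ y) - scaleLimit q lam g ((q : ℝ) ^ x))
          / (((q : ℝ) ^ y : ℝ) : ℂ) ^ d
        - scaleLimit q lam g ((q : ℝ) ^ x)
          * (((((q : ℝ) ^ x) ^ d)⁻¹ - (((q : ℝ) ^ y) ^ d)⁻¹ : ℝ) : ℂ) := by
      rw [hΦ, scaleFluctuation, scaleFluctuation]
      push_cast
      ring
    rw [hsplit]
    refine (norm_sub_le _ _).trans ?_
    rw [norm_div, hnormpow, norm_mul, Complex.norm_real, Real.norm_of_nonneg hinv0, hL, add_mul]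
    refine add_le_add ((div_le_self (norm_nonneg _) (hpow1 _ (hx.trans hxy))).trans h2) ?_
    have hBx := hB _ hX.le (hXY.trans hY2)
    calc _ ≤ B * (d * Real.log q * (y - x)) := mul_le_mul hBx hinv hinv0 hB0
      _ ≤ B * (d * Real.log q * (y - x) ^ α) := by gcongr
      _ = _ := by ring
  have hordered : ∀ x y, x ≤ y → ‖Φ y - Φ x‖ ≤ (L + 2 * B) * (y - x) ^ α := by
    intro x y hxy
    rcases le_or_gt (y - x) 1 with h1 | h1
    · have hper : Function.Periodic (fun z => ‖Φ (z + (y - x)) - Φ z‖) 1 := fun z => by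
        simp only
        rw [show z + 1 + (y - x) = z + (y - x) + 1 by ring, hΦ, hstep, hstep, ← mul_sub, norm_mul,
          hω, one_mul]
      have h2 := hper.sub_int_mul_eq (x := x) ⌊x⌋
      simp only [mul_one, add_sub_cancel] at h2
      rw [← h2]
      have hx0 : 0 ≤ x - ⌊x⌋ := sub_nonneg.2 (Int.floor_le x)
      have hx1 : x - ⌊x⌋ ≤ 1 := by linarith [Int.lt_floor_add_one x]
      have h3 := hlocal (x - ⌊x⌋) (x - ⌊x⌋ + (y - x)) hx0 (by linarith) (by linarith) (by linarith)
      rw [add_sub_cancel_left] at h3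
      refine h3.trans ?_
      have : 0 ≤ (y - x) ^ α := Real.rpow_nonneg (by linarith) _
      gcongr
      linarith
    · have h2 : 1 ≤ (y - x) ^ α := Real.one_le_rpow h1.le hα0.le
      calc _ ≤ ‖Φ y‖ + ‖Φ x‖ := norm_sub_le _ _
        _ ≤ B + B := add_le_add (hsup _) (hsup _)
        _ = 2 * B * 1 := by ring
        _ ≤ (L + 2 * B) * (y - x) ^ α := by gcongr; linarith
  refine ⟨L + 2 * B, by positivity, fun x y => ?_⟩
  rcases le_total x y with h | h
  · rw [norm_sub_rev, abs_sub_comm, abs_of_nonneg (sub_nonneg.2 h)]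
    exact hordered x y h
  · rw [abs_of_nonneg (sub_nonneg.2 h)]
    exact hordered y x h

end ScaleLimit

/-! ### Principal parts and pole orders. -/

section PrincipalPart

/-- Near `z₀`, the function `f` is the sum of `a / (z - z₀)`, `b / (z - z₀) ^ 2` and an analytic
function. -/
def HasPrincipalPart (f : ℂ → ℂ) (z₀ a b : ℂ) : Prop :=
  ∃ g : ℂ → ℂ, AnalyticAt ℂ g z₀ ∧
    ∀ᶠ z in 𝓝[≠] z₀, f z = a / (z - z₀) + b / (z - z₀) ^ 2 + g z

variable {f f₁ f₂ : ℂ → ℂ} {z₀ a b a₁ b₁ a₂ b₂ : ℂ}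

theorem AnalyticAt.hasPrincipalPart (hf : AnalyticAt ℂ f z₀) : HasPrincipalPart f z₀ 0 0 :=
  ⟨f, hf, by simp⟩

theorem HasPrincipalPart.add (h₁ : HasPrincipalPart f₁ z₀ a₁ b₁)
    (h₂ : HasPrincipalPart f₂ z₀ a₂ b₂) :
    HasPrincipalPart (fun z => f₁ z + f₂ z) z₀ (a₁ + a₂) (b₁ + b₂) := by
  obtain ⟨g₁, hg₁, e₁⟩ := h₁
  obtain ⟨g₂, hg₂, e₂⟩ := h₂
  refine ⟨fun z => g₁ z + g₂ z, hg₁.add hg₂, ?_⟩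
  filter_upwards [e₁, e₂] with z h h'
  rw [h, h']
  ring

/-- The analytic part is the divided difference `dslope f z₀`. -/
theorem AnalyticAt.hasPrincipalPart_div_sub (hf : AnalyticAt ℂ f z₀) :
    HasPrincipalPart (fun z => f z / (z - z₀)) z₀ (f z₀) 0 := by
  obtain ⟨p, hp⟩ := hf
  refine ⟨dslope f z₀, ⟨_, hp.has_fpower_series_dslope_fslope⟩, ?_⟩
  filter_upwards [self_mem_nhdsWithin] with z hz
  have hz' : z - z₀ ≠ 0 := sub_ne_zero.2 hz
  rw [dslope_of_ne _ hz, slope_def_field]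
  field_simp
  ring

theorem HasPrincipalPart.congr (h : HasPrincipalPart f₁ z₀ a b) (he : f₂ =ᶠ[𝓝[≠] z₀] f₁) :
    HasPrincipalPart f₂ z₀ a b := by
  obtain ⟨g, hg, e⟩ := h
  exact ⟨g, hg, (he.and e).mono fun z hz => hz.1.trans hz.2⟩

/-- A quotient with a simple zero in the denominator. -/
theorem hasPrincipalPart_div (h₁ : AnalyticAt ℂ f₁ z₀) (h₂ : AnalyticAt ℂ f₂ z₀)
    (h0 : f₂ z₀ = 0) (h' : HasDerivAt f₂ a z₀) (ha : a ≠ 0) :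
    HasPrincipalPart (fun z => f₁ z / f₂ z) z₀ (f₁ z₀ / a) 0 := by
  obtain ⟨p, hp⟩ := h₂
  have hs : AnalyticAt ℂ (dslope f₂ z₀) z₀ := ⟨_, hp.has_fpower_series_dslope_fslope⟩
  have hs0 : dslope f₂ z₀ z₀ = a := by rw [dslope_same, h'.deriv]
  have hq := (h₁.div hs (by rwa [hs0])).hasPrincipalPart_div_sub
  simp only [Pi.div_apply, hs0] at hq
  refine hq.congr ?_
  filter_upwards [self_mem_nhdsWithin] with z hz
  rw [dslope_of_ne _ hz, slope_def_field, h0, sub_zero, div_div,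
    div_mul_cancel₀ _ (sub_ne_zero.2 hz)]

theorem HasPrincipalPart.hasResidueAt (h : HasPrincipalPart f z₀ a b) : HasResidueAt f z₀ a := by
  obtain ⟨g, hg, e⟩ := h
  refine ⟨1, fun j => if j = 0 then a else b, g, by simp, hg, e.mono fun z hz => ?_⟩
  simp [Finset.sum_range_succ, hz]

theorem meromorphicOrderAt_ge_of_eventuallyEq {g : ℂ → ℂ} {n : ℤ} (hg : AnalyticAt ℂ g z₀)
    (h : ∀ᶠ z in 𝓝[≠] z₀, f z = (z - z₀) ^ n * g z) :
    MeromorphicAt f z₀ ∧ (n : WithTop ℤ) ≤ meromorphicOrderAt f z₀ := by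
  have hm : MeromorphicAt (fun z : ℂ => z - z₀) z₀ := by fun_prop
  have h1 : MeromorphicAt ((fun z : ℂ => z - z₀) ^ n) z₀ := hm.zpow n
  have he : f =ᶠ[𝓝[≠] z₀] ((fun z : ℂ => z - z₀) ^ n) * g := h
  refine ⟨(h1.mul hg.meromorphicAt).congr he.symm, ?_⟩
  rw [meromorphicOrderAt_congr he, meromorphicOrderAt_mul h1 hg.meromorphicAt,
    meromorphicOrderAt_zpow hm, meromorphicOrderAt_id_sub_const, mul_one]
  exact le_add_of_nonneg_right hg.meromorphicOrderAt_nonneg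

theorem HasPrincipalPart.neg_two_le_order (h : HasPrincipalPart f z₀ a b) :
    MeromorphicAt f z₀ ∧ ((-2 : ℤ) : WithTop ℤ) ≤ meromorphicOrderAt f z₀ := by
  obtain ⟨g, hg, e⟩ := h
  refine meromorphicOrderAt_ge_of_eventuallyEq
    (g := fun z => a * (z - z₀) + b + (z - z₀) ^ 2 * g z) (by fun_prop) ?_
  filter_upwards [e, self_mem_nhdsWithin] with z hz hne
  have hz' : z - z₀ ≠ 0 := sub_ne_zero.2 hne
  rw [hz, zpow_neg]
  norm_cast
  field_simp

theorem HasPrincipalPart.neg_one_le_order (h : HasPrincipalPart f z₀ a 0) :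
    ((-1 : ℤ) : WithTop ℤ) ≤ meromorphicOrderAt f z₀ := by
  obtain ⟨g, hg, e⟩ := h
  refine (meromorphicOrderAt_ge_of_eventuallyEq
    (g := fun z => a + (z - z₀) * g z) (by fun_prop) ?_).2
  filter_upwards [e, self_mem_nhdsWithin] with z hz hne
  have hz' : z - z₀ ≠ 0 := sub_ne_zero.2 hne
  rw [hz, zpow_neg]
  norm_cast
  field_simp
  ring

end PrincipalPart

/-! ### Mellin transforms of functions cut off below 1. -/

section TailMellin

open MeasureTheory Set

variable {f : ℝ → ℂ} {C a : ℝ} {s : ℂ}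

theorem locallyIntegrableOn_indicator_Ioi_one (hm : Measurable f)
    (hf : ∀ y, 1 < y → ‖f y‖ ≤ C * y ^ a) :
    LocallyIntegrableOn ((Ioi (1 : ℝ)).indicator f) (Ioi 0) := by
  have h : LocallyIntegrableOn (fun y : ℝ => C * y ^ a) (Ioi 0) := by
    refine ContinuousOn.locallyIntegrableOn (fun y hy => ?_) measurableSet_Ioi
    exact (continuousAt_const.mul
      (Real.continuousAt_rpow_const y a (Or.inl (ne_of_gt hy)))).continuousWithinAt
  refine h.mono (hm.indicator measurableSet_Ioi).aestronglyMeasurable (ae_of_all _ fun y => ?_)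
  by_cases hy : 1 < y
  · rw [indicator_of_mem (mem_Ioi.2 hy)]
    exact (hf y hy).trans (le_abs_self _)
  · rw [indicator_of_notMem (by simpa using hy), norm_zero]
    exact norm_nonneg _

theorem isBigO_atTop_indicator_Ioi_one (hf : ∀ y, 1 < y → ‖f y‖ ≤ C * y ^ a) :
    (Ioi (1 : ℝ)).indicator f =O[atTop] fun y : ℝ => y ^ (-(-a)) := by
  refine IsBigO.of_bound C ?_
  filter_upwards [eventually_gt_atTop 1] with y hy
  rw [indicator_of_mem (mem_Ioi.2 hy), neg_neg,
    Real.norm_of_nonneg (Real.rpow_nonneg (by linarith) _)]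
  exact hf y hy

/-- The cutoff removes any condition at 0, so only growth at infinity limits the half-plane of
convergence. -/
theorem isBigO_zero_indicator_Ioi_one (f : ℝ → ℂ) (b : ℝ) :
    (Ioi (1 : ℝ)).indicator f =O[𝓝[>] 0] fun y : ℝ => y ^ (-b) := by
  refine IsBigO.of_bound 0 ?_
  filter_upwards [Ioo_mem_nhdsGT (zero_lt_one' ℝ)] with y hy
  rw [indicator_of_notMem (by simpa using hy.2.le)]
  simp

theorem mellinConvergent_indicator_Ioi_one (hm : Measurable f)
    (hf : ∀ y, 1 < y → ‖f y‖ ≤ C * y ^ a) (hs : s.re < -a) :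
    MellinConvergent ((Ioi (1 : ℝ)).indicator f) s :=
  mellinConvergent_of_isBigO_rpow (locallyIntegrableOn_indicator_Ioi_one hm hf)
    (isBigO_atTop_indicator_Ioi_one hf) hs (isBigO_zero_indicator_Ioi_one f _)
    (sub_one_lt s.re)

theorem differentiableAt_mellin_indicator_Ioi_one (hm : Measurable f)
    (hf : ∀ y, 1 < y → ‖f y‖ ≤ C * y ^ a) (hs : s.re < -a) :
    DifferentiableAt ℂ (mellin ((Ioi (1 : ℝ)).indicator f)) s :=
  mellin_differentiableAt_of_isBigO_rpow (locallyIntegrableOn_indicator_Ioi_one hm hf)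
    (isBigO_atTop_indicator_Ioi_one hf) hs (isBigO_zero_indicator_Ioi_one f _)
    (sub_one_lt s.re)

theorem mellin_indicator_Ioi_one (f : ℝ → ℂ) (s : ℂ) :
    mellin ((Ioi (1 : ℝ)).indicator f) s = ∫ y in Ioi (1 : ℝ), (y : ℂ) ^ (s - 1) * f y := by
  have h : ∀ y : ℝ, (y : ℂ) ^ (s - 1) • (Ioi (1 : ℝ)).indicator f y
      = (Ioi (1 : ℝ)).indicator (fun y : ℝ => (y : ℂ) ^ (s - 1) * f y) y := fun y => by
    by_cases hy : 1 < y <;> simp [indicator, hy]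
  simp only [mellin, h]
  rw [setIntegral_indicator measurableSet_Ioi,
    inter_eq_self_of_subset_right (Ioi_subset_Ioi zero_le_one)]

variable {d : ℕ}

theorem cpow_sub_one_mul_pow {y : ℝ} (hy : 0 < y) (s : ℂ) (d : ℕ) :
    (y : ℂ) ^ (s - 1) * (y : ℂ) ^ d = (y : ℂ) ^ (s + d - 1) := by
  rw [← Complex.cpow_natCast, ← Complex.cpow_add _ _ (by exact_mod_cast hy.ne')]
  ring_nf

theorem mellin_indicator_pow (hs : s.re < -d) :
    mellin ((Ioi (1 : ℝ)).indicator fun y : ℝ => (y : ℂ) ^ d) s = -(1 / (s + d)) := by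
  rw [mellin_indicator_Ioi_one, setIntegral_congr_fun (g := fun y : ℝ => (y : ℂ) ^ (s + d - 1))
    measurableSet_Ioi (fun y hy => cpow_sub_one_mul_pow (zero_lt_one.trans hy) s d),
    integral_Ioi_cpow_of_lt (by simp; linarith) one_pos]
  simp [neg_div]

theorem norm_pow_le_rpow (d : ℕ) (y : ℝ) (hy : 1 < y) : ‖(y : ℂ) ^ d‖ ≤ 1 * y ^ (d : ℝ) := by
  rw [norm_pow, Complex.norm_real, Real.norm_of_nonneg (by linarith), one_mul, Real.rpow_natCast]

/-- A factor `log y` corresponds to differentiation in `s`, applied to `-1 / (s + d)`. -/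
theorem mellin_indicator_pow_mul_log (hs : s.re < -d) :
    MellinConvergent ((Ioi (1 : ℝ)).indicator fun y : ℝ => (Real.log y : ℂ) * (y : ℂ) ^ d) s ∧
    mellin ((Ioi (1 : ℝ)).indicator fun y : ℝ => (Real.log y : ℂ) * (y : ℂ) ^ d) s
      = 1 / (s + d) ^ 2 := by
  have hm : Measurable fun y : ℝ => (y : ℂ) ^ d := by fun_prop
  have hf := norm_pow_le_rpow d
  obtain ⟨h1, h2⟩ := mellin_hasDerivAt_of_isBigO_rpow
    (locallyIntegrableOn_indicator_Ioi_one hm hf) (isBigO_atTop_indicator_Ioi_one hf) hs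
    (isBigO_zero_indicator_Ioi_one _ _) (sub_one_lt s.re)
  have hE : (fun y : ℝ => Real.log y • (Ioi (1 : ℝ)).indicator (fun y : ℝ => (y : ℂ) ^ d) y)
      = (Ioi (1 : ℝ)).indicator fun y : ℝ => (Real.log y : ℂ) * (y : ℂ) ^ d := by
    funext y
    by_cases hy : 1 < y <;> simp [indicator, hy]
  rw [hE] at h1 h2
  refine ⟨h1, h2.unique ?_⟩
  have hne : s + d ≠ 0 := fun h => by
    have := congrArg Complex.re h
    simp at this
    linarith
  have h3 : HasDerivAt (fun s : ℂ => -(1 / (s + d))) (1 / (s + d) ^ 2) s := by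
    have := ((hasDerivAt_id s).add_const (d : ℂ)).inv hne
    exact (this.neg.congr_deriv (by simp [neg_div])).congr_of_eventuallyEq
      (Eventually.of_forall fun w => by simp)
  refine h3.congr_of_eventuallyEq ?_
  have : ∀ᶠ w in 𝓝 s, w.re < -(d : ℝ) :=
    (Complex.continuous_re.tendsto s).eventually (gt_mem_nhds hs)
  filter_upwards [this] with w hw
  exact mellin_indicator_pow hw

end TailMellin

/-! ### Meromorphic continuation for quasi-periodic main terms. -/

section Continuation

open MeasureTheory Set

variable {q d : ℕ} {ω : ℂ} {Φ : ℝ → ℂ}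

theorem exists_norm_le_of_quasiPeriodic (hω : ‖ω‖ = 1) (hΦ : Continuous Φ)
    (hper : ∀ x, Φ (x + 1) = ω * Φ x) : ∃ B, 0 ≤ B ∧ ∀ x, ‖Φ x‖ ≤ B := by
  have hp : Function.Periodic (fun x => ‖Φ x‖) 1 := fun x => by
    simp only [hper, norm_mul, hω, one_mul]
  obtain ⟨B, hB⟩ := (isCompact_Icc (a := (0 : ℝ)) (b := 1)).exists_bound_of_continuousOn
    hΦ.continuousOn
  have hB' : ∀ x, ‖Φ x‖ ≤ B := fun x => by
    obtain ⟨y, hy, hxy⟩ := hp.exists_mem_Ico₀ one_pos x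
    rw [show ‖Φ x‖ = ‖Φ y‖ from hxy]
    exact hB y ⟨hy.1, hy.2.le⟩
  exact ⟨B, (norm_nonneg _).trans (hB' 0), hB'⟩

/-- The multiplicative form `y ↦ y ^ d Φ(log_q y)` of a fluctuation. -/
noncomputable def fluctuationTerm (q d : ℕ) (Φ : ℝ → ℂ) (y : ℝ) : ℂ :=
  (y : ℂ) ^ d * Φ (Real.logb q y)

theorem measurable_fluctuationTerm (hΦ : Continuous Φ) : Measurable (fluctuationTerm q d Φ) := by
  have h1 : Measurable fun y : ℝ => Φ (Real.logb q y) := by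
    refine hΦ.measurable.comp ?_
    unfold Real.logb
    exact Real.measurable_log.div_const _
  have h2 : Measurable fun y : ℝ => (y : ℂ) ^ d := by fun_prop
  exact h2.mul h1

theorem norm_fluctuationTerm_le {B : ℝ} (hB : ∀ x, ‖Φ x‖ ≤ B) (y : ℝ) (hy : 1 < y) :
    ‖fluctuationTerm q d Φ y‖ ≤ B * y ^ (d : ℝ) := by
  have h1 := norm_pow_le_rpow d y hy
  rw [fluctuationTerm, norm_mul, mul_comm]
  rw [one_mul] at h1
  exact mul_le_mul (hB _) h1 (norm_nonneg _) ((norm_nonneg _).trans (hB 0))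

theorem fluctuationTerm_mul (hq : 2 ≤ q) (hper : ∀ x, Φ (x + 1) = ω * Φ x) {y : ℝ} (hy : 0 < y) :
    fluctuationTerm q d Φ (q * y) = ω * (q : ℂ) ^ d * fluctuationTerm q d Φ y := by
  have hq0 : (0 : ℝ) < q := by positivity
  have hq1 : (1 : ℝ) < q := by exact_mod_cast hq
  rw [fluctuationTerm, Real.logb_mul hq0.ne' hy.ne', Real.logb_self_eq_one hq1, add_comm, hper,
    fluctuationTerm]
  push_cast
  ring

/-- The Mellin transform of the fluctuation over one period. -/
noncomputable def fluctuationMellin (q d : ℕ) (Φ : ℝ → ℂ) (s : ℂ) : ℂ :=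
  ∫ y in Ioc (1 : ℝ) q, (y : ℂ) ^ (s - 1) * fluctuationTerm q d Φ y

theorem mellin_indicator_indicator_Iic (f : ℝ → ℂ) (s : ℂ) :
    mellin ((Ioi (1 : ℝ)).indicator ((Iic (q : ℝ)).indicator f)) s
      = ∫ y in Ioc (1 : ℝ) q, (y : ℂ) ^ (s - 1) * f y := by
  have h : ∀ y : ℝ, (y : ℂ) ^ (s - 1) * (Iic (q : ℝ)).indicator f y
      = (Iic (q : ℝ)).indicator (fun y : ℝ => (y : ℂ) ^ (s - 1) * f y) y := fun y => by
    by_cases hy : y ≤ q <;> simp [indicator, hy]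
  simp only [mellin_indicator_Ioi_one, h]
  rw [setIntegral_indicator measurableSet_Iic, Ioi_inter_Iic]

/-- On the bounded range `(1, q]` a growth bound with any exponent holds, so the transform is
entire. -/
theorem differentiable_fluctuationMellin (hq : 2 ≤ q) (hω : ‖ω‖ = 1) (hΦ : Continuous Φ)
    (hper : ∀ x, Φ (x + 1) = ω * Φ x) : Differentiable ℂ (fluctuationMellin q d Φ) := by
  intro s
  obtain ⟨B, hB0, hB⟩ := exists_norm_le_of_quasiPeriodic hω hΦ hper
  have h : fluctuationMellin q d Φ
      = mellin ((Ioi (1 : ℝ)).indicator ((Iic (q : ℝ)).indicator (fluctuationTerm q d Φ))) :=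
    funext fun s => (mellin_indicator_indicator_Iic _ s).symm
  have hq0 : (0 : ℝ) < q := by positivity
  have hq1 : (1 : ℝ) ≤ q := by exact_mod_cast (by lia : 1 ≤ q)
  rw [h]
  refine differentiableAt_mellin_indicator_Ioi_one (a := -s.re - 1)
    (C := B * (q : ℝ) ^ (d : ℝ) * (q : ℝ) ^ (|s.re + 1|))
    ((measurable_fluctuationTerm hΦ).indicator measurableSet_Iic) (fun y hy => ?_) (by linarith)
  have hy0 : 0 < y := by linarith
  by_cases hyq : y ≤ q
  · rw [indicator_of_mem (mem_Iic.2 hyq)]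
    refine (norm_fluctuationTerm_le hB y hy).trans ?_
    have h1 : y ^ (d : ℝ) ≤ (q : ℝ) ^ (d : ℝ) := Real.rpow_le_rpow hy0.le hyq (by positivity)
    have h2 : 1 ≤ (q : ℝ) ^ (|s.re + 1|) * y ^ (-s.re - 1) := by
      rw [show -s.re - 1 = -(s.re + 1) by ring, Real.rpow_neg hy0.le, ← div_eq_mul_inv,
        one_le_div (Real.rpow_pos_of_pos hy0 _)]
      calc y ^ (s.re + 1) ≤ y ^ |s.re + 1| := Real.rpow_le_rpow_of_exponent_le hy.le (le_abs_self _)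
        _ ≤ _ := Real.rpow_le_rpow hy0.le hyq (abs_nonneg _)
    calc B * y ^ (d : ℝ) ≤ B * (q : ℝ) ^ (d : ℝ) := by gcongr
      _ ≤ B * (q : ℝ) ^ (d : ℝ) * ((q : ℝ) ^ (|s.re + 1|) * y ^ (-s.re - 1)) :=
        le_mul_of_one_le_right (by positivity) h2
      _ = _ := by ring
  · rw [indicator_of_notMem (by simpa using hyq), norm_zero]
    positivity

/-- The substitution `y = q^x` turns residues into Fourier integrals. -/
theorem fluctuationMellin_eq_integral (hq : 2 ≤ q) (hΦ : Continuous Φ) (s : ℂ) :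
    fluctuationMellin q d Φ s
      = Real.log q * ∫ x in (0 : ℝ)..1, Φ x * Complex.exp ((s + d) * Real.log q * x) := by
  have hq0 : (0 : ℝ) < q := by positivity
  have hq1 : (1 : ℝ) < q := by exact_mod_cast hq
  have hpos : ∀ y ∈ (fun x : ℝ => (q : ℝ) ^ x) '' uIcc 0 1, 0 < y := by
    rintro y ⟨x, -, rfl⟩
    exact Real.rpow_pos_of_pos hq0 x
  have h := intervalIntegral.integral_deriv_smul_comp'' (a := 0) (b := 1)
    (f := fun x : ℝ => (q : ℝ) ^ x) (f' := fun x : ℝ => (q : ℝ) ^ x * Real.log q)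
    (g := fun y : ℝ => (y : ℂ) ^ (s - 1) * fluctuationTerm q d Φ y)
    (Real.continuous_const_rpow hq0.ne').continuousOn
    (fun x _ => (Real.hasStrictDerivAt_const_rpow hq0 x).hasDerivAt.hasDerivWithinAt)
    ((Real.continuous_const_rpow hq0.ne').mul continuous_const).continuousOn
    (by
      intro y hy
      have hy0 := hpos y hy
      refine ContinuousAt.continuousWithinAt ?_
      unfold fluctuationTerm
      refine ContinuousAt.mul ?_ (ContinuousAt.mul (by fun_prop) ?_)
      · exact (Complex.continuousAt_ofReal_cpow_const y _ (Or.inr hy0.ne'))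
      · exact hΦ.continuousAt.comp (Real.continuousAt_logb hy0.ne'))
  rw [Real.rpow_zero, Real.rpow_one, intervalIntegral.integral_of_le hq1.le] at h
  rw [fluctuationMellin, ← h, ← intervalIntegral.integral_const_mul]
  refine intervalIntegral.integral_congr fun x _ => ?_
  have hqx : (0 : ℝ) < (q : ℝ) ^ x := Real.rpow_pos_of_pos hq0 x
  have hE : (((q : ℝ) ^ x : ℝ) : ℂ) ^ (s - 1) * (((q : ℝ) ^ x : ℝ) : ℂ) ^ d * (((q : ℝ) ^ x : ℝ) : ℂ)
      = Complex.exp ((s + d) * Real.log q * x) := by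
    rw [mul_assoc, ← pow_succ, cpow_sub_one_mul_pow hqx,
      Complex.cpow_def_of_ne_zero (by exact_mod_cast hqx.ne'), ← Complex.ofReal_log hqx.le,
      Real.log_rpow hq0]
    congr 1
    push_cast
    ring
  simp only [Function.comp, fluctuationTerm, Real.logb_rpow hq0 hq1.ne', Complex.real_smul]
  rw [← hE]
  push_cast
  ring

/-- Scaling by `q` maps `(1, ∞)` to `(q, ∞)` and multiplies the integral by `ω q^(s+d)`; the
difference of the two integrals is the one over `(1, q]`. -/
theorem mellin_fluctuationTerm (hq : 2 ≤ q) (hω : ‖ω‖ = 1) (hΦ : Continuous Φ)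
    (hper : ∀ x, Φ (x + 1) = ω * Φ x) {s : ℂ} (hs : s.re < -d) :
    mellin ((Ioi (1 : ℝ)).indicator (fluctuationTerm q d Φ)) s * (1 - ω * (q : ℂ) ^ (s + d))
      = fluctuationMellin q d Φ s := by
  have hq0 : (0 : ℝ) < q := by positivity
  have hq1 : (1 : ℝ) < q := by exact_mod_cast hq
  obtain ⟨B, hB0, hB⟩ := exists_norm_le_of_quasiPeriodic hω hΦ hper
  have hc := mellinConvergent_indicator_Ioi_one (measurable_fluctuationTerm hΦ)
    (norm_fluctuationTerm_le (q := q) (d := d) hB) hs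
  set G : ℝ → ℂ := fun y => (y : ℂ) ^ (s - 1) * fluctuationTerm q d Φ y with hG
  have hi : IntegrableOn G (Ioi 1) := by
    refine (IntegrableOn.mono_set hc (Ioi_subset_Ioi zero_le_one)).congr_fun (fun y hy => ?_)
      measurableSet_Ioi
    simp only [hG, indicator_of_mem hy, smul_eq_mul]
  have hscale : ∫ y in Ioi (q : ℝ), G y = ω * (q : ℂ) ^ (s + d) * ∫ y in Ioi (1 : ℝ), G y := by
    have h1 := integral_comp_mul_left_Ioi G 1 hq0
    rw [mul_one, setIntegral_congr_fun (g := fun y => (q : ℂ) ^ (s - 1) * (ω * (q : ℂ) ^ d) * G y)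
      measurableSet_Ioi, integral_const_mul] at h1
    · have hq0' : (q : ℂ) ≠ 0 := by exact_mod_cast hq0.ne'
      rw [Complex.real_smul, eq_comm, Complex.ofReal_inv, Complex.ofReal_natCast,
        inv_mul_eq_iff_eq_mul₀ hq0'] at h1
      rw [h1]
      have h2 := cpow_sub_one_mul_pow hq0 s d
      have h3 : (q : ℂ) ^ (s + d) = q * ((q : ℂ) ^ (s - 1) * (q : ℂ) ^ d) := by
        rw [show s + d = (s + d - 1) + 1 by ring, Complex.cpow_add _ _ hq0', Complex.cpow_one]
        rw [Complex.ofReal_natCast] at h2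
        rw [h2, mul_comm]
      rw [h3]
      ring
    · intro y hy
      have hy0 : (0 : ℝ) < y := zero_lt_one.trans hy
      simp only [hG]
      rw [fluctuationTerm_mul hq hper hy0, Complex.ofReal_mul,
        Complex.mul_cpow_ofReal_nonneg hq0.le hy0.le]
      push_cast
      ring
  have hsplit : ∫ y in Ioi (1 : ℝ), G y
      = (∫ y in Ioc (1 : ℝ) q, G y) + ∫ y in Ioi (q : ℝ), G y := by
    rw [← setIntegral_union (Ioc_disjoint_Ioi le_rfl) measurableSet_Ioi
      (hi.mono_set Ioc_subset_Ioi_self) (hi.mono_set (Ioi_subset_Ioi hq1.le)),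
      Ioc_union_Ioi_eq_Ioi hq1.le]
  rw [mellin_indicator_Ioi_one, fluctuationMellin]
  rw [hscale] at hsplit
  linear_combination hsplit

/-- With `s = -z`, the three main terms have explicit transforms, and the remainder is `O(y^a)` for
all `a > d - 1`, so its transform is analytic for `Re z > d - 1`. -/
theorem exists_meromorphic_continuation (hq : 2 ≤ q) (hω : ‖ω‖ = 1) (hΦ : Continuous Φ)
    (hper : ∀ x, Φ (x + 1) = ω * Φ x) {E K : ℂ} {A : ℝ → ℂ} (hA : Measurable A)
    (hr : ∀ a : ℝ, (d : ℝ) - 1 < a → ∃ C, ∀ y : ℝ, 1 < y →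
      ‖A y - (E * ((y : ℂ) ^ d * (Real.logb q y : ℂ)) + K * (y : ℂ) ^ d
        + fluctuationTerm q d Φ y)‖ ≤ C * y ^ a) :
    ∃ F : ℂ → ℂ,
      (∀ z : ℂ, (d : ℝ) < z.re →
        F z = z * ∫ t in Ioi (1 : ℝ), A t * (t : ℂ) ^ (-(z + 1))) ∧
      ∀ z₀ : ℂ, (d : ℝ) - 1 < z₀.re →
        (z₀ ≠ d → ω * (q : ℂ) ^ ((d : ℂ) - z₀) ≠ 1 → AnalyticAt ℂ F z₀) ∧
        HasPrincipalPart F z₀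
          ((if z₀ = d then E / Real.log q + K * d else 0)
            + (if ω * (q : ℂ) ^ ((d : ℂ) - z₀) = 1 then
              z₀ * ∫ x in (0 : ℝ)..1, Φ x * Complex.exp (((d : ℂ) - z₀) * Real.log q * x) else 0))
          (if z₀ = d then E * d / Real.log q else 0) := by
  have hq0 : (0 : ℝ) < q := by positivity
  have hq1 : (1 : ℝ) < q := by exact_mod_cast hq
  have hqc : (q : ℂ) ≠ 0 := by exact_mod_cast hq0.ne'
  have hL : (Real.log q : ℂ) ≠ 0 := by exact_mod_cast (Real.log_pos hq1).ne'
  obtain ⟨B, hB0, hB⟩ := exists_norm_le_of_quasiPeriodic hω hΦ hper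
  set L : ℂ := (Real.log q : ℂ) with hLdef
  set r : ℝ → ℂ := fun y => A y - (E * ((y : ℂ) ^ d * (Real.logb q y : ℂ)) + K * (y : ℂ) ^ d
        + fluctuationTerm q d Φ y) with hrdef
  have hrm : Measurable r := by
    have h1 : Measurable fun y : ℝ => (Real.logb q y : ℂ) := by
      unfold Real.logb
      exact Complex.measurable_ofReal.comp (Real.measurable_log.div_const _)
    have h2 : Measurable fun y : ℝ => (y : ℂ) ^ d := by fun_prop
    exact hA.sub ((((h2.mul h1).const_mul E).add (h2.const_mul K)).add
      (measurable_fluctuationTerm hΦ))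
  set R : ℂ → ℂ := mellin ((Ioi (1 : ℝ)).indicator r) with hR
  have hRd : ∀ s : ℂ, s.re < 1 - d → DifferentiableAt ℂ R s := fun s hs => by
    obtain ⟨C, hC⟩ := hr ((d - 1 - s.re) / 2) (by linarith)
    exact differentiableAt_mellin_indicator_Ioi_one hrm hC (by linarith)
  set D : ℂ → ℂ := fun z => 1 - ω * (q : ℂ) ^ ((d : ℂ) - z) with hD
  have hDd : ∀ z, HasDerivAt D (ω * (q : ℂ) ^ ((d : ℂ) - z) * L) z := fun z => by
    have h1 := ((hasDerivAt_id z).const_sub (d : ℂ)).const_cpow (c := (q : ℂ)) (Or.inl hqc)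
    have h2 := (h1.const_mul ω).const_sub 1
    refine h2.congr_deriv ?_
    rw [hLdef, ← Complex.natCast_log]
    simp only [id]
    ring
  have hDa : ∀ z, AnalyticAt ℂ D z := fun z =>
    (show Differentiable ℂ D from fun z => (hDd z).differentiableAt).analyticAt z
  have hIa : ∀ z, AnalyticAt ℂ (fun z => z * fluctuationMellin q d Φ (-z)) z := fun z =>
    (show Differentiable ℂ (fun z => z * fluctuationMellin q d Φ (-z)) from
      differentiable_id.mul
        ((differentiable_fluctuationMellin hq hω hΦ hper).comp differentiable_neg)).analyticAt z
  have hRa : ∀ z : ℂ, (d : ℝ) - 1 < z.re → AnalyticAt ℂ (fun z => z * R (-z)) z := fun z hz => by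
    refine DifferentiableOn.analyticAt (s := {z : ℂ | (d : ℝ) - 1 < z.re}) (fun w hw => ?_)
      ((isOpen_lt continuous_const Complex.continuous_re).mem_nhds hz)
    have hw' : (-w).re < 1 - d := by
      rw [Complex.neg_re]
      linarith [show (d : ℝ) - 1 < w.re from hw]
    exact (differentiableAt_id.mul
      ((hRd (-w) hw').comp w differentiableAt_id.neg)).differentiableWithinAt
  refine ⟨fun z => E / L * z / (z - d) ^ 2 + K * z / (z - d)
    + z * fluctuationMellin q d Φ (-z) / D z + z * R (-z), fun z hz => ?_, fun z₀ hz₀ => ⟨?_, ?_⟩⟩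
  · have hs : (-z).re < -d := by
      rw [Complex.neg_re]
      linarith
    have hzd : z - d ≠ 0 := fun h => by
      have := congrArg Complex.re h
      simp at this
      linarith
    have hDz : D z ≠ 0 := fun h => by
      have h1 : ‖ω * (q : ℂ) ^ ((d : ℂ) - z)‖ = 1 := by rw [← sub_eq_zero.1 h, norm_one]
      rw [norm_mul, hω, one_mul, Complex.norm_natCast_cpow_of_pos (by lia)] at h1
      have h2 := Real.rpow_lt_one_of_one_lt_of_neg hq1 (z := ((d : ℂ) - z).re)
        (by simp; linarith)
      linarith
    obtain ⟨hc1, hm1⟩ := mellin_indicator_pow_mul_log hs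
    have hpm : Measurable fun y : ℝ => (y : ℂ) ^ d := by fun_prop
    have hc2 := mellinConvergent_indicator_Ioi_one hpm (norm_pow_le_rpow d) hs
    have hm2 := mellin_indicator_pow hs
    have hc3 := mellinConvergent_indicator_Ioi_one (measurable_fluctuationTerm hΦ)
      (norm_fluctuationTerm_le (q := q) (d := d) hB) hs
    have hm3 := mellin_fluctuationTerm hq hω hΦ hper hs
    obtain ⟨C, hC⟩ := hr d (by linarith)
    have hc4 := mellinConvergent_indicator_Ioi_one hrm hC hs
    have h12 := hasMellin_add (hc1.const_smul (E / L)) (hc2.const_smul K)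
    have h123 := hasMellin_add h12.1 hc3
    have h1234 := hasMellin_add h123.1 hc4
    have hsum := h1234.2
    rw [h123.2, h12.2, mellin_const_smul, mellin_const_smul, hm1, hm2] at hsum
    have hAeq : (fun t => (((E / L) • (Ioi (1 : ℝ)).indicator
          (fun y : ℝ => (Real.log y : ℂ) * (y : ℂ) ^ d) t
        + K • (Ioi (1 : ℝ)).indicator (fun y : ℝ => (y : ℂ) ^ d) t)
        + (Ioi (1 : ℝ)).indicator (fluctuationTerm q d Φ) t)
        + (Ioi (1 : ℝ)).indicator r t) = (Ioi (1 : ℝ)).indicator A := by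
      funext y
      by_cases hy : 1 < y
      · simp only [indicator, mem_Ioi, hy, if_true, hrdef, Real.logb, smul_eq_mul, hLdef]
        push_cast
        ring
      · simp [indicator, hy]
    rw [hAeq, mellin_indicator_Ioi_one] at hsum
    have hI : ∫ t in Ioi (1 : ℝ), A t * (t : ℂ) ^ (-(z + 1))
        = ∫ y in Ioi (1 : ℝ), (y : ℂ) ^ (-z - 1) * A y := by
      congr 1
      funext t
      rw [mul_comm, neg_add']
    beta_reduce
    rw [hI, hsum, ← hm3, show (-z + d : ℂ) = d - z by ring]
    have hzd' : (d : ℂ) - z ≠ 0 := fun h => hzd (by linear_combination -h)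
    have e1 : 1 / (d - z) ^ 2 = 1 / (z - d) ^ 2 := by rw [← neg_sub, neg_sq]
    have e2 : -(1 / (d - z)) = 1 / (z - d) := by rw [← neg_sub z, div_neg, neg_neg]
    rw [e1, e2, show 1 - ω * (q : ℂ) ^ ((d : ℂ) - z) = D z from rfl]
    simp only [smul_eq_mul]
    field_simp
    ring
  · intro h1 h2
    have hne : (z₀ - d) ≠ 0 := sub_ne_zero.2 h1
    have hD0 : D z₀ ≠ 0 := fun h => h2 (sub_eq_zero.1 h).symm
    have hz1 : AnalyticAt ℂ (fun z : ℂ => E / L * z / (z - d) ^ 2) z₀ :=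
      AnalyticAt.div (by fun_prop) (by fun_prop) (pow_ne_zero 2 hne)
    have hz2 : AnalyticAt ℂ (fun z : ℂ => K * z / (z - d)) z₀ :=
      AnalyticAt.div (by fun_prop) (by fun_prop) hne
    exact ((hz1.add hz2).add ((hIa z₀).div (hDa z₀) hD0)).add (hRa z₀ hz₀)
  · have P1 : HasPrincipalPart (fun z : ℂ => E / L * z / (z - d) ^ 2 + K * z / (z - d)) z₀
        (if z₀ = d then E / L + K * d else 0) (if z₀ = d then E * d / L else 0) := by
      split_ifs with h
      -- Writing `z = (z - d) + d`, the double pole also contributes `E / L` to the residue; this is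
      -- what the term with `e_T` in `c_0` compensates.
      · subst h
        refine ⟨fun _ => K, analyticAt_const, ?_⟩
        filter_upwards [self_mem_nhdsWithin] with z hz
        have hz' : z - d ≠ 0 := sub_ne_zero.2 hz
        field_simp
        ring
      · have hne : (z₀ - d) ≠ 0 := sub_ne_zero.2 h
        have hz1 : AnalyticAt ℂ (fun z : ℂ => E / L * z / (z - d) ^ 2) z₀ :=
          AnalyticAt.div (by fun_prop) (by fun_prop) (pow_ne_zero 2 hne)
        have hz2 : AnalyticAt ℂ (fun z : ℂ => K * z / (z - d)) z₀ :=
          AnalyticAt.div (by fun_prop) (by fun_prop) hne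
        exact (hz1.add hz2).hasPrincipalPart
    have P2 : HasPrincipalPart (fun z => z * fluctuationMellin q d Φ (-z) / D z) z₀
        (if ω * (q : ℂ) ^ ((d : ℂ) - z₀) = 1 then
          z₀ * ∫ x in (0 : ℝ)..1, Φ x * Complex.exp (((d : ℂ) - z₀) * L * x) else 0) 0 := by
      split_ifs with h
      -- At a zero of `D` its derivative is `log q`, which cancels the factor from the substitution
      -- `y = q^x`.
      · have h1 := hasPrincipalPart_div (hIa z₀) (hDa z₀) (by simp [hD, h]) (hDd z₀)
          (by rw [h, one_mul]; exact hL)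
        rw [h, one_mul, fluctuationMellin_eq_integral hq hΦ, ← hLdef,
          show (-z₀ + d : ℂ) = d - z₀ by ring] at h1
        convert h1 using 1
        field_simp
      · exact ((hIa z₀).div (hDa z₀) fun h' => h (sub_eq_zero.1 h').symm).hasPrincipalPart
    simpa using (P1.add P2).add (hRa z₀ hz₀).hasPrincipalPart

end Continuation

/-! ### Absolute convergence and integral representation of the Dirichlet series. -/

namespace DigitTransducer

section DirichletSeries

variable {q d : ℕ} [NeZero q] {σ : Type*} {T : DigitTransducer q d σ}

theorem sup_eq_iff_mem_box (hd : 1 ≤ d) (n : Fin d → ℕ) (m : ℕ) :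
    Finset.univ.sup n = m ↔ n ∈ box d (m + 1) \ box d m := by
  rw [Finset.mem_sdiff, mem_box, mem_box]
  have h1 : (∀ i, n i < m + 1) ↔ Finset.univ.sup n ≤ m := by simp
  have h2 : (∀ i, n i < m) ↔ Finset.univ.sup n < m := by
    have : Nonempty (Fin d) := ⟨⟨0, hd⟩⟩
    constructor
    · intro h
      have hm : 0 < m := (Nat.zero_le _).trans_lt (h ⟨0, hd⟩)
      exact (Finset.sup_lt_iff hm).2 fun i _ => h i
    · intro h i
      exact (Finset.le_sup (Finset.mem_univ i)).trans_lt h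
  rw [h1, h2]
  lia

theorem card_box_sdiff_le (m : ℕ) :
    (((box d (m + 1)) \ box d m).card : ℝ) ≤ d * ((m : ℝ) + 1) ^ ((d : ℝ) - 1) := by
  rw [Finset.card_sdiff_of_subset (box_subset m), card_box, card_box,
    Nat.cast_sub (Nat.pow_le_pow_left (Nat.le_succ m) d)]
  have h := abs_pow_sub_pow_le_rpow (d := d) (a := (d : ℝ) - 1) (Nat.cast_nonneg (α := ℝ) m)
    (by linarith : (m : ℝ) ≤ m + 1) le_rfl (by linarith [Nat.cast_nonneg (α := ℝ) m]) le_rfl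
  push_cast
  exact (le_abs_self _).trans h

/-- Terms are grouped by the maximum norm `m`: there are `O(m^(d-1))` of them, each `O(m^(η - Re
z))`, with `η` half the distance from `Re z` to `d`. -/
theorem summable_dirichletTerm [Finite σ] (hq : 2 ≤ q) (hd : 1 ≤ d) (T : DigitTransducer q d σ)
    {z : ℂ} (hz : (d : ℝ) < z.re) (s : σ) : Summable (T.dirichletTerm z s) := by
  set η : ℝ := (z.re - d) / 2 with hη
  have hη0 : 0 < η := by rw [hη]; linarith
  obtain ⟨C, hC0, hC⟩ := exists_abs_outputVec_le hq T hη0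
  set b : ℝ := (d : ℝ) - 1 + η with hb
  have hd' : (1 : ℝ) ≤ d := by exact_mod_cast hd
  have hb0 : 0 ≤ b := by rw [hb]; linarith
  set φ : ℕ → ℝ := fun m => C * ((m : ℝ) + 1) ^ η * (m : ℝ) ^ (-z.re) with hφ
  have hφ0 : ∀ m, 0 ≤ φ m := fun m => by positivity
  have hsum : Summable fun m : ℕ => C * d * 2 ^ b * (m : ℝ) ^ (b - z.re) :=
    (Real.summable_nat_rpow.2 (by rw [hb, hη]; linarith)).mul_left _
  have hsup : ∀ n : {n : Fin d → ℕ // n ≠ 0}, 1 ≤ Finset.univ.sup n.1 := fun n => by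
    by_contra h
    refine n.2 (funext fun i => ?_)
    have := Finset.le_sup (f := n.1) (Finset.mem_univ i)
    simp only [Pi.zero_apply]
    lia
  have hterm : ∀ n : {n : Fin d → ℕ // n ≠ 0},
      ‖T.dirichletTerm z s n‖ ≤ φ (Finset.univ.sup n.1) := fun n => by
    rw [dirichletTerm, norm_mul, Complex.norm_real,
      Complex.norm_natCast_cpow_of_pos (hsup n), Complex.neg_re]
    have h := hC _ n.1 (Finset.mem_sdiff.1 ((sup_eq_iff_mem_box hd n.1 _).1 rfl)).1 s
    rw [hφ]
    exact mul_le_mul_of_nonneg_right h (by positivity)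
  have hblock : ∀ m : ℕ, 1 ≤ m →
      (((box d (m + 1)) \ box d m).card : ℝ) * φ m ≤ C * d * 2 ^ b * (m : ℝ) ^ (b - z.re) := by
    intro m hm
    have hm' : (1 : ℝ) ≤ m := by exact_mod_cast hm
    have hm1 : (0 : ℝ) < (m : ℝ) + 1 := by linarith
    have h2 : ((m : ℝ) + 1) ^ b ≤ 2 ^ b * (m : ℝ) ^ b := by
      rw [← Real.mul_rpow (by norm_num) (by linarith)]
      exact Real.rpow_le_rpow hm1.le (by linarith) hb0
    calc _ ≤ d * ((m : ℝ) + 1) ^ ((d : ℝ) - 1) * φ m :=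
          mul_le_mul_of_nonneg_right (card_box_sdiff_le m) (hφ0 m)
      _ = C * d * ((m : ℝ) + 1) ^ b * (m : ℝ) ^ (-z.re) := by
          simp only [hφ]
          rw [hb, Real.rpow_add hm1 ((d : ℝ) - 1) η]
          ring
      _ ≤ C * d * (2 ^ b * (m : ℝ) ^ b) * (m : ℝ) ^ (-z.re) := by gcongr
      _ = _ := by rw [show b - z.re = b + -z.re from sub_eq_add_neg _ _,
            Real.rpow_add (show (0 : ℝ) < m by linarith) b]; ring
  refine Summable.of_norm (summable_of_sum_le (fun _ => norm_nonneg _)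
    (c := ∑' m : ℕ, C * d * 2 ^ b * (m : ℝ) ^ (b - z.re)) fun S => ?_)
  calc ∑ n ∈ S, ‖T.dirichletTerm z s n‖
      ≤ ∑ n ∈ S, φ (Finset.univ.sup n.1) := Finset.sum_le_sum fun n _ => hterm n
    _ = ∑ m ∈ S.image fun n : {n : Fin d → ℕ // n ≠ 0} => Finset.univ.sup n.1,
        ((S.filter fun n => Finset.univ.sup n.1 = m).card : ℝ) * φ m := by
        rw [Finset.sum_comp]
        simp only [nsmul_eq_mul]
    _ ≤ ∑ m ∈ S.image fun n : {n : Fin d → ℕ // n ≠ 0} => Finset.univ.sup n.1,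
        C * d * 2 ^ b * (m : ℝ) ^ (b - z.re) := by
        refine Finset.sum_le_sum fun m hm => ?_
        obtain ⟨n, -, hn⟩ := Finset.mem_image.1 hm
        refine le_trans (mul_le_mul_of_nonneg_right ?_ (hφ0 m)) (hblock m (hn ▸ hsup n))
        have : (S.filter fun n => Finset.univ.sup n.1 = m).card
            ≤ ((box d (m + 1)) \ box d m).card := by
          refine Finset.card_le_card_of_injOn Subtype.val (fun n hn => ?_)
            (Subtype.val_injective.injOn)
          exact (sup_eq_iff_mem_box hd _ _).1 (Finset.mem_filter.1 hn).2
        exact_mod_cast this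
    _ ≤ _ := hsum.sum_le_tsum _ fun m _ => by positivity

/-- Summation over the fibres of the maximum norm. The index `n = 0` may be added because `0 ^ (-z)`
is 0 by convention for `z ≠ 0`. -/
theorem hasSum_term_boxSum [Finite σ] (hq : 2 ≤ q) (hd : 1 ≤ d) (T : DigitTransducer q d σ)
    {z : ℂ} (hz : (d : ℝ) < z.re) (s : σ) :
    HasSum (LSeries.term (fun m => T.boxSum (m + 1) s - T.boxSum m s) z)
      (T.dirichletSeries z s) := by
  have hz0 : z ≠ 0 := fun h => by
    rw [h, Complex.zero_re] at hz
    exact absurd hz (not_lt.2 (Nat.cast_nonneg d))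
  set t : (Fin d → ℕ) → ℂ := fun n => (T.outputVec n s : ℂ) *
    ((Finset.univ.sup n : ℕ) : ℂ) ^ (-z) with ht
  have h1 : HasSum (fun n : {n : Fin d → ℕ // n ≠ 0} => t n.1) (T.dirichletSeries z s) :=
    (summable_dirichletTerm hq hd T hz s).hasSum
  have h2 : HasSum t (T.dirichletSeries z s) := by
    refine (hasSum_subtype_iff_of_support_subset (s := {n : Fin d → ℕ | n ≠ 0}) ?_).1 h1
    intro n hn h0
    refine hn ?_
    rw [h0, ht]
    have h3 : (Finset.univ.sup (0 : Fin d → ℕ)) = 0 := by simp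
    simp only [h3, Nat.cast_zero]
    rw [Complex.zero_cpow (neg_ne_zero.2 hz0), mul_zero]
  have h3 := h2.tsum_fiberwise fun n => Finset.univ.sup n
  refine (congrArg (HasSum · _) (funext fun m => ?_)).mpr h3
  have hset : ((fun n : Fin d → ℕ => Finset.univ.sup n) ⁻¹' {m})
      = ((box d (m + 1) \ box d m : Finset (Fin d → ℕ)) : Set (Fin d → ℕ)) := by
    ext n
    rw [Set.mem_preimage, Set.mem_singleton_iff, sup_eq_iff_mem_box hd, Finset.mem_coe]
  rw [hset, Finset.tsum_subtype']
  have hval : ∀ n ∈ box d (m + 1) \ box d m, t n = (T.outputVec n s : ℂ) * (m : ℂ) ^ (-z) :=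
    fun n hn => by simp only [ht, (sup_eq_iff_mem_box hd n m).2 hn]
  rw [Finset.sum_congr rfl hval, ← Finset.sum_mul, LSeries.term_def]
  have hdiff : T.boxSum (m + 1) s - T.boxSum m s
      = ∑ n ∈ box d (m + 1) \ box d m, (T.outputVec n s : ℂ) := by
    rw [boxSum, boxSum, ← Finset.sum_sdiff (box_subset m), add_sub_cancel_right]
  split_ifs with hm
  · rw [hm, Nat.cast_zero, Complex.zero_cpow (neg_ne_zero.2 hz0), mul_zero]
  · rw [hdiff, Complex.cpow_neg, div_eq_mul_inv]

variable [Fintype σ]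

theorem hasSum_term_dotProduct (hq : 2 ≤ q) (hd : 1 ≤ d) (T : DigitTransducer q d σ)
    {z : ℂ} (hz : (d : ℝ) < z.re) (w : σ → ℂ) :
    HasSum (LSeries.term (fun m => w ⬝ᵥ (T.boxSum (m + 1) - T.boxSum m)) z)
      (w ⬝ᵥ T.dirichletSeries z) := by
  have h := hasSum_sum (s := Finset.univ) fun s _ =>
    (hasSum_term_boxSum hq hd T hz s).mul_left (w s)
  refine (congrArg (HasSum · _) (funext fun m => ?_)).mpr h
  simp only [LSeries.term_def, dotProduct, Pi.sub_apply]
  split_ifs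
  · simp
  · simp [Finset.sum_div, mul_div_assoc]

variable [DecidableEq σ]

/-- Partial summation. The shell of norm `m` is the difference of the boxes of sides `m + 1` and
`m`, so the partial sums telescope; `boxSum 1` is the omitted term `n = 0`. -/
theorem dotProduct_dirichletSeries (hq : 2 ≤ q) (hd : 1 ≤ d) (T : DigitTransducer q d σ)
    {z : ℂ} (hz : (d : ℝ) < z.re) (w : σ → ℂ) :
    w ⬝ᵥ T.dirichletSeries z
      = z * ∫ t in Set.Ioi (1 : ℝ),
        (w ⬝ᵥ (T.boxSum (⌊t⌋₊ + 1) - T.boxSum 1)) * (t : ℂ) ^ (-(z + 1)) := by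
  have h := hasSum_term_dotProduct hq hd T hz w
  have hpart : ∀ n : ℕ, ∑ k ∈ Finset.Icc 1 n, w ⬝ᵥ (T.boxSum (k + 1) - T.boxSum k)
      = w ⬝ᵥ (T.boxSum (n + 1) - T.boxSum 1) := fun n => by
    induction n with
    | zero => simp
    | succ n ih =>
      rw [Finset.sum_Icc_succ_top (by lia), ih, ← dotProduct_add]
      congr 1
      abel
  -- The midpoint choice gives both `d - 1 < a` and `a + 1 < Re z`.
  set a : ℝ := ((d : ℝ) + z.re) / 2 - 1 with ha
  have hd' : (1 : ℝ) ≤ d := by exact_mod_cast hd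
  obtain ⟨C, hC0, hC⟩ := exists_norm_boxSum_sub_le hq T (a := a) (by rw [ha]; linarith)
  have ha0 : 0 ≤ a := by rw [ha]; linarith
  have hO : (fun n : ℕ => ∑ k ∈ Finset.Icc 1 n, w ⬝ᵥ (T.boxSum (k + 1) - T.boxSum k))
      =O[atTop] fun n : ℕ => (n : ℝ) ^ (a + 1) := by
    refine IsBigO.of_bound ((∑ s, ‖w s‖) * (C * 2 ^ a)) ?_
    filter_upwards [eventually_ge_atTop 1] with n hn
    have hn' : (1 : ℝ) ≤ n := by exact_mod_cast hn
    have h1 := norm_sub_le_of_increment ha0 hC0 hC 1 n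
    rw [add_comm 1 n] at h1
    rw [hpart, Real.norm_of_nonneg (by positivity)]
    refine (Matrix.norm_dotProduct_le _ _).trans ?_
    rw [mul_assoc]
    refine mul_le_mul_of_nonneg_left (h1.trans ?_) (Finset.sum_nonneg fun s _ => norm_nonneg _)
    have h2 : ((n : ℝ) + 1) ^ a ≤ 2 ^ a * (n : ℝ) ^ a := by
      rw [← Real.mul_rpow (by norm_num) (by linarith)]
      exact Real.rpow_le_rpow (by linarith) (by linarith) ha0
    calc _ ≤ (n : ℝ) * (C * (2 ^ a * (n : ℝ) ^ a)) := by
          push_cast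
          rw [add_comm 1 (n : ℝ)]
          gcongr
      _ = _ := by rw [Real.rpow_add_one (by linarith)]; ring
  have := LSeries_eq_mul_integral _ (r := a + 1) (by linarith) (s := z) (by rw [ha]; linarith)
    h.summable hO
  simp only [hpart] at this
  rw [← this]
  exact h.tsum_eq.symm

end DirichletSeries

end DigitTransducer

/-! ### Fluctuations attached to the vectors `w_k`. -/

namespace DigitTransducer

section Fluctuation

variable {q d : ℕ} [NeZero q] {σ : Type*} [Fintype σ] [DecidableEq σ] {T : DigitTransducer q d σ}

/-- The root of unity `exp(2πik/p)`. -/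
noncomputable def rootOfUnity (T : DigitTransducer q d σ) (k : ℤ) : ℂ :=
  Complex.exp (2 * Real.pi * Complex.I * k / T.finalPeriod)

/-- The contribution of the vector `w_k` to the fluctuation of the normalized box sums. -/
noncomputable def eigenFluctuation (T : DigitTransducer q d σ) (E K : σ → ℂ) (k : ℤ) : ℝ → ℂ :=
  scaleFluctuation q d ((q : ℂ) ^ d * T.rootOfUnity k)
    fun N => T.leftVec k 0 ⬝ᵥ T.normalizedSum E K N

theorem norm_eigenvalue (k : ℤ) : ‖(q : ℂ) ^ d * T.rootOfUnity k‖ = (q : ℝ) ^ d := by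
  rw [norm_mul, rootOfUnity, norm_root_of_unity, mul_one, norm_pow, Complex.norm_natCast]

theorem exists_norm_leftVec_dotProduct_le (hq : 2 ≤ q) (hd : 1 ≤ d) (T : DigitTransducer q d σ)
    {E K : σ → ℂ} (hE : (T.matrix 0).mulVec E = (q : ℂ) ^ d • E)
    (hO : T.outSum = (q : ℂ) ^ d • E + ((q : ℂ) ^ d • K - (T.matrix 0).mulVec K)) (k : ℤ) {a : ℝ}
    (ha : (d : ℝ) - 1 < a) : ∃ C : ℝ, 0 ≤ C ∧
      (∀ N : ℕ, ‖T.leftVec k 0 ⬝ᵥ T.normalizedSum E K N - ((q : ℂ) ^ d * T.rootOfUnity k)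
        * (T.leftVec k 0 ⬝ᵥ T.normalizedSum E K (N / q))‖ ≤ C * ((N : ℝ) + 1) ^ a) ∧
      ∀ N : ℕ, ‖T.leftVec k 0 ⬝ᵥ T.normalizedSum E K (N + 1)
        - T.leftVec k 0 ⬝ᵥ T.normalizedSum E K N‖ ≤ C * ((N : ℝ) + 1) ^ a := by
  obtain ⟨C, hC0, hC⟩ := T.exists_norm_normalizedSum_sub_mulVec_le hq hd hE hO ha
  obtain ⟨D, hD0, hD⟩ := T.exists_norm_normalizedSum_sub_le hq hd E K ha
  have hW : 0 ≤ ∑ s, ‖T.leftVec k 0 s‖ := Finset.sum_nonneg fun s _ => norm_nonneg _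
  refine ⟨(∑ s, ‖T.leftVec k 0 s‖) * (C + D), by positivity, fun N => ?_, fun N => ?_⟩
  · have h1 : ((q : ℂ) ^ d * T.rootOfUnity k) * (T.leftVec k 0 ⬝ᵥ T.normalizedSum E K (N / q))
        = T.leftVec k 0 ⬝ᵥ (T.matrix 0).mulVec (T.normalizedSum E K (N / q)) := by
      rw [Matrix.dotProduct_mulVec, vecMul_leftVec, smul_dotProduct, smul_eq_mul, rootOfUnity]
    rw [h1, ← dotProduct_sub, mul_assoc]
    refine (Matrix.norm_dotProduct_le _ _).trans (mul_le_mul_of_nonneg_left ((hC N).trans ?_) hW)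
    have : 0 ≤ ((N : ℝ) + 1) ^ a := by positivity
    gcongr
    linarith
  · rw [← dotProduct_sub, mul_assoc]
    refine (Matrix.norm_dotProduct_le _ _).trans (mul_le_mul_of_nonneg_left ((hD N).trans ?_) hW)
    have : 0 ≤ ((N : ℝ) + 1) ^ a := by positivity
    gcongr
    linarith

theorem eigenFluctuation_add_one (hq : 2 ≤ q) (hd : 1 ≤ d)
    {E K : σ → ℂ} (hE : (T.matrix 0).mulVec E = (q : ℂ) ^ d • E)
    (hO : T.outSum = (q : ℂ) ^ d • E + ((q : ℂ) ^ d • K - (T.matrix 0).mulVec K)) (k : ℤ) (x : ℝ) :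
    T.eigenFluctuation E K k (x + 1) = T.rootOfUnity k * T.eigenFluctuation E K k x := by
  have hd' : (1 : ℝ) ≤ d := by exact_mod_cast hd
  obtain ⟨C, hC0, h1, -⟩ := T.exists_norm_leftVec_dotProduct_le hq hd hE hO k
    (a := (d : ℝ) - 1 / 2) (by linarith)
  have hqd : (q : ℂ) ^ d ≠ 0 := pow_ne_zero _ (NeZero.ne _)
  rw [eigenFluctuation, scaleFluctuation_add_one hq (norm_eigenvalue k) (by linarith)
    (by linarith) hC0 h1, mul_div_cancel_left₀ _ hqd]

theorem exists_norm_eigenFluctuation_sub_le (hq : 2 ≤ q) (hd : 1 ≤ d)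
    {E K : σ → ℂ} (hE : (T.matrix 0).mulVec E = (q : ℂ) ^ d • E)
    (hO : T.outSum = (q : ℂ) ^ d • E + ((q : ℂ) ^ d • K - (T.matrix 0).mulVec K)) (k : ℤ)
    {α : ℝ} (hα0 : 0 < α) (hα1 : α < 1) :
    ∃ D : ℝ, 0 ≤ D ∧ ∀ x y,
      ‖T.eigenFluctuation E K k x - T.eigenFluctuation E K k y‖ ≤ D * |x - y| ^ α := by
  have hd' : (1 : ℝ) ≤ d := by exact_mod_cast hd
  obtain ⟨C, hC0, h1, h2⟩ := T.exists_norm_leftVec_dotProduct_le hq hd hE hO k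
    (a := (d : ℝ) - α) (by linarith)
  have h := exists_norm_scaleFluctuation_sub_le hq (norm_eigenvalue k) (by linarith)
    (by linarith) (by linarith) hC0 h1 h2
  rwa [sub_sub_cancel] at h

theorem continuous_of_norm_sub_le_rpow {f : ℝ → ℂ} {D α : ℝ} (hα : 0 < α)
    (h : ∀ x y, ‖f x - f y‖ ≤ D * |x - y| ^ α) : Continuous f := by
  refine continuous_iff_continuousAt.2 fun x => ?_
  rw [ContinuousAt, tendsto_iff_norm_sub_tendsto_zero]
  refine squeeze_zero (fun _ => norm_nonneg _) (fun y => h y x) ?_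
  have hc : Continuous fun y : ℝ => D * |y - x| ^ α :=
    continuous_const.mul ((continuous_id.sub continuous_const).abs.rpow_const
      fun _ => Or.inr hα.le)
  have := hc.tendsto x
  simpa [Real.zero_rpow hα.ne'] using this

theorem continuous_eigenFluctuation (hq : 2 ≤ q) (hd : 1 ≤ d)
    {E K : σ → ℂ} (hE : (T.matrix 0).mulVec E = (q : ℂ) ^ d • E)
    (hO : T.outSum = (q : ℂ) ^ d • E + ((q : ℂ) ^ d • K - (T.matrix 0).mulVec K)) (k : ℤ) :
    Continuous (T.eigenFluctuation E K k) := by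
  obtain ⟨D, -, hD⟩ := exists_norm_eigenFluctuation_sub_le hq hd hE hO k
    (α := 1 / 2) (by norm_num) (by norm_num)
  exact continuous_of_norm_sub_le_rpow (by norm_num) hD

theorem exists_norm_sub_eigenFluctuation_le (hq : 2 ≤ q) (hd : 1 ≤ d)
    {E K : σ → ℂ} (hE : (T.matrix 0).mulVec E = (q : ℂ) ^ d • E)
    (hO : T.outSum = (q : ℂ) ^ d • E + ((q : ℂ) ^ d • K - (T.matrix 0).mulVec K)) (k : ℤ) {a : ℝ}
    (ha : (d : ℝ) - 1 < a) (had : a < d) : ∃ C : ℝ, 0 ≤ C ∧ ∀ y : ℝ, 1 ≤ y →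
      ‖T.leftVec k 0 ⬝ᵥ T.normalizedSum E K ⌊y⌋₊
        - fluctuationTerm q d (T.eigenFluctuation E K k) y‖ ≤ C * y ^ a := by
  have hd' : (1 : ℝ) ≤ d := by exact_mod_cast hd
  have hq1 : (1 : ℝ) < q := by exact_mod_cast hq
  obtain ⟨C, hC0, h1, h2⟩ := T.exists_norm_leftVec_dotProduct_le hq hd hE hO k ha
  refine ⟨C / (1 - (q : ℝ) ^ (a - d)) * 2 ^ a, ?_, fun y hy => ?_⟩
  · have := rpow_sub_lt_one (d := d) hq had
    have h3 : 0 < 1 - (q : ℝ) ^ (a - d) := by linarith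
    positivity
  · exact norm_scaleLimit_log_sub_le hq (norm_eigenvalue k) (by linarith) had hC0 h1 hy

/-- Replacing `⌊y⌋ + 1` by `y` in the main terms, and by `⌊y⌋` in the normalized sum, costs one
increment each. -/
theorem exists_norm_boxSum_sub_main_le (hq : 2 ≤ q) (hd : 1 ≤ d)
    {E K : σ → ℂ} (hE : (T.matrix 0).mulVec E = (q : ℂ) ^ d • E)
    (hO : T.outSum = (q : ℂ) ^ d • E + ((q : ℂ) ^ d • K - (T.matrix 0).mulVec K)) (k : ℤ) {a : ℝ}
    (ha : (d : ℝ) - 1 < a) : ∃ C : ℝ, ∀ y : ℝ, 1 < y →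
      ‖T.leftVec k 0 ⬝ᵥ (T.boxSum (⌊y⌋₊ + 1) - T.boxSum 1)
        - ((T.leftVec k 0 ⬝ᵥ E) * ((y : ℂ) ^ d * (Real.logb q y : ℂ))
          + (T.leftVec k 0 ⬝ᵥ K) * (y : ℂ) ^ d
          + fluctuationTerm q d (T.eigenFluctuation E K k) y)‖ ≤ C * y ^ a := by
  have hd' : (1 : ℝ) ≤ d := by exact_mod_cast hd
  -- The fluctuation exists for exponents below `d`; since `y > 1`, a bound with a smaller exponent
  -- implies the others.
  wlog had : a < d generalizing a
  · obtain ⟨C, hC⟩ := this (a := (d : ℝ) - 1 / 2) (by linarith) (by linarith)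
    have hC0 : 0 ≤ C * (2 : ℝ) ^ ((d : ℝ) - 1 / 2) := (norm_nonneg _).trans (hC 2 (by norm_num))
    have hC0' : 0 ≤ C := nonneg_of_mul_nonneg_left hC0 (by positivity)
    refine ⟨C, fun y hy => (hC y hy).trans ?_⟩
    have := Real.rpow_le_rpow_of_exponent_le hy.le (show (d : ℝ) - 1 / 2 ≤ a by linarith)
    gcongr
  set w := T.leftVec k 0 with hw
  have ha0 : 0 ≤ a := by linarith
  obtain ⟨C₁, hC₁0, hC₁⟩ := exists_abs_pow_mul_logb_sub_le hq hd ha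
  obtain ⟨C₂, hC₂0, -, hC₂⟩ := T.exists_norm_leftVec_dotProduct_le hq hd hE hO k ha
  obtain ⟨C₃, hC₃0, hC₃⟩ := exists_norm_sub_eigenFluctuation_le hq hd hE hO k ha had
  refine ⟨‖w ⬝ᵥ E‖ * (C₁ * 2 ^ a) + ‖w ⬝ᵥ K‖ * (d * 2 ^ a) + C₂ * 2 ^ a + C₃ + ‖w ⬝ᵥ T.boxSum 1‖,
    fun y hy => ?_⟩
  set N : ℕ := ⌊y⌋₊ with hN
  have hy0 : 0 < y := by linarith
  have hfl : (N : ℝ) ≤ y := Nat.floor_le hy0.le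
  have hlt : y ≤ (N : ℝ) + 1 := (Nat.lt_floor_add_one y).le
  have h2y : ((N : ℝ) + 1) ^ a ≤ 2 ^ a * y ^ a := by
    rw [← Real.mul_rpow (by norm_num) hy0.le]
    exact Real.rpow_le_rpow (by positivity) (by linarith) ha0
  have hya : 1 ≤ y ^ a := Real.one_le_rpow hy.le ha0
  have e1 : ‖((N : ℂ) + 1) ^ d * (Real.logb q ((N : ℝ) + 1) : ℂ) - (y : ℂ) ^ d * (Real.logb q y : ℂ)‖
      ≤ C₁ * 2 ^ a * y ^ a := by
    have h := hC₁ y ((N : ℝ) + 1) hy.le hlt (by linarith)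
    have hc : ((N : ℂ) + 1) ^ d * (Real.logb q ((N : ℝ) + 1) : ℂ) - (y : ℂ) ^ d * (Real.logb q y : ℂ)
        = (((N : ℝ) + 1) ^ d * Real.logb q ((N : ℝ) + 1) - y ^ d * Real.logb q y : ℝ) := by
      push_cast; ring
    rw [hc, Complex.norm_real, Real.norm_eq_abs, mul_assoc]
    exact h.trans (mul_le_mul_of_nonneg_left h2y hC₁0)
  have e2 : ‖((N : ℂ) + 1) ^ d - (y : ℂ) ^ d‖ ≤ d * 2 ^ a * y ^ a := by
    have h := abs_pow_sub_pow_le_rpow (d := d) (a := a) hy0.le hlt (by linarith) (by linarith)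
      ha.le
    have hc : ((N : ℂ) + 1) ^ d - (y : ℂ) ^ d = (((N : ℝ) + 1) ^ d - y ^ d : ℝ) := by
      push_cast; ring
    rw [hc, Complex.norm_real, Real.norm_eq_abs, mul_assoc]
    exact h.trans (mul_le_mul_of_nonneg_left h2y (by positivity))
  have e3 := (hC₂ N).trans (mul_le_mul_of_nonneg_left h2y hC₂0)
  have e4 := hC₃ y hy.le
  have hsplit : w ⬝ᵥ (T.boxSum (N + 1) - T.boxSum 1)
        - ((w ⬝ᵥ E) * ((y : ℂ) ^ d * (Real.logb q y : ℂ)) + (w ⬝ᵥ K) * (y : ℂ) ^ d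
          + fluctuationTerm q d (T.eigenFluctuation E K k) y)
      = (w ⬝ᵥ E) * (((N : ℂ) + 1) ^ d * (Real.logb q ((N : ℝ) + 1) : ℂ)
          - (y : ℂ) ^ d * (Real.logb q y : ℂ))
        + (w ⬝ᵥ K) * (((N : ℂ) + 1) ^ d - (y : ℂ) ^ d)
        + (w ⬝ᵥ T.normalizedSum E K (N + 1) - w ⬝ᵥ T.normalizedSum E K N)
        + (w ⬝ᵥ T.normalizedSum E K N - fluctuationTerm q d (T.eigenFluctuation E K k) y)
        - w ⬝ᵥ T.boxSum 1 := by
    have hns : w ⬝ᵥ T.normalizedSum E K (N + 1) = w ⬝ᵥ T.boxSum (N + 1)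
        - ((N : ℂ) + 1) ^ d * (Real.logb q ((N : ℝ) + 1) : ℂ) * (w ⬝ᵥ E)
        - ((N : ℂ) + 1) ^ d * (w ⬝ᵥ K) := by
      rw [normalizedSum, dotProduct_sub, dotProduct_sub, dotProduct_smul, dotProduct_smul]
      simp only [smul_eq_mul, Nat.cast_add, Nat.cast_one]
    rw [hns, dotProduct_sub]
    ring
  rw [hsplit]
  refine (norm_sub_le _ _).trans ?_
  refine (add_le_add_left ((norm_add_le _ _).trans (add_le_add_left ((norm_add_le _ _).trans
    (add_le_add_left (norm_add_le _ _) _)) _)) _).trans ?_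
  rw [norm_mul, norm_mul]
  have f1 := mul_le_mul_of_nonneg_left e1 (norm_nonneg (w ⬝ᵥ E))
  have f2 := mul_le_mul_of_nonneg_left e2 (norm_nonneg (w ⬝ᵥ K))
  have f5 := le_mul_of_one_le_right (norm_nonneg (w ⬝ᵥ T.boxSum 1)) hya
  linarith

theorem exists_dirichletSeries_continuation (hq : 2 ≤ q) (hd : 1 ≤ d) (T : DigitTransducer q d σ)
    {E K : σ → ℂ} (hE : (T.matrix 0).mulVec E = (q : ℂ) ^ d • E)
    (hO : T.outSum = (q : ℂ) ^ d • E + ((q : ℂ) ^ d • K - (T.matrix 0).mulVec K)) (k : ℤ) :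
    ∃ F : ℂ → ℂ,
      (∀ z : ℂ, (d : ℝ) < z.re → F z = T.leftVec k 0 ⬝ᵥ T.dirichletSeries z) ∧
      ∀ z₀ : ℂ, (d : ℝ) - 1 < z₀.re →
        (z₀ ≠ d → T.rootOfUnity k * (q : ℂ) ^ ((d : ℂ) - z₀) ≠ 1 → AnalyticAt ℂ F z₀) ∧
        HasPrincipalPart F z₀
          ((if z₀ = d then (T.leftVec k 0 ⬝ᵥ E) / Real.log q + (T.leftVec k 0 ⬝ᵥ K) * d else 0)
            + (if T.rootOfUnity k * (q : ℂ) ^ ((d : ℂ) - z₀) = 1 then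
              z₀ * ∫ x in (0 : ℝ)..1, T.eigenFluctuation E K k x
                * Complex.exp (((d : ℂ) - z₀) * Real.log q * x) else 0))
          (if z₀ = d then (T.leftVec k 0 ⬝ᵥ E) * d / Real.log q else 0) := by
  obtain ⟨F, hF1, hF2⟩ := exists_meromorphic_continuation hq (norm_root_of_unity (T := T) k)
    (continuous_eigenFluctuation hq hd hE hO k) (eigenFluctuation_add_one hq hd hE hO k)
    (A := fun y => T.leftVec k 0 ⬝ᵥ (T.boxSum (⌊y⌋₊ + 1) - T.boxSum 1))
    ((measurable_from_nat (f := fun n => T.leftVec k 0 ⬝ᵥ (T.boxSum (n + 1) - T.boxSum 1))).comp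
      Nat.measurable_floor)
    (fun a ha => exists_norm_boxSum_sub_main_le hq hd hE hO k ha)
  exact ⟨F, fun z hz => (hF1 z hz).trans (dotProduct_dirichletSeries hq hd T hz _).symm, hF2⟩

end Fluctuation

end DigitTransducer

/-! ### Fourier coefficients, Bernstein's theorem, quasi-periodic functions. -/

section Fourier

open MeasureTheory Set

variable {p : ℝ} {f : ℝ → ℂ} {k : ℤ}

/-- The `k`-th Fourier coefficient of a `p`-periodic function. -/
noncomputable def periodicCoeff (p : ℝ) (f : ℝ → ℂ) (k : ℤ) : ℂ :=
  (p : ℂ)⁻¹ * ∫ x in (0 : ℝ)..p, f x * Complex.exp (-(2 * Real.pi * Complex.I * k / p * x))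

theorem fourierCoeffOn_eq_periodicCoeff (hp : 0 < p) (f : ℝ → ℂ) (k : ℤ) :
    fourierCoeffOn hp f k = periodicCoeff p f k := by
  rw [fourierCoeffOn_eq_integral, periodicCoeff, sub_zero, Complex.real_smul]
  push_cast
  rw [one_div]
  congr 1
  refine intervalIntegral.integral_congr fun x _ => ?_
  simp only [fourier_coe_apply, smul_eq_mul]
  rw [mul_comm]
  congr 2
  push_cast
  ring

theorem hasSum_sq_periodicCoeff (hp : 0 < p) (hf : Continuous f) :
    HasSum (fun k => ‖periodicCoeff p f k‖ ^ 2) (p⁻¹ * ∫ x in (0 : ℝ)..p, ‖f x‖ ^ 2) := by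
  have hL : MemLp f 2 (volume.restrict (Ioc 0 p)) := by
    obtain ⟨B, hB⟩ := (isCompact_Icc (a := (0 : ℝ)) (b := p)).exists_bound_of_continuousOn
      hf.continuousOn
    refine MemLp.of_bound hf.aestronglyMeasurable B ?_
    filter_upwards [ae_restrict_mem measurableSet_Ioc] with x hx
    exact hB x ⟨hx.1.le, hx.2⟩
  have h := hasSum_sq_fourierCoeffOn hp hL
  simp only [fourierCoeffOn_eq_periodicCoeff, sub_zero, smul_eq_mul] at h
  exact h

theorem periodicCoeff_shift_sub (hf : Continuous f) (hper : Function.Periodic f p) (hp : p ≠ 0)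
    (t : ℝ) (k : ℤ) :
    periodicCoeff p (fun x => f (x + t) - f x) k
      = (Complex.exp (2 * Real.pi * Complex.I * k / p * t) - 1) * periodicCoeff p f k := by
  set G : ℝ → ℂ := fun x => f x * Complex.exp (-(2 * Real.pi * Complex.I * k / p * x)) with hG
  have hGc : Continuous G := by rw [hG]; fun_prop
  have hGp : Function.Periodic G p := fun x => by
    have hpc : (p : ℂ) ≠ 0 := by exact_mod_cast hp
    simp only [hG, hper x]
    congr 1
    rw [show -(2 * Real.pi * Complex.I * k / p * (x + p : ℝ) : ℂ)
      = -(2 * Real.pi * Complex.I * k / p * x) + ((-k : ℤ) : ℂ) * (2 * Real.pi * Complex.I) by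
        push_cast; field_simp; ring, Complex.exp_periodic.int_mul (-k) _]
  have h1 : ∫ x in (0 : ℝ)..p, f (x + t) * Complex.exp (-(2 * Real.pi * Complex.I * k / p * x))
      = Complex.exp (2 * Real.pi * Complex.I * k / p * t) * ∫ x in (0 : ℝ)..p, G x := by
    have h2 : ∫ x in (0 : ℝ)..p, G x = ∫ x in (0 : ℝ)..p, G (x + t) := by
      rw [intervalIntegral.integral_comp_add_right, add_comm p t, zero_add]
      simpa using hGp.intervalIntegral_add_eq 0 t
    rw [h2, ← intervalIntegral.integral_const_mul]
    refine intervalIntegral.integral_congr fun x _ => ?_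
    simp only [hG]
    rw [mul_left_comm, ← Complex.exp_add]
    congr 2
    push_cast
    ring
  rw [periodicCoeff, periodicCoeff]
  have h3 : ∫ x in (0 : ℝ)..p, (f (x + t) - f x)
        * Complex.exp (-(2 * Real.pi * Complex.I * k / p * x))
      = (∫ x in (0 : ℝ)..p, f (x + t) * Complex.exp (-(2 * Real.pi * Complex.I * k / p * x)))
        - ∫ x in (0 : ℝ)..p, G x := by
    rw [← intervalIntegral.integral_sub]
    · refine intervalIntegral.integral_congr fun x _ => ?_
      simp only [hG, sub_mul]
    · exact Continuous.intervalIntegrable (by fun_prop) _ _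
    · exact hGc.intervalIntegrable _ _
  rw [h3, h1]
  ring

theorem one_le_norm_exp_sub_one {θ : ℝ} (h1 : Real.pi / 2 ≤ |θ|) (h2 : |θ| ≤ Real.pi) :
    1 ≤ ‖Complex.exp (θ * Complex.I) - 1‖ := by
  have hc : Real.cos θ ≤ 0 := by
    rw [← Real.cos_abs]
    exact Real.cos_nonpos_of_pi_div_two_le_of_le h1 (by linarith [Real.pi_pos])
  have h3 : (Complex.exp (θ * Complex.I) - 1).re = Real.cos θ - 1 := by
    rw [Complex.sub_re, Complex.exp_ofReal_mul_I_re, Complex.one_re]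
  have h4 := Complex.abs_re_le_norm (Complex.exp (θ * Complex.I) - 1)
  rw [h3, abs_of_nonpos (by linarith)] at h4
  linarith

/-- Parseval for `f(x + t) - f(x)`. With `t = p / 2^(j+2)` the frequencies `2^j ≤ |k| < 2^(j+1)` are
rotated by an angle between `π/2` and `π`, so their coefficients are multiplied by a factor of
modulus at least 1. -/
theorem sum_sq_periodicCoeff_le {D α : ℝ} (hp : 0 < p) (hα : 0 < α)
    (hper : Function.Periodic f p) (hf : ∀ x y, ‖f x - f y‖ ≤ D * |x - y| ^ α) (j : ℕ)
    (S : Finset ℤ) (hS : ∀ k ∈ S, k ≠ 0 ∧ Nat.log 2 k.natAbs = j) :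
    ∑ k ∈ S, ‖periodicCoeff p f k‖ ^ 2 ≤ (D * (p / 2 ^ (j + 2)) ^ α) ^ 2 := by
  have hfc := DigitTransducer.continuous_of_norm_sub_le_rpow hα hf
  set t : ℝ := p / 2 ^ (j + 2) with ht
  have ht0 : 0 < t := by positivity
  have hsq := hasSum_sq_periodicCoeff (f := fun x => f (x + t) - f x) hp (by fun_prop)
  have hint : p⁻¹ * ∫ x in (0 : ℝ)..p, ‖f (x + t) - f x‖ ^ 2 ≤ (D * t ^ α) ^ 2 := by
    have h1 : ∫ x in (0 : ℝ)..p, ‖f (x + t) - f x‖ ^ 2 ≤ ∫ x in (0 : ℝ)..p, (D * t ^ α) ^ 2 := by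
      refine intervalIntegral.integral_mono_on hp.le
        (Continuous.intervalIntegrable (by fun_prop) _ _)
        (Continuous.intervalIntegrable (by fun_prop) _ _) fun x _ => ?_
      have h2 := hf (x + t) x
      rw [add_sub_cancel_left, abs_of_pos ht0] at h2
      gcongr
    rw [intervalIntegral.integral_const, sub_zero, smul_eq_mul] at h1
    calc _ ≤ p⁻¹ * (p * (D * t ^ α) ^ 2) := by gcongr
      _ = _ := by field_simp
  refine le_trans ?_ hint
  refine le_trans (Finset.sum_le_sum fun k hk => ?_) (sum_le_hasSum S (fun k _ => by positivity) hsq)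
  rw [periodicCoeff_shift_sub hfc hper hp.ne', norm_mul, mul_pow]
  obtain ⟨hk0, hkj⟩ := hS k hk
  have hlow : (2 : ℝ) ^ j ≤ |(k : ℝ)| := by
    have := Nat.pow_log_le_self 2 (Int.natAbs_ne_zero.2 hk0)
    rw [hkj] at this
    rw [← Int.cast_abs, Int.abs_eq_natAbs]
    exact_mod_cast this
  have hupp : |(k : ℝ)| ≤ 2 ^ (j + 1) := by
    have := Nat.lt_pow_succ_log_self one_lt_two k.natAbs
    rw [hkj] at this
    rw [← Int.cast_abs, Int.abs_eq_natAbs]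
    exact_mod_cast this.le
  have hθ : (2 * Real.pi * Complex.I * k / p * t : ℂ)
      = ((Real.pi * (k / 2 ^ (j + 1)) : ℝ) : ℂ) * Complex.I := by
    have hpc : (p : ℂ) ≠ 0 := by exact_mod_cast hp.ne'
    rw [ht]
    push_cast
    field_simp
    ring
  have hone : 1 ≤ ‖Complex.exp (2 * Real.pi * Complex.I * k / p * t) - 1‖ := by
    rw [hθ]
    refine one_le_norm_exp_sub_one ?_ ?_ <;>
      rw [abs_mul, abs_of_pos Real.pi_pos, abs_div, abs_of_pos (by positivity : (0 : ℝ) < 2 ^ (j + 1))]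
    · rw [div_eq_mul_inv]
      refine mul_le_mul_of_nonneg_left ?_ Real.pi_pos.le
      rw [le_div_iff₀ (by positivity), pow_succ]
      linarith
    · exact mul_le_of_le_one_right Real.pi_pos.le ((div_le_one (by positivity)).2 hupp)
  exact le_mul_of_one_le_left (by positivity) (one_le_pow₀ hone)

/-- Cauchy–Schwarz on a dyadic block of at most `2^(j+2)` frequencies; the resulting ratio
`2^(1/2-α)` is where `α > 1/2` becomes necessary. -/
theorem sum_norm_periodicCoeff_le {D α : ℝ} (hp : 0 < p) (hα : 0 < α) (hD : 0 ≤ D)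
    (hper : Function.Periodic f p) (hf : ∀ x y, ‖f x - f y‖ ≤ D * |x - y| ^ α) (j : ℕ)
    (S : Finset ℤ) (hS : ∀ k ∈ S, k ≠ 0 ∧ Nat.log 2 k.natAbs = j) :
    ∑ k ∈ S, ‖periodicCoeff p f k‖ ≤ D * p ^ α * ((2 : ℝ) ^ (1 / 2 - α)) ^ (j + 2) := by
  have hcard : (S.card : ℝ) ≤ 2 ^ (j + 2) := by
    have h1 : S ⊆ Finset.Ioo (-2 ^ (j + 1) : ℤ) (2 ^ (j + 1)) := fun k hk => by
      obtain ⟨-, hkj⟩ := hS k hk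
      have := Nat.lt_pow_succ_log_self one_lt_two k.natAbs
      rw [hkj] at this
      rw [Finset.mem_Ioo, ← abs_lt, Int.abs_eq_natAbs]
      exact_mod_cast this
    have h2 := Finset.card_le_card h1
    rw [Int.card_Ioo] at h2
    have h3 : ((2 : ℤ) ^ (j + 1) - -2 ^ (j + 1) - 1).toNat ≤ 2 ^ (j + 2) := by
      rw [Int.toNat_le]
      push_cast
      rw [pow_succ (2 : ℤ) (j + 1)]
      linarith
    exact_mod_cast h2.trans h3
  have hsq := sum_sq_periodicCoeff_le hp hα hper hf j S hS
  have hcs := sq_sum_le_card_mul_sum_sq (s := S) (f := fun k => ‖periodicCoeff p f k‖)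
  refine le_of_sq_le_sq ?_ (by positivity)
  have h2 : (0 : ℝ) < 2 ^ (j + 2) := by positivity
  calc _ ≤ (S.card : ℝ) * ∑ k ∈ S, ‖periodicCoeff p f k‖ ^ 2 := hcs
    _ ≤ 2 ^ (j + 2) * (D * (p / 2 ^ (j + 2)) ^ α) ^ 2 := by gcongr
    _ = _ := by
      rw [← Real.rpow_natCast (2 ^ (1 / 2 - α) : ℝ), ← Real.rpow_mul (by norm_num),
        mul_comm (1 / 2 - α), Real.rpow_mul (by norm_num), Real.rpow_natCast,
        Real.rpow_sub h2, Real.div_rpow hp.le h2.le, ← Real.sqrt_eq_rpow]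
      have h3 := Real.sq_sqrt h2.le
      field_simp
      rw [h3, mul_comm]

/-- Bernstein's theorem on the absolute convergence of Fourier series. -/
theorem summable_norm_periodicCoeff {D α : ℝ} (hp : 0 < p) (hα : 1 / 2 < α) (hD : 0 ≤ D)
    (hper : Function.Periodic f p) (hf : ∀ x y, ‖f x - f y‖ ≤ D * |x - y| ^ α) :
    Summable fun k => ‖periodicCoeff p f k‖ := by
  set ρ : ℝ := (2 : ℝ) ^ (1 / 2 - α) with hρ
  have hρ0 : 0 ≤ ρ := by positivity
  have hρ1 : ρ < 1 := Real.rpow_lt_one_of_one_lt_of_neg (by norm_num) (by linarith)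
  have hsum : Summable fun j : ℕ => D * p ^ α * ρ ^ (j + 2) :=
    ((summable_nat_add_iff 2).2 (summable_geometric_of_lt_one hρ0 hρ1)).mul_left _
  refine summable_of_sum_le (fun _ => norm_nonneg _)
    (c := ‖periodicCoeff p f 0‖ + ∑' j : ℕ, D * p ^ α * ρ ^ (j + 2)) fun S => ?_
  calc ∑ k ∈ S, ‖periodicCoeff p f k‖
      ≤ ∑ k ∈ insert 0 S, ‖periodicCoeff p f k‖ :=
        Finset.sum_le_sum_of_subset_of_nonneg (Finset.subset_insert _ _) fun _ _ _ => norm_nonneg _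
    _ = ‖periodicCoeff p f 0‖ + ∑ k ∈ (insert 0 S).erase 0, ‖periodicCoeff p f k‖ :=
        (Finset.add_sum_erase _ _ (Finset.mem_insert_self _ _)).symm
    _ ≤ _ := ?_
  gcongr
  set S' := (insert 0 S).erase 0 with hS'
  rw [← Finset.sum_fiberwise_of_maps_to (t := S'.image fun k => Nat.log 2 k.natAbs)
    (g := fun k => Nat.log 2 k.natAbs) fun k hk => Finset.mem_image_of_mem _ hk]
  refine le_trans (Finset.sum_le_sum fun j _ => ?_)
    (hsum.sum_le_tsum (S'.image fun k => Nat.log 2 k.natAbs) fun j _ => by positivity)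
  refine sum_norm_periodicCoeff_le hp (by linarith) hD hper hf j _ fun k hk => ?_
  obtain ⟨h1, h2⟩ := Finset.mem_filter.1 hk
  exact ⟨Finset.ne_of_mem_erase h1, h2⟩

theorem tendstoUniformly_fourier_series (hp : 0 < p) (hfc : Continuous f)
    (hper : Function.Periodic f p) (hs : Summable fun k => ‖periodicCoeff p f k‖) :
    TendstoUniformly (fun (S : Finset ℤ) (x : ℝ) => ∑ k ∈ S, periodicCoeff p f k *
      Complex.exp (2 * Real.pi * Complex.I * k / p * x)) f atTop := by
  have : Fact (0 < p) := ⟨hp⟩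
  have hcont : Continuous hper.lift := continuous_quot_lift _ hfc
  set g : C(AddCircle p, ℂ) := ⟨hper.lift, hcont⟩ with hg
  have hcoeff : ∀ k, fourierCoeff g k = periodicCoeff p f k := fun k => by
    rw [fourierCoeff_eq_intervalIntegral _ _ 0, zero_add, periodicCoeff, Complex.real_smul]
    push_cast
    rw [one_div]
    congr 1
    refine intervalIntegral.integral_congr fun x _ => ?_
    simp only [fourier_coe_apply, smul_eq_mul, hg, ContinuousMap.coe_mk, Function.Periodic.lift_coe]
    rw [mul_comm]
    congr 2
    push_cast
    ring
  have hsum : Summable (fourierCoeff g) := by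
    rw [show fourierCoeff g = periodicCoeff p f from funext hcoeff]
    exact hs.of_norm
  have h := hasSum_fourier_series_of_summable hsum
  have h2 := (ContinuousMap.tendsto_iff_tendstoUniformly.1 h).comp fun x : ℝ => (x : AddCircle p)
  rw [SummationFilter.unconditional_filter] at h2
  refine (tendstoUniformly_congr (Eventually.of_forall fun S => funext fun x => ?_)).mp h2
  simp only [Function.comp, ContinuousMap.coe_sum, Finset.sum_apply, ContinuousMap.coe_smul,
    Pi.smul_apply, smul_eq_mul, hcoeff, fourier_coe_apply]
  refine Finset.sum_congr rfl fun k _ => ?_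
  congr 2
  ring

theorem exp_eq_one_iff_dvd {n : ℕ} (hn : 0 < n) (m : ℤ) :
    Complex.exp (2 * Real.pi * Complex.I * m / n) = 1 ↔ (n : ℤ) ∣ m := by
  have hnc : (n : ℂ) ≠ 0 := by exact_mod_cast hn.ne'
  have hpi : (2 * Real.pi * Complex.I : ℂ) ≠ 0 := Complex.two_pi_I_ne_zero
  rw [Complex.exp_eq_one_iff]
  constructor
  · rintro ⟨j, hj⟩
    refine ⟨j, ?_⟩
    have : (m : ℂ) = n * j := by
      field_simp at hj
      linear_combination hj
    exact_mod_cast this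
  · rintro ⟨j, rfl⟩
    refine ⟨j, ?_⟩
    push_cast
    field_simp

/-- The integrals over the `n` unit intervals form a geometric progression whose ratio is an `n`-th
root of unity, equal to 1 exactly when `n ∣ l - k`. -/
theorem periodicCoeff_of_quasiPeriodic {n : ℕ} (hn : 0 < n) {l : ℤ} (hfc : Continuous f)
    (hf : ∀ x, f (x + 1) = Complex.exp (2 * Real.pi * Complex.I * l / n) * f x) (k : ℤ) :
    periodicCoeff n f k = if (n : ℤ) ∣ l - k then
      ∫ x in (0 : ℝ)..1, f x * Complex.exp (-(2 * Real.pi * Complex.I * k / n * x)) else 0 := by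
  have hnc : (n : ℂ) ≠ 0 := by exact_mod_cast hn.ne'
  set G : ℝ → ℂ := fun x => f x * Complex.exp (-(2 * Real.pi * Complex.I * k / n * x)) with hG
  have hGc : Continuous G := by rw [hG]; fun_prop
  set ζ : ℂ := Complex.exp (2 * Real.pi * Complex.I * (l - k : ℤ) / n) with hζ
  have hG1 : ∀ x, G (x + 1) = ζ * G x := fun x => by
    simp only [hG, hf, hζ]
    rw [show -(2 * Real.pi * Complex.I * k / n * (x + 1 : ℝ) : ℂ)
      = -(2 * Real.pi * Complex.I * k / n * x) + -(2 * Real.pi * Complex.I * k / n) by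
        push_cast; ring, show (2 * Real.pi * Complex.I * (l - k : ℤ) / n : ℂ)
      = 2 * Real.pi * Complex.I * l / n + -(2 * Real.pi * Complex.I * k / n) by push_cast; ring,
      Complex.exp_add, Complex.exp_add]
    ring
  have hGj : ∀ j : ℕ, ∫ x in (j : ℝ)..(j + 1 : ℕ), G x = ζ ^ j * ∫ x in (0 : ℝ)..1, G x := by
    intro j
    induction j with
    | zero => simp
    | succ j ih =>
      have h1 : ∫ x in ((j + 1 : ℕ) : ℝ)..((j + 1 + 1 : ℕ) : ℝ), G x
          = ∫ x in (j : ℝ)..(j + 1 : ℕ), G (x + 1) := by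
        rw [intervalIntegral.integral_comp_add_right]
        push_cast
        rfl
      rw [h1]
      simp only [hG1]
      rw [intervalIntegral.integral_const_mul, ih, pow_succ]
      ring
  have hsum : ∫ x in (0 : ℝ)..n, G x
      = (∑ j ∈ Finset.range n, ζ ^ j) * ∫ x in (0 : ℝ)..1, G x := by
    have h1 := intervalIntegral.sum_integral_adjacent_intervals (f := G) (a := fun j : ℕ => (j : ℝ))
      (n := n) (μ := volume) fun j _ => hGc.intervalIntegrable _ _
    rw [Nat.cast_zero] at h1
    rw [← h1, Finset.sum_mul]
    exact Finset.sum_congr rfl fun j _ => hGj j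
  have hgoal : periodicCoeff n f k
      = (n : ℂ)⁻¹ * ((∑ j ∈ Finset.range n, ζ ^ j) * ∫ x in (0 : ℝ)..1, G x) := by
    rw [← hsum, periodicCoeff]
    push_cast
    rfl
  rw [hgoal]
  split_ifs with h
  · rw [show ζ = 1 from (exp_eq_one_iff_dvd hn _).2 h]
    simp only [one_pow, Finset.sum_const, Finset.card_range, nsmul_eq_mul, mul_one]
    rw [inv_mul_cancel_left₀ hnc]
  · have hζ1 : ζ ≠ 1 := fun h' => h ((exp_eq_one_iff_dvd hn _).1 h')
    have hζn : ζ ^ n = 1 := by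
      rw [hζ, ← Complex.exp_nat_mul, mul_div_cancel₀ _ hnc]
      rw [mul_comm, Complex.exp_int_mul_two_pi_mul_I]
    rw [geom_sum_eq hζ1, hζn, sub_self, zero_div, zero_mul, mul_zero]

theorem periodicCoeff_add {g : ℝ → ℂ} (hf : Continuous f) (hg : Continuous g) (k : ℤ) :
    periodicCoeff p (fun x => f x + g x) k = periodicCoeff p f k + periodicCoeff p g k := by
  rw [periodicCoeff, periodicCoeff, periodicCoeff, ← mul_add, ← intervalIntegral.integral_add]
  · simp only [add_mul]
  · exact Continuous.intervalIntegrable (by fun_prop) _ _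
  · exact Continuous.intervalIntegrable (by fun_prop) _ _

theorem periodicCoeff_sum {ι : Type*} (S : Finset ι) {g : ι → ℝ → ℂ} (hg : ∀ i, Continuous (g i))
    (k : ℤ) : periodicCoeff p (fun x => ∑ i ∈ S, g i x) k = ∑ i ∈ S, periodicCoeff p (g i) k := by
  simp only [periodicCoeff]
  rw [← Finset.mul_sum, ← intervalIntegral.integral_finsetSum]
  · simp only [Finset.sum_mul]
  · exact fun i _ => Continuous.intervalIntegrable (by have := hg i; fun_prop) _ _

/-- A continuous periodic function is determined by its asymptotic values at `log_q N`. -/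
theorem eq_zero_of_tendsto_logb {q n : ℕ} (hq : 2 ≤ q) (hn : 0 < n) (hfc : Continuous f)
    (hper : Function.Periodic f n)
    (h : Tendsto (fun N : ℕ => f (Real.logb q N)) atTop (𝓝 0)) : f = 0 := by
  funext x
  have hq0 : (0 : ℝ) < q := by positivity
  have hq1 : (1 : ℝ) < q := by exact_mod_cast hq
  -- Modulo the period, `log_q ⌊y j⌋` is `x + log_q (⌊y j⌋ / y j)`, which tends to `x`.
  set y : ℕ → ℝ := fun j => (q : ℝ) ^ (x + j * n) with hy
  have hytop : Tendsto y atTop atTop := by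
    have h1 : Tendsto (fun j : ℕ => x + (j : ℝ) * n) atTop atTop :=
      tendsto_atTop_add_const_left _ _
        (tendsto_natCast_atTop_atTop.atTop_mul_const (by exact_mod_cast hn))
    exact (tendsto_rpow_atTop_of_base_gt_one _ hq1).comp h1
  have hfl : Tendsto (fun j => ⌊y j⌋₊) atTop atTop := tendsto_nat_floor_atTop.comp hytop
  have h1 := h.comp hfl
  have h2 : ∀ j, f (Real.logb q ⌊y j⌋₊) = f (x + Real.logb q (⌊y j⌋₊ / y j)) ∨ ⌊y j⌋₊ = 0 := by
    intro j
    by_cases h0 : ⌊y j⌋₊ = 0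
    · exact Or.inr h0
    left
    have hyj : 0 < y j := Real.rpow_pos_of_pos hq0 _
    have hlog : Real.logb q (y j) = x + j * n := Real.logb_rpow hq0 hq1.ne'
    rw [Real.logb_div (by exact_mod_cast h0) hyj.ne', hlog,
      ← hper.nat_mul j (x + (Real.logb q ⌊y j⌋₊ - (x + j * n)))]
    congr 1
    ring
  have h3 : Tendsto (fun j => (⌊y j⌋₊ : ℝ) / y j) atTop (𝓝 1) :=
    (tendsto_nat_floor_div_atTop (R := ℝ)).comp hytop
  have h4 : Tendsto (fun j => f (x + Real.logb q (⌊y j⌋₊ / y j))) atTop (𝓝 (f x)) := by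
    have h5 : Tendsto (fun j => x + Real.logb q (⌊y j⌋₊ / y j)) atTop (𝓝 (x + Real.logb q 1)) :=
      tendsto_const_nhds.add ((Real.continuousAt_logb one_ne_zero).tendsto.comp h3)
    rw [Real.logb_one, add_zero] at h5
    exact (hfc.tendsto x).comp h5
  refine tendsto_nhds_unique h4 (h1.congr' ?_)
  filter_upwards [hfl.eventually (eventually_ne_atTop 0)] with j hj
  exact (h2 j).resolve_right hj

end Fourier

/-! ### Asymptotics of the expectation. -/

namespace DigitTransducer

section Expectation

variable {q d : ℕ} [NeZero q] {σ : Type*} [Fintype σ] [DecidableEq σ] {T : DigitTransducer q d σ}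

/-- Induction on `N` for all iterates of `r` at once: a recursion step replaces `N` by `⌊N/q⌋` and
adds one iterate, which gains the factor `θ / q^δ < 1`. -/
theorem exists_norm_remainder_dotProduct_le (hq : 2 ≤ q) (hd : 1 ≤ d) (T : DigitTransducer q d σ)
    {E K : σ → ℂ} (hE : (T.matrix 0).mulVec E = (q : ℂ) ^ d • E)
    (hO : T.outSum = (q : ℂ) ^ d • E + ((q : ℂ) ^ d • K - (T.matrix 0).mulVec K))
    {r : σ → ℂ} {θ B δ : ℝ} (hθ : 0 < θ) (hθδ : θ < (q : ℝ) ^ δ) (hδ : (d : ℝ) - 1 < δ)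
    (hr : ∀ j : ℕ, ‖(((T.matrix 0).vecMulLinear : Module.End ℂ (σ → ℂ)) ^ j) r‖ ≤ B * θ ^ j) :
    ∃ C : ℝ, 0 ≤ C ∧ ∀ N : ℕ, ‖r ⬝ᵥ T.normalizedSum E K N‖ ≤ C * (N : ℝ) ^ δ := by
  have hd' : (1 : ℝ) ≤ d := by exact_mod_cast hd
  have hδ0 : 0 < δ := by linarith
  have hq0 : (0 : ℝ) < q := by positivity
  obtain ⟨C, hC0, hC⟩ := T.exists_norm_normalizedSum_sub_mulVec_le hq hd hE hO hδ
  set L : Module.End ℂ (σ → ℂ) := (T.matrix 0).vecMulLinear with hL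
  set κ : ℝ := θ / (q : ℝ) ^ δ with hκ
  have hqδ : 0 < (q : ℝ) ^ δ := Real.rpow_pos_of_pos hq0 δ
  have hκ1 : κ < 1 := (div_lt_one hqδ).2 hθδ
  have hB0 : 0 ≤ B := by simpa using (norm_nonneg _).trans (hr 0)
  set P : ℝ := Fintype.card σ * B * (C * 2 ^ δ) with hP
  have hP0 : 0 ≤ P := by positivity
  -- The fixed point of `A ↦ A κ + P`, so that the constant reproduces itself in the induction.
  set A : ℝ := P / (1 - κ) with hA
  have hA0 : 0 ≤ A := div_nonneg hP0 (by linarith)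
  have hAP : A * κ + P = A := by
    have h1 : 1 - κ ≠ 0 := by linarith
    rw [hA]
    field_simp
    ring
  have key : ∀ N j : ℕ, ‖(L ^ j) r ⬝ᵥ T.normalizedSum E K N‖ ≤ A * θ ^ j * (N : ℝ) ^ δ := by
    intro N
    induction N using Nat.strong_induction_on with
    | _ N ih =>
      intro j
      rcases Nat.eq_zero_or_pos N with rfl | hN
      · rw [normalizedSum_zero hd, dotProduct_zero, norm_zero]
        positivity
      have hN1 : (1 : ℝ) ≤ N := by exact_mod_cast hN
      have hsplit : (L ^ j) r ⬝ᵥ T.normalizedSum E K N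
          = (L ^ (j + 1)) r ⬝ᵥ T.normalizedSum E K (N / q)
            + (L ^ j) r ⬝ᵥ (T.normalizedSum E K N
              - (T.matrix 0).mulVec (T.normalizedSum E K (N / q))) := by
        rw [dotProduct_sub, Matrix.dotProduct_mulVec, pow_succ', Module.End.mul_apply]
        simp only [hL, Matrix.vecMulLinear_apply]
        ring
      have h1 := ih (N / q) (Nat.div_lt_self hN hq) (j + 1)
      have h2 : ((N / q : ℕ) : ℝ) ^ δ ≤ (N : ℝ) ^ δ / (q : ℝ) ^ δ := by
        rw [← Real.div_rpow (by positivity) hq0.le]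
        exact Real.rpow_le_rpow (by positivity) Nat.cast_div_le hδ0.le
      have h3 : ((N : ℝ) + 1) ^ δ ≤ 2 ^ δ * (N : ℝ) ^ δ := by
        rw [← Real.mul_rpow (by norm_num) (by linarith)]
        exact Real.rpow_le_rpow (by linarith) (by linarith) hδ0.le
      have h4 : ∑ s, ‖(L ^ j) r s‖ ≤ Fintype.card σ * (B * θ ^ j) := by
        refine (Finset.sum_le_sum fun s _ => (norm_le_pi_norm _ s).trans (hr j)).trans ?_
        rw [Finset.sum_const, nsmul_eq_mul, Finset.card_univ]
      have h5 : ‖(L ^ j) r ⬝ᵥ (T.normalizedSum E K N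
          - (T.matrix 0).mulVec (T.normalizedSum E K (N / q)))‖ ≤ P * θ ^ j * (N : ℝ) ^ δ := by
        refine (Matrix.norm_dotProduct_le _ _).trans ?_
        calc _ ≤ (Fintype.card σ * (B * θ ^ j)) * (C * (2 ^ δ * (N : ℝ) ^ δ)) :=
              mul_le_mul h4 ((hC N).trans (mul_le_mul_of_nonneg_left h3 hC0)) (norm_nonneg _)
                (by positivity)
          _ = _ := by rw [hP]; ring
      rw [hsplit]
      calc _ ≤ A * θ ^ (j + 1) * ((N : ℝ) ^ δ / (q : ℝ) ^ δ) + P * θ ^ j * (N : ℝ) ^ δ :=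
            (norm_add_le _ _).trans (add_le_add (h1.trans (by gcongr)) h5)
        _ = (A * κ + P) * θ ^ j * (N : ℝ) ^ δ := by rw [hκ, pow_succ]; ring
        _ = _ := by rw [hAP]
  exact ⟨A, hA0, fun N => by simpa using key N 0⟩

theorem expectation_eq_boxSum (T : DigitTransducer q d σ) (N : ℕ) :
    (T.expectation N : ℂ) = T.boxSum N T.init / (N : ℂ) ^ d := by
  rw [expectation, boxSum]
  push_cast
  congr 1
  refine Finset.sum_nbij (fun n i => (n i : ℕ)) (fun n _ => ?_) (fun n _ m _ h => ?_)
    (fun n hn => ?_) (fun n _ => rfl)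
  · exact mem_box.2 fun i => (n i).2
  · exact funext fun i => Fin.ext (congrFun h i)
  · have h := mem_box.1 (Finset.mem_coe.1 hn)
    exact ⟨fun i => ⟨n i, h i⟩, Finset.mem_coe.2 (Finset.mem_univ _), rfl⟩

/-- The complex form of the fluctuation of the expectation. -/
noncomputable def totalFluctuation (T : DigitTransducer q d σ) (E K : σ → ℂ) (x : ℝ) : ℂ :=
  K T.init + ∑ l ∈ Finset.range T.finalPeriod, T.eigenFluctuation E K l x

/-- The normalized sum is paired with the spectral decomposition of the initial indicator vector.
Any `δ < d` above both `d - 1` and `log_q θ` bounds all errors by `N^δ`. -/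
theorem exists_norm_expectation_sub_le (hq : 2 ≤ q) (hd : 1 ≤ d) (T : DigitTransducer q d σ)
    {E K : σ → ℂ} (hE : (T.matrix 0).mulVec E = (q : ℂ) ^ d • E)
    (hO : T.outSum = (q : ℂ) ^ d • E + ((q : ℂ) ^ d • K - (T.matrix 0).mulVec K)) :
    ∃ ξ C : ℝ, 0 < ξ ∧ ∀ N : ℕ, 1 ≤ N →
      ‖(T.expectation N : ℂ) - E T.init * (Real.logb q N : ℂ)
        - T.totalFluctuation E K (Real.logb q N)‖ ≤ C * (N : ℝ) ^ (-ξ) := by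
  have hd' : (1 : ℝ) ≤ d := by exact_mod_cast hd
  have hq1 : (1 : ℝ) < q := by exact_mod_cast hq
  obtain ⟨r, θ, B, hθ0, hθ, hr, hsingle⟩ := T.exists_spectral_decomposition
  have hlog : Real.logb q θ < d := by
    rw [Real.logb_lt_iff_lt_rpow hq1 hθ0, Real.rpow_natCast]
    exact hθ
  obtain ⟨δ, hδ1, hδ2⟩ := exists_between (max_lt (sub_one_lt (d : ℝ)) hlog)
  have hδ : (d : ℝ) - 1 < δ := (le_max_left _ _).trans_lt hδ1
  have hθδ : θ < (q : ℝ) ^ δ :=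
    (Real.logb_lt_iff_lt_rpow hq1 hθ0).1 ((le_max_right _ _).trans_lt hδ1)
  obtain ⟨C, hC0, hC⟩ := T.exists_norm_remainder_dotProduct_le hq hd hE hO hθ0 hθδ hδ hr
  have hl := fun l : ℕ => exists_norm_sub_eigenFluctuation_le hq hd hE hO (l : ℤ) hδ hδ2
  choose D hD0 hD using hl
  refine ⟨d - δ, ∑ l ∈ Finset.range T.finalPeriod, D l + C, by linarith, fun N hN => ?_⟩
  have hN1 : (1 : ℝ) ≤ N := by exact_mod_cast hN
  have hN0 : (0 : ℝ) < N := by linarith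
  have hNd : ((N : ℂ) ^ d) ≠ 0 := pow_ne_zero _ (by exact_mod_cast hN0.ne')
  set G := T.normalizedSum E K N with hG
  have hinit : G T.init = ∑ l ∈ Finset.range T.finalPeriod, T.leftVec l 0 ⬝ᵥ G + r ⬝ᵥ G := by
    have h1 : (Pi.single T.init 1 : σ → ℂ) ⬝ᵥ G = G T.init := by
      rw [single_dotProduct, one_mul]
    rw [← h1, hsingle, add_dotProduct, sum_dotProduct]
  have hbox : T.boxSum N T.init = (N : ℂ) ^ d * (Real.logb q N : ℂ) * E T.init
      + (N : ℂ) ^ d * K T.init + G T.init := by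
    simp only [hG, normalizedSum, Pi.sub_apply, Pi.smul_apply, smul_eq_mul]
    ring
  have hkey : (N : ℂ) ^ d * ((T.expectation N : ℂ) - E T.init * (Real.logb q N : ℂ)
        - T.totalFluctuation E K (Real.logb q N))
      = ∑ l ∈ Finset.range T.finalPeriod, (T.leftVec l 0 ⬝ᵥ G
        - fluctuationTerm q d (T.eigenFluctuation E K l) N) + r ⬝ᵥ G := by
    rw [expectation_eq_boxSum, mul_sub, mul_sub, mul_div_cancel₀ _ hNd, hbox, hinit,
      totalFluctuation, Finset.sum_sub_distrib, mul_add, Finset.mul_sum]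
    simp only [fluctuationTerm, Complex.ofReal_natCast]
    ring
  have hbound : ‖(N : ℂ) ^ d * ((T.expectation N : ℂ) - E T.init * (Real.logb q N : ℂ)
        - T.totalFluctuation E K (Real.logb q N))‖
      ≤ (∑ l ∈ Finset.range T.finalPeriod, D l + C) * (N : ℝ) ^ δ := by
    rw [hkey, add_mul, Finset.sum_mul]
    refine (norm_add_le _ _).trans (add_le_add ((norm_sum_le _ _).trans
      (Finset.sum_le_sum fun l _ => ?_)) (hC N))
    have := hD l N hN1
    rwa [Nat.floor_natCast] at this
  rw [norm_mul, norm_pow, Complex.norm_natCast, ← Real.rpow_natCast] at hbound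
  rw [neg_sub, Real.rpow_sub hN0, ← mul_div_assoc, le_div_iff₀ (by positivity), mul_comm]
  exact hbound

end Expectation

end DigitTransducer

/-! ### Periodicity, reality and uniqueness of the fluctuation. -/

namespace DigitTransducer

section TotalFluctuation

variable {q d : ℕ} [NeZero q] {σ : Type*} [Fintype σ] [DecidableEq σ] {T : DigitTransducer q d σ}

theorem rootOfUnity_eq_one_iff (k : ℤ) : T.rootOfUnity k = 1 ↔ (T.finalPeriod : ℤ) ∣ k :=
  exp_eq_one_iff_dvd T.finalPeriod_pos k

theorem rootOfUnity_eq_of_dvd {k l : ℤ} (h : (T.finalPeriod : ℤ) ∣ l - k) :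
    T.rootOfUnity l = T.rootOfUnity k := by
  have h1 := (rootOfUnity_eq_one_iff (T := T) (l - k)).2 h
  have h2 : T.rootOfUnity l = T.rootOfUnity (l - k) * T.rootOfUnity k := by
    simp only [rootOfUnity]
    rw [← Complex.exp_add]
    congr 1
    push_cast
    ring
  rw [h2, h1, one_mul]

theorem leftVec_eq_of_dvd {k l : ℤ} (h : (T.finalPeriod : ℤ) ∣ l - k) :
    T.leftVec l 0 = T.leftVec k 0 := by
  have h1 := rootOfUnity_eq_of_dvd h
  simp only [rootOfUnity] at h1
  rw [leftVec, leftVec, dominantEigenvalues_zero, dominantEigenvalues_zero, h1]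

theorem eigenFluctuation_eq_of_dvd (E K : σ → ℂ) {k l : ℤ} (h : (T.finalPeriod : ℤ) ∣ l - k) :
    T.eigenFluctuation E K l = T.eigenFluctuation E K k := by
  rw [eigenFluctuation, eigenFluctuation, rootOfUnity_eq_of_dvd h, leftVec_eq_of_dvd h]

variable {E K : σ → ℂ}

theorem periodic_totalFluctuation (hq : 2 ≤ q) (hd : 1 ≤ d)
    (hE : (T.matrix 0).mulVec E = (q : ℂ) ^ d • E)
    (hO : T.outSum = (q : ℂ) ^ d • E + ((q : ℂ) ^ d • K - (T.matrix 0).mulVec K)) :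
    Function.Periodic (T.totalFluctuation E K) T.finalPeriod := by
  intro x
  have hstep : ∀ (l : ℤ) (n : ℕ), T.eigenFluctuation E K l (x + n)
      = T.rootOfUnity l ^ n * T.eigenFluctuation E K l x := by
    intro l n
    induction n with
    | zero => simp
    | succ n ih =>
      rw [Nat.cast_succ, ← add_assoc, eigenFluctuation_add_one hq hd hE hO, ih, pow_succ]
      ring
  have hp : (T.finalPeriod : ℂ) ≠ 0 := by exact_mod_cast T.finalPeriod_pos.ne'
  have hpow : ∀ l : ℤ, T.rootOfUnity l ^ T.finalPeriod = 1 := fun l => by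
    rw [rootOfUnity, ← Complex.exp_nat_mul, mul_div_cancel₀ _ hp, mul_comm,
      Complex.exp_int_mul_two_pi_mul_I]
  simp only [totalFluctuation, hstep, hpow, one_mul]

theorem exists_norm_totalFluctuation_sub_le (hq : 2 ≤ q) (hd : 1 ≤ d)
    (hE : (T.matrix 0).mulVec E = (q : ℂ) ^ d • E)
    (hO : T.outSum = (q : ℂ) ^ d • E + ((q : ℂ) ^ d • K - (T.matrix 0).mulVec K))
    {α : ℝ} (hα0 : 0 < α) (hα1 : α < 1) : ∃ D : ℝ, 0 ≤ D ∧ ∀ x y,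
      ‖T.totalFluctuation E K x - T.totalFluctuation E K y‖ ≤ D * |x - y| ^ α := by
  have hl := fun l : ℕ => exists_norm_eigenFluctuation_sub_le hq hd hE hO (l : ℤ) hα0 hα1
  choose D hD0 hD using hl
  refine ⟨∑ l ∈ Finset.range T.finalPeriod, D l, Finset.sum_nonneg fun l _ => hD0 l,
    fun x y => ?_⟩
  rw [totalFluctuation, totalFluctuation, add_sub_add_left_eq_sub, ← Finset.sum_sub_distrib,
    Finset.sum_mul]
  exact (norm_sum_le _ _).trans (Finset.sum_le_sum fun l _ => hD l x y)

theorem continuous_totalFluctuation (hq : 2 ≤ q) (hd : 1 ≤ d)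
    (hE : (T.matrix 0).mulVec E = (q : ℂ) ^ d • E)
    (hO : T.outSum = (q : ℂ) ^ d • E + ((q : ℂ) ^ d • K - (T.matrix 0).mulVec K)) :
    Continuous (T.totalFluctuation E K) :=
  continuous_const.add (continuous_finsetSum _ fun l _ =>
    continuous_eigenFluctuation hq hd hE hO l)

/-- The main term of the expectation is real. -/
theorem im_eq_zero (hq : 2 ≤ q) (hd : 1 ≤ d)
    (hE : (T.matrix 0).mulVec E = (q : ℂ) ^ d • E)
    (hO : T.outSum = (q : ℂ) ^ d • E + ((q : ℂ) ^ d • K - (T.matrix 0).mulVec K)) :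
    (E T.init).im = 0 ∧ ∀ x, (T.totalFluctuation E K x).im = 0 := by
  have hq1 : (1 : ℝ) < q := by exact_mod_cast hq
  obtain ⟨ξ, C, hξ, hC⟩ := T.exists_norm_expectation_sub_le hq hd hE hO
  have hc := continuous_totalFluctuation hq hd hE hO
  have hper := periodic_totalFluctuation hq hd hE hO
  have h0 : Tendsto (fun N : ℕ => C * (N : ℝ) ^ (-ξ)) atTop (𝓝 0) := by
    have := ((tendsto_rpow_neg_atTop hξ).comp tendsto_natCast_atTop_atTop).const_mul C
    simpa using this
  -- The expectation is real, so the imaginary part of the main terms tends to 0. Dividing by `log_q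
  -- N` isolates `Im E_init`, and then the periodic part vanishes.
  have him : Tendsto (fun N : ℕ => (E T.init).im * Real.logb q N
      + (T.totalFluctuation E K (Real.logb q N)).im) atTop (𝓝 0) := by
    refine squeeze_zero_norm' ?_ h0
    filter_upwards [eventually_ge_atTop 1] with N hN
    refine le_trans ?_ (hC N hN)
    have h1 := Complex.abs_im_le_norm ((T.expectation N : ℂ) - E T.init * (Real.logb q N : ℂ)
        - T.totalFluctuation E K (Real.logb q N))
    rw [Complex.sub_im, Complex.sub_im, Complex.ofReal_im, Complex.im_mul_ofReal, zero_sub,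
      ← neg_add', abs_neg] at h1
    exact h1
  have hlog : Tendsto (fun N : ℕ => Real.logb q N) atTop atTop :=
    (Real.tendsto_logb_atTop hq1).comp tendsto_natCast_atTop_atTop
  have hzero : (E T.init).im = 0 := by
    obtain ⟨B, hB⟩ : ∃ B, ∀ x, ‖T.totalFluctuation E K x‖ ≤ B := by
      obtain ⟨B, hB⟩ := (isCompact_Icc (a := (0 : ℝ)) (b := T.finalPeriod)).exists_bound_of_continuousOn
        hc.continuousOn
      refine ⟨B, fun x => ?_⟩
      obtain ⟨y, hy, hxy⟩ := hper.exists_mem_Ico₀ (by exact_mod_cast T.finalPeriod_pos) x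
      rw [hxy]
      exact hB y ⟨hy.1, hy.2.le⟩
    have hdiv : Tendsto (fun N : ℕ => (E T.init).im
        + (T.totalFluctuation E K (Real.logb q N)).im / Real.logb q N) atTop (𝓝 0) := by
      have h1 : Tendsto (fun N : ℕ => ((E T.init).im * Real.logb q N
        + (T.totalFluctuation E K (Real.logb q N)).im) * (Real.logb q N)⁻¹) atTop (𝓝 (0 * 0)) :=
        him.mul (tendsto_inv_atTop_zero.comp hlog)
      rw [mul_zero] at h1
      refine h1.congr' ?_
      filter_upwards [hlog.eventually (eventually_gt_atTop 0)] with N hN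
      field_simp
    have hsmall : Tendsto (fun N : ℕ => (T.totalFluctuation E K (Real.logb q N)).im
        / Real.logb q N) atTop (𝓝 0) := by
      have h1 : Tendsto (fun N : ℕ => B / Real.logb q N) atTop (𝓝 0) :=
        tendsto_const_nhds.div_atTop hlog
      refine squeeze_zero_norm' ?_ h1
      filter_upwards [hlog.eventually (eventually_gt_atTop 0)] with N hN
      rw [norm_div, Real.norm_of_nonneg hN.le]
      exact div_le_div_of_nonneg_right ((Complex.abs_im_le_norm _).trans (hB _)) hN.le
    have h2 := (tendsto_const_nhds (x := (E T.init).im) (f := (atTop : Filter ℕ))).add hsmall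
    rw [add_zero] at h2
    exact tendsto_nhds_unique h2 hdiv
  refine ⟨hzero, ?_⟩
  simp only [hzero, zero_mul, zero_add] at him
  have h3 := eq_zero_of_tendsto_logb (f := fun x => ((T.totalFluctuation E K x).im : ℂ)) hq
    T.finalPeriod_pos (Complex.continuous_ofReal.comp (Complex.continuous_im.comp hc))
    (fun x => by simp only [hper x])
    (by
      have := (Complex.continuous_ofReal.tendsto 0).comp him
      rwa [Complex.ofReal_zero] at this)
  intro x
  have h4 : ((T.totalFluctuation E K x).im : ℂ) = 0 := congrFun h3 x
  exact_mod_cast h4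

theorem tendsto_rpow_neg_mul_log {ξ : ℝ} (hξ : 0 < ξ) :
    Tendsto (fun N : ℕ => (N : ℝ) ^ (-ξ) * Real.log N) atTop (𝓝 0) := by
  have h := (isLittleO_log_rpow_atTop hξ).tendsto_div_nhds_zero
  refine (h.comp tendsto_natCast_atTop_atTop).congr fun N => ?_
  simp only [Function.comp]
  rw [Real.rpow_neg (Nat.cast_nonneg N), div_eq_inv_mul]

theorem isFluctuation_re_totalFluctuation (hq : 2 ≤ q) (hd : 1 ≤ d)
    (hE : (T.matrix 0).mulVec E = (q : ℂ) ^ d • E)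
    (hO : T.outSum = (q : ℂ) ^ d • E + ((q : ℂ) ^ d • K - (T.matrix 0).mulVec K))
    (he : E T.init = T.meanConstant) :
    T.IsFluctuation fun x => (T.totalFluctuation E K x).re := by
  have hre : ∀ x, ((T.totalFluctuation E K x).re : ℂ) = T.totalFluctuation E K x := fun x =>
    Complex.ext (by simp) (by simp [(im_eq_zero hq hd hE hO).2 x])
  refine ⟨fun x => by simp only [periodic_totalFluctuation hq hd hE hO x], ?_, ?_⟩
  · obtain ⟨D, hD0, hD⟩ := exists_norm_totalFluctuation_sub_le hq hd hE hO
      (α := 1 / 2) (by norm_num) (by norm_num)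
    lift D to ℝ≥0 using hD0
    refine ⟨D, 1 / 2, by norm_num, fun x y => ?_⟩
    rw [edist_nndist, edist_nndist, ← ENNReal.coe_rpow_of_nonneg _ (by norm_num), ← ENNReal.coe_mul,
      ENNReal.coe_le_coe, ← NNReal.coe_le_coe]
    push_cast
    rw [Real.dist_eq, Real.dist_eq, ← Complex.sub_re]
    exact (Complex.abs_re_le_norm _).trans (by simpa using hD x y)
  · obtain ⟨ξ, C, hξ, hC⟩ := T.exists_norm_expectation_sub_le hq hd hE hO
    refine ⟨ξ, hξ, IsBigO.of_bound C ?_⟩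
    filter_upwards [eventually_ge_atTop 3] with N hN
    have hN3 : (3 : ℝ) ≤ N := by exact_mod_cast hN
    have hlog : 1 ≤ Real.log N := by
      rw [Real.le_log_iff_exp_le (by linarith)]
      exact Real.exp_one_lt_three.le.trans hN3
    rw [hre, ← he]
    have h1 := hC N (by lia)
    have hC0 : 0 ≤ C :=
      nonneg_of_mul_nonneg_left ((norm_nonneg _).trans h1) (Real.rpow_pos_of_pos (by linarith) _)
    refine h1.trans (mul_le_mul_of_nonneg_left ?_ hC0)
    rw [Real.norm_of_nonneg (by positivity)]
    exact le_mul_of_one_le_right (by positivity) hlog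

/-- The difference is continuous, periodic and tends to 0 along `log_q N`. -/
theorem IsFluctuation.eq (hq : 2 ≤ q) {Ψ Ψ' : ℝ → ℝ} (h : T.IsFluctuation Ψ)
    (h' : T.IsFluctuation Ψ') : Ψ = Ψ' := by
  obtain ⟨hp, ⟨C, α, hα, hh⟩, ξ, hξ, hO⟩ := h
  obtain ⟨hp', ⟨C', α', hα', hh'⟩, ξ', hξ', hO'⟩ := h'
  have hc := hh.continuous hα
  have hc' := hh'.continuous hα'
  have t1 := hO.trans_tendsto (tendsto_rpow_neg_mul_log hξ)
  have t2 := hO'.trans_tendsto (tendsto_rpow_neg_mul_log hξ')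
  have t3 := t2.sub t1
  have h3 := eq_zero_of_tendsto_logb (f := fun x => (Ψ x : ℂ) - Ψ' x) hq T.finalPeriod_pos
    (by fun_prop) (fun x => by simp only [hp x, hp' x]) (by
      rw [sub_zero] at t3
      refine t3.congr fun N => ?_
      ring)
  funext x
  have := congrFun h3 x
  exact_mod_cast sub_eq_zero.1 this

end TotalFluctuation

/-! ### Fourier coefficients of the fluctuation and location of the poles. -/

section Coefficients

variable {q d : ℕ} [NeZero q] {σ : Type*} [Fintype σ] [DecidableEq σ] {T : DigitTransducer q d σ}

theorem periodicCoeff_const {p : ℝ} (hp : 0 < p) (c : ℂ) (k : ℤ) :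
    periodicCoeff p (fun _ => c) k = if k = 0 then c else 0 := by
  have hpc : (p : ℂ) ≠ 0 := by exact_mod_cast hp.ne'
  split_ifs with h
  · rw [periodicCoeff, h]
    simp only [Int.cast_zero, mul_zero, zero_div, zero_mul, neg_zero, Complex.exp_zero, mul_one,
      intervalIntegral.integral_const, sub_zero, Complex.real_smul]
    rw [inv_mul_cancel_left₀ hpc]
  · have hk : (k : ℂ) ≠ 0 := by exact_mod_cast h
    have hne : -(2 * Real.pi * Complex.I * k / p : ℂ) ≠ 0 :=
      neg_ne_zero.2 (div_ne_zero (mul_ne_zero Complex.two_pi_I_ne_zero hk) hpc)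
    have h1 := integral_exp_mul_complex (a := 0) (b := p) hne
    have h2 : Complex.exp (-(2 * Real.pi * Complex.I * k / p) * p) = 1 := by
      rw [neg_mul, div_mul_cancel₀ _ hpc, ← mul_neg, mul_comm, ← Int.cast_neg,
        Complex.exp_int_mul_two_pi_mul_I]
    rw [h2, Complex.ofReal_zero, mul_zero, Complex.exp_zero, sub_self, zero_div] at h1
    simp only [periodicCoeff, ← neg_mul]
    rw [intervalIntegral.integral_const_mul, h1, mul_zero, mul_zero]

/-- Only the summand with `l ≡ k` modulo `p` has frequency `k`. -/
theorem periodicCoeff_totalFluctuation (hq : 2 ≤ q) (hd : 1 ≤ d) {E K : σ → ℂ}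
    (hE : (T.matrix 0).mulVec E = (q : ℂ) ^ d • E)
    (hO : T.outSum = (q : ℂ) ^ d • E + ((q : ℂ) ^ d • K - (T.matrix 0).mulVec K)) (k : ℤ) :
    periodicCoeff T.finalPeriod (T.totalFluctuation E K) k
      = (if k = 0 then K T.init else 0) + ∫ x in (0 : ℝ)..1, T.eigenFluctuation E K k x
        * Complex.exp (-(2 * Real.pi * Complex.I * k / T.finalPeriod * x)) := by
  have hc := fun l : ℕ => continuous_eigenFluctuation hq hd hE hO (l : ℤ)
  have hp := T.finalPeriod_pos
  have hpZ : (0 : ℤ) < T.finalPeriod := by exact_mod_cast hp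
  have h1 : periodicCoeff T.finalPeriod (T.totalFluctuation E K) k
      = periodicCoeff T.finalPeriod (fun _ => K T.init) k
        + ∑ l ∈ Finset.range T.finalPeriod,
          periodicCoeff T.finalPeriod (T.eigenFluctuation E K l) k := by
    rw [← periodicCoeff_sum _ hc, ← periodicCoeff_add continuous_const
      (continuous_finsetSum _ fun l _ => hc l)]
    rfl
  rw [h1, periodicCoeff_const (by exact_mod_cast hp)]
  congr 1
  have hl₀ : (((k % T.finalPeriod).toNat : ℕ) : ℤ) = k % T.finalPeriod :=
    Int.toNat_of_nonneg (Int.emod_nonneg _ hpZ.ne')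
  have hdvd : (T.finalPeriod : ℤ) ∣ ((k % T.finalPeriod).toNat : ℕ) - k := by
    rw [hl₀, Int.emod_def]
    exact ⟨-(k / T.finalPeriod), by ring⟩
  have hlt : (k % T.finalPeriod).toNat < T.finalPeriod := by
    have := Int.emod_lt_of_pos k hpZ
    lia
  rw [Finset.sum_eq_single_of_mem (k % T.finalPeriod).toNat (Finset.mem_range.2 hlt)]
  · rw [periodicCoeff_of_quasiPeriodic hp (hc _) (eigenFluctuation_add_one hq hd hE hO _),
      if_pos hdvd, eigenFluctuation_eq_of_dvd E K hdvd]
  · intro l hl hne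
    rw [periodicCoeff_of_quasiPeriodic hp (hc _) (eigenFluctuation_add_one hq hd hE hO _),
      if_neg]
    intro h
    refine hne ?_
    have h2 := dvd_sub h hdvd
    rw [sub_sub_sub_cancel_right] at h2
    have h3 := Finset.mem_range.1 hl
    have h4 := Int.eq_zero_of_abs_lt_dvd h2 (by rw [abs_lt]; lia)
    lia

theorem fourierCoefficient_eq_periodicCoeff (Ψ : ℝ → ℝ) (k : ℤ) :
    T.fourierCoefficient Ψ k = periodicCoeff T.finalPeriod (fun x => (Ψ x : ℂ)) k := by
  simp only [fourierCoefficient, periodicCoeff, Complex.ofReal_natCast]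

theorem rootOfUnity_mul_cpow (k : ℤ) (z : ℂ) :
    T.rootOfUnity k * (q : ℂ) ^ ((d : ℂ) - z)
      = Complex.exp (2 * Real.pi * Complex.I * k / T.finalPeriod + ((d : ℂ) - z) * Real.log q) := by
  have hqc : (q : ℂ) ≠ 0 := NeZero.ne _
  rw [rootOfUnity, Complex.cpow_def_of_ne_zero hqc, ← Complex.natCast_log, Complex.exp_add,
    mul_comm (Real.log q : ℂ)]

theorem chi_mul_log (hq : 2 ≤ q) (k : ℤ) :
    T.chi k * Real.log q = 2 * Real.pi * Complex.I * k / T.finalPeriod := by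
  have hL : (Real.log q : ℂ) ≠ 0 := by
    exact_mod_cast (Real.log_pos (by exact_mod_cast hq : (1 : ℝ) < q)).ne'
  have hp : (T.finalPeriod : ℂ) ≠ 0 := by exact_mod_cast T.finalPeriod_pos.ne'
  rw [chi]
  field_simp

theorem chi_eq_zero_iff (hq : 2 ≤ q) (k : ℤ) : T.chi k = 0 ↔ k = 0 := by
  constructor
  · intro h
    have h1 := chi_mul_log (T := T) hq k
    have hp : (T.finalPeriod : ℂ) ≠ 0 := by exact_mod_cast T.finalPeriod_pos.ne'
    rw [h, zero_mul, eq_comm, div_eq_zero_iff, or_iff_left hp, mul_eq_zero,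
      or_iff_right Complex.two_pi_I_ne_zero] at h1
    exact_mod_cast h1
  · rintro rfl
    simp [chi]

theorem re_chi (k : ℤ) : (T.chi k).re = 0 := by
  have : T.chi k = ((2 * Real.pi * k / (T.finalPeriod * Real.log q) : ℝ) : ℂ) * Complex.I := by
    rw [chi]
    push_cast
    ring
  rw [this, Complex.re_ofReal_mul, Complex.I_re, mul_zero]

/-- The exponent is a multiple `2πi n`, and `n` shifts `k` by a multiple of `p`. -/
theorem exists_eq_add_chi (hq : 2 ≤ q) {k : ℤ} {z : ℂ}
    (h : T.rootOfUnity k * (q : ℂ) ^ ((d : ℂ) - z) = 1) :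
    ∃ m : ℤ, m ≡ k [ZMOD T.finalPeriod] ∧ z = d + T.chi m := by
  have hL : (Real.log q : ℂ) ≠ 0 := by
    exact_mod_cast (Real.log_pos (by exact_mod_cast hq : (1 : ℝ) < q)).ne'
  have hp : (T.finalPeriod : ℂ) ≠ 0 := by exact_mod_cast T.finalPeriod_pos.ne'
  rw [rootOfUnity_mul_cpow, Complex.exp_eq_one_iff] at h
  obtain ⟨n, hn⟩ := h
  refine ⟨k - T.finalPeriod * n, ?_, ?_⟩
  · exact (Int.modEq_iff_dvd.2 ⟨n, by ring⟩)
  · have h1 := chi_mul_log (T := T) hq (k - T.finalPeriod * n)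
    refine mul_right_cancel₀ hL ?_
    rw [add_mul, h1]
    simp only [Int.cast_sub, Int.cast_mul, Int.cast_natCast]
    field_simp at hn ⊢
    linear_combination -hn

theorem rootOfUnity_mul_cpow_chi (hq : 2 ≤ q) (k : ℤ) :
    T.rootOfUnity k * (q : ℂ) ^ ((d : ℂ) - (d + T.chi k)) = 1 := by
  rw [rootOfUnity_mul_cpow, sub_add_cancel_left, neg_mul, chi_mul_log hq, add_neg_cancel,
    Complex.exp_zero]

end Coefficients

end DigitTransducer

/-! ### The main theorem. -/

theorem theorem2 {σ : Type*} [Fintype σ] [DecidableEq σ] (q d : ℕ) [NeZero q]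
    (hq : 2 ≤ q) (hd : 1 ≤ d) (T : DigitTransducer q d σ)
    (hacc : ∀ s, T.Reachable T.init s) :
    -- the derivatives at `t = 0` that enter `e_T` and the formula for `c_0` exist
    (∀ C ∈ T.finalComponents, DifferentiableAt ℝ (T.dominantEigenvalue C) 0) ∧
    DifferentiableAt ℝ (T.leftVec 0) 0 ∧
    -- the Dirichlet series converges absolutely for `Re z > d`
    (∀ z : ℂ, (d : ℝ) < z.re → ∀ s, Summable (T.dirichletTerm z s)) ∧
    -- the periodic fluctuation is well defined
    (∃! Ψ : ℝ → ℝ, T.IsFluctuation Ψ) ∧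
    ∀ Ψ : ℝ → ℝ, T.IsFluctuation Ψ →
      -- `F k` is the meromorphic continuation of `w_kᵀ H` to `Re z > d - 1`
      (∃ F : ℤ → ℂ → ℂ,
        (∀ k : ℤ,
          (∀ z : ℂ, (d : ℝ) < z.re → F k z = T.leftVec k 0 ⬝ᵥ T.dirichletSeries z) ∧
          MeromorphicOn (F k) {z : ℂ | (d : ℝ) - 1 < z.re} ∧
          -- location and order of the possible poles
          (∀ z : ℂ, (d : ℝ) - 1 < z.re → z ≠ d →
            (∀ m : ℤ, m ≡ k [ZMOD T.finalPeriod] → z ≠ d + T.chi m) → AnalyticAt ℂ (F k) z) ∧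
          (-2 : ℤ) ≤ meromorphicOrderAt (F k) d ∧
          (¬ (T.finalPeriod : ℤ) ∣ k → (-1 : ℤ) ≤ meromorphicOrderAt (F k) d) ∧
          (∀ m : ℤ, m ≠ 0 → (-1 : ℤ) ≤ meromorphicOrderAt (F k) (d + T.chi m))) ∧
        -- the Fourier coefficients
        ∃ ρ : ℤ → ℂ, (∀ k : ℤ, HasResidueAt (F k) (d + T.chi k) (ρ k)) ∧
          T.fourierCoefficient Ψ 0 =
            -T.meanConstant / (d * Real.log q)
              - Complex.I * (deriv (T.leftVec 0) 0 ⬝ᵥ fun _ => 1) + 1 / d * ρ 0 ∧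
          ∀ k : ℤ, k ≠ 0 → T.fourierCoefficient Ψ k = 1 / (d + T.chi k) * ρ k) ∧
      -- the Fourier series converges absolutely, and uniformly to the fluctuation
      (Summable fun k : ℤ => ‖T.fourierCoefficient Ψ k‖) ∧
      TendstoUniformly
        (fun (S : Finset ℤ) (x : ℝ) => ∑ k ∈ S, T.fourierCoefficient Ψ k *
          Complex.exp (2 * Real.pi * Complex.I * k / T.finalPeriod * x))
        (fun x => (Ψ x : ℂ)) atTop := by
  obtain ⟨hdiff, hdiff0, E, K, hE, hO, he, hK, hK0⟩ := T.exists_mean_decomposition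
  have hfl := T.isFluctuation_re_totalFluctuation hq hd hE hO he
  have hp : (0 : ℝ) < T.finalPeriod := by exact_mod_cast T.finalPeriod_pos
  have hd0 : (d : ℂ) ≠ 0 := by exact_mod_cast (by lia : d ≠ 0)
  have hL : (Real.log q : ℂ) ≠ 0 := by
    exact_mod_cast (Real.log_pos (by exact_mod_cast hq : (1 : ℝ) < q)).ne'
  refine ⟨hdiff, hdiff0, fun z hz s => T.summable_dirichletTerm hq hd hz s,
    ⟨_, hfl, fun Ψ hΨ => hΨ.eq hq hfl⟩, fun Ψ hΨ => ?_⟩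
  have hΨc : (fun x => (Ψ x : ℂ)) = T.totalFluctuation E K := by
    rw [hΨ.eq hq hfl]
    exact funext fun x => Complex.ext (by simp)
      (by simp [(DigitTransducer.im_eq_zero hq hd hE hO).2 x])
  have hcoeff : ∀ k, T.fourierCoefficient Ψ k
      = periodicCoeff T.finalPeriod (T.totalFluctuation E K) k := fun k => by
    rw [T.fourierCoefficient_eq_periodicCoeff, hΨc]
  have hcoeff' := fun k => (hcoeff k).trans (T.periodicCoeff_totalFluctuation hq hd hE hO k)
  -- Any exponent strictly between `1/2` and 1 would serve for Bernstein's theorem.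
  obtain ⟨D, hD0, hD⟩ := T.exists_norm_totalFluctuation_sub_le hq hd hE hO
    (α := 3 / 4) (by norm_num) (by norm_num)
  have hper := T.periodic_totalFluctuation hq hd hE hO
  have hsum := summable_norm_periodicCoeff hp (by norm_num) hD0 hper hD
  refine ⟨?_, by simpa only [hcoeff] using hsum, ?_⟩
  · choose F hF1 hF2 using T.exists_dirichletSeries_continuation hq hd hE hO
    have hre : ∀ m : ℤ, (d : ℝ) - 1 < ((d : ℂ) + T.chi m).re := fun m => by
      rw [Complex.add_re, T.re_chi, add_zero, Complex.natCast_re]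
      linarith
    have hred : (d : ℝ) - 1 < (d : ℂ).re := by
      rw [Complex.natCast_re]
      linarith
    have hchi : ∀ m : ℤ, m ≠ 0 → (d : ℂ) + T.chi m ≠ d := fun m hm h =>
      hm ((T.chi_eq_zero_iff hq m).1 (by simpa using h))
    have hne : ∀ m : ℤ, (d : ℂ) + T.chi m ≠ 0 := fun m h => by
      have h1 := congrArg Complex.re h
      rw [Complex.add_re, T.re_chi, add_zero, Complex.natCast_re, Complex.zero_re] at h1
      exact hd0 (by exact_mod_cast h1)
    -- At `z = d + χ_k` the integral in the residue is the Fourier integral of frequency `k`.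
    have hint : ∀ k : ℤ, ∫ x in (0 : ℝ)..1, T.eigenFluctuation E K k x
          * Complex.exp (((d : ℂ) - (d + T.chi k)) * Real.log q * x)
        = ∫ x in (0 : ℝ)..1, T.eigenFluctuation E K k x
          * Complex.exp (-(2 * Real.pi * Complex.I * k / T.finalPeriod * x)) := fun k => by
      simp only [sub_add_cancel_left, neg_mul, T.chi_mul_log hq]
    refine ⟨F, fun k => ⟨hF1 k, fun z hz => (hF2 k z hz).2.neg_two_le_order.1, fun z hz hzd hzm => ?_,
      (hF2 k d hred).2.neg_two_le_order.2, fun hk => ?_, fun m hm => ?_⟩, _,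
      fun k => (hF2 k _ (hre k)).2.hasResidueAt, ?_, fun k hk => ?_⟩
    · refine (hF2 k z hz).1 hzd fun h => ?_
      obtain ⟨m, hm, hzm'⟩ := T.exists_eq_add_chi hq h
      exact hzm m hm hzm'
    -- For `p ∤ k` the coefficient of the double pole is a multiple of `w_k · E = 0`.
    · have h := (hF2 k d hred).2
      rw [T.leftVec_dotProduct_eq_zero_of_harmonic hk hE] at h
      simp only [zero_mul, zero_div, ite_self] at h
      exact h.neg_one_le_order
    · have h := (hF2 k _ (hre m)).2
      rw [if_neg (hchi m hm), if_neg (hchi m hm)] at h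
      exact h.neg_one_le_order
    -- As `w_0 · E = e_T` and `w_0 · K = 0`, the residue divided by `d` is `e_T / (d log q)` plus
    -- the mean of `Φ_0`; the remaining part of `c_0` is `K_init = -i w_0' · 1`.
    · have h0 : T.chi 0 = 0 := (T.chi_eq_zero_iff hq 0).2 rfl
      rw [hcoeff' 0, if_pos (T.rootOfUnity_mul_cpow_chi hq 0), hint 0, h0, add_zero, if_pos rfl,
        if_pos rfl, T.leftVec_zero_dotProduct_of_harmonic hE, hK0, he, hK]
      field_simp
      ring
    · rw [hcoeff' k, if_pos (T.rootOfUnity_mul_cpow_chi hq k), hint k, if_neg hk,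
        if_neg (hchi k hk), zero_add, zero_add, one_div, inv_mul_cancel_left₀ (hne k)]
  · have h := tendstoUniformly_fourier_series hp (T.continuous_totalFluctuation hq hd hE hO) hper hsum
    rw [hΨc]
    simpa only [hcoeff, Complex.ofReal_natCast] using h
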